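/- **Conventions.** Double categories $\mathbb D$ are pseudo: objects and arrows, and proarrows and cells, form categories (internal composition), while external composition $\odot$ (diagrammatic order, units $\mathrm{id}_x$; proarrows are written $m:x\nrightarrow y$) is associative and unital up to coherent globular isomorphism. A lax double functor is strictly functorial on arrows and cells and has natural, coherent globular comparisons $Fm\odot Fn\to F(m\odot n)$ and $\mathrm{id}_{Fx}\to F\,\mathrm{id}_x$; it is *normal* if the comparisons $\mathrm{id}_{Fx}\to F\,\mathrm{id}_x$ are invertible. A natural transformation $\alpha:F\Rightarrow G$ of lax double functors has components an arrow $\alpha_x:Fx\to Gx$ for each object and a cell $\alpha_m:Fm\to Gm$ with sides $\alpha_x,\alpha_y$ for each proarrow $m:x\nrightarrow y$, natural in arrows and cells and compatible with the comparisons. *Families and products.* Let $\mathrm{Fam}^*(\mathbb D)$ be the double category in which an object is a family $(x_i)_{i\in I}$ of objects of $\mathbb D$ indexed by a (finite) set; an arrow $(x_i)_{i\in I}\to(y_j)_{j\in J}$ is a function $f_0:J\to I$ with arrows $x_{f_0(j)}\to y_j$; a proarrow $(x_i)_{i\in I}\nrightarrow (y_j)_{j\in J}$ is a (finite) span $I\xleftarrow{\ell}A\xrightarrow{r}J$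 with proarrows $m_a:x_{\ell(a)}\nrightarrow y_{r(a)}$; and a cell from $(m_a)_{a\in A}$ to $(n_b)_{b\in B}$, with given arrows on the two sides, is a map of spans $\phi:B\to A$ over the two functions together with cells $m_{\phi(b)}\to n_b$ of $\mathbb D$ whose sides are the corresponding components of those arrows. External composition is by pullback of spans. Let $\Delta:\mathbb D\to\mathrm{Fam}^*(\mathbb D)$ send everything to the family indexed by a one-element set. $\mathbb D$ has *lax (finite) products* if $\Delta$ has a right adjoint $\prod$ in the 2-category of double categories, lax double functors and natural transformations, and these are *normal* if $\prod$ is normal. Restricting $\prod$ to families of proarrows over identity spans gives, for each (finite) set $I$, a lax double functor $\Pi:\mathbb D^I\to\mathbb D$; the counit gives projections $\pi_i:\Pi\vec x\to x_i$ and projection cells $\pi_i:\Pi\vec m\to m_i$. *Companions and conjoints.* A companion of $f:x\to y$ is a proarrow $f_!:x\nrightarrow y$ with a unit cell $\mathrm{id}_x\to f_!$ (sides $1_x,f$) and a counit cell $f_!\to\mathrm{id}_y$ (sides $f,1_y$) whose internal composite is $\mathrm{id}_f$ and whose external composite is $1_{f_!}$, up to unitors. Dually, a conjoint $f^*:y\nrightarrow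 x$ has a unit $\mathrm{id}_x\to f^*$ (sides $f,1_x$) and a counit $f^*\to\mathrm{id}_y$ (sides $1_y,f$). A cell $\alpha:m\to n$ with left side $f$ and right side $g$ is *reshaped* into globular cells $m\odot g_!\to f_!\odot n$ (the external composite of the unit of $f_!$, $\alpha$ and the counit of $g_!$) and $f^*\odot m\to n\odot g^*$ (the external composite of the counit of $f^*$, $\alpha$ and the unit of $g^*$). *Protransformations.* A lax protransformation $\tau:F\nrightarrow G$ of lax double functors $\mathbb D\to\mathbb E$ consists of proarrows $\tau_x:Fx\nrightarrow Gx$, cells $\tau_f:\tau_x\to\tau_y$ with sides $Ff$ and $Gf$, strictly functorial in the arrow $f:x\to y$, and globular comparison cells $\tau_m:\tau_x\odot Gm\to Fm\odot\tau_y$, natural with respect to cells and compatible with the laxity comparisons of $F$ and $G$. An oplax one has instead comparisons $Fm\odot\tau_y\to\tau_x\odot Gm$. It is pseudo if its comparison cells are invertible (an oplax one is then also lax, by inverting them). $\mathrm{LaxPs}(\mathbb D,\mathbb E)$ is the double category of lax double functors, natural transformations, pseudo protransformations and modifications. **Proposition (Structure proarrows between products).** Let $\mathbb D$ be a double category with normal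 lax (finite) products, and let $f_0:J\to I$ be a function between (finite) sets. For an $I$-indexed family of objects $\vec x$, write $f_0^*\vec x=(x_{f_0(j)})_{j\in J}$, and similarly for families of proarrows. For each $\vec x$ there is a unique arrow $\Pi(f_0)_{\vec x}:\Pi\vec x\to\Pi f_0^*\vec x$ with $\pi_j\circ\Pi(f_0)_{\vec x}=\pi_{f_0(j)}$ for all $j\in J$, and for each $I$-indexed parallel family of proarrows $\vec m:\vec x\nrightarrow \vec y$ there is a unique cell $\Pi(f_0)_{\vec m}:\Pi\vec m\to\Pi f_0^*\vec m$ with $\pi_j\circ\Pi(f_0)_{\vec m}=\pi_{f_0(j)}$ for all $j\in J$; these form a natural transformation $\Pi(f_0):\Pi\Rightarrow\Pi\circ\mathbb D^{f_0}$ of lax double functors $\mathbb D^I\to\mathbb D$, where $\mathbb D^{f_0}:\mathbb D^I\to\mathbb D^J$ is reindexing along $f_0$. Moreover: 1. For each $\vec x$, the structure arrow $\Pi(f_0)_{\vec x}$ has a companion $(\Pi(f_0)_{\vec x})_!:\Pi\vec x\nrightarrow \Pi f_0^*\vec x$ and a conjoint $(\Pi(f_0)_{\vec x})^*:\Pi f_0^*\vec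 x\nrightarrow \Pi\vec x$. 2. For every choice of these companions, the proarrows $(\Pi(f_0)_{\vec x})_!$ and the reshaped structure cells $\Pi\vec m\odot(\Pi(f_0)_{\vec y})_!\to(\Pi(f_0)_{\vec x})_!\odot\Pi f_0^*\vec m$, together with the cells $(\Pi(f_0)_{\vec x})_!\to(\Pi(f_0)_{\vec y})_!$ at arrows $\vec x\to\vec y$ obtained by sliding the structure arrows in the naturality squares of $\Pi(f_0)$, are the components of an oplax protransformation $\Pi(f_0)_!:\Pi\nrightarrow \Pi\circ\mathbb D^{f_0}$. 3. Dually, for every choice of conjoints, the proarrows $(\Pi(f_0)_{\vec x})^*$ and the reshaped structure cells $(\Pi(f_0)_{\vec x})^*\odot\Pi\vec m\to\Pi f_0^*\vec m\odot(\Pi(f_0)_{\vec y})^*$, together with the cells obtained by sliding in the naturality squares, are the components of a lax protransformation $\Pi(f_0)^*:\Pi\circ\mathbb D^{f_0}\nrightarrow \Pi$. 4. If $f_0$ is a bijection, then $\Pi(f_0)_!$ and $\Pi(f_0)^*$ are pseudo and form an adjoint equivalence $\Pi(f_0)_!\dashv\Pi(f_0)^*$ in $\mathrm{LaxPs}(\mathbb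 D^I,\mathbb D)$. -/

import Mathlib

open CategoryTheory

universe w c p v u c₁ p₁ v₁ u₁ c₂ p₂ v₂ u₂ c₃ p₃ v₃ u₃

/-! ## Double categories -/

/-- A (pseudo) double category, that is, a pseudocategory internal to categories. The category of
objects and arrows is `D`; `Pro x y` is the type of proarrows `x ⇸ y`. Proarrows (with arbitrary
ends) are the objects, and cells `Cell m n` the morphisms, of a second category, with the strictly
functorial source and target `src`, `tgt`. So a cell `α : Cell m n` with `m : x ⇸ y`, `n : w ⇸ z`
is a square with top `m`, bottom `n`, left side `src α : x ⟶ w` and right side `tgt α : y ⟶ z`.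
Internal composition `vcomp` is strict, external composition (`pcomp`, `hcomp`, in diagrammatic
order) is associative and unital up to coherent globular isomorphism. -/
class DoubleCategory (D : Type u) [Category.{v} D] where
  Pro : D → D → Type p
  Cell : ∀ {x y w z : D}, Pro x y → Pro w z → Type c
  src : ∀ {x y w z : D} {m : Pro x y} {n : Pro w z}, Cell m n → (x ⟶ w)
  tgt : ∀ {x y w z : D} {m : Pro x y} {n : Pro w z}, Cell m n → (y ⟶ z)
  /-- internal identity cell `1_m` -/
  one : ∀ {x y : D} (m : Pro x y), Cell m m
  /-- internal composition of cells -/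
  vcomp : ∀ {x y x' y' x'' y'' : D} {m : Pro x y} {m' : Pro x' y'} {m'' : Pro x'' y''},
    Cell m m' → Cell m' m'' → Cell m m''
  src_one : ∀ {x y : D} (m : Pro x y), src (one m) = 𝟙 x
  tgt_one : ∀ {x y : D} (m : Pro x y), tgt (one m) = 𝟙 y
  src_vcomp : ∀ {x y x' y' x'' y'' : D} {m : Pro x y} {m' : Pro x' y'} {m'' : Pro x'' y''}
    (α : Cell m m') (β : Cell m' m''), src (vcomp α β) = src α ≫ src β
  tgt_vcomp : ∀ {x y x' y' x'' y'' : D} {m : Pro x y} {m' : Pro x' y'} {m'' : Pro x'' y''}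
    (α : Cell m m') (β : Cell m' m''), tgt (vcomp α β) = tgt α ≫ tgt β
  one_vcomp : ∀ {x y x' y' : D} {m : Pro x y} {m' : Pro x' y'} (α : Cell m m'),
    vcomp (one m) α = α
  vcomp_one : ∀ {x y x' y' : D} {m : Pro x y} {m' : Pro x' y'} (α : Cell m m'),
    vcomp α (one m') = α
  vcomp_assoc : ∀ {x y x' y' x'' y'' x''' y''' : D} {m : Pro x y} {m' : Pro x' y'}
    {m'' : Pro x'' y''} {m''' : Pro x''' y'''}
    (α : Cell m m') (β : Cell m' m'') (γ : Cell m'' m'''),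
    vcomp (vcomp α β) γ = vcomp α (vcomp β γ)
  /-- external identity proarrow `id_x` -/
  pid : ∀ x : D, Pro x x
  /-- external identity cell `id_f` -/
  pidMap : ∀ {x y : D}, (x ⟶ y) → Cell (pid x) (pid y)
  src_pidMap : ∀ {x y : D} (f : x ⟶ y), src (pidMap f) = f
  tgt_pidMap : ∀ {x y : D} (f : x ⟶ y), tgt (pidMap f) = f
  pidMap_id : ∀ x : D, pidMap (𝟙 x) = one (pid x)
  pidMap_comp : ∀ {x y z : D} (f : x ⟶ y) (g : y ⟶ z),
    pidMap (f ≫ g) = vcomp (pidMap f) (pidMap g)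
  /-- external composition of proarrows -/
  pcomp : ∀ {x y z : D}, Pro x y → Pro y z → Pro x z
  /-- external composition of cells -/
  hcomp : ∀ {x y z x' y' z' : D} {m : Pro x y} {n : Pro y z} {m' : Pro x' y'} {n' : Pro y' z'}
    (α : Cell m m') (β : Cell n n'), tgt α = src β → Cell (pcomp m n) (pcomp m' n')
  src_hcomp : ∀ {x y z x' y' z' : D} {m : Pro x y} {n : Pro y z} {m' : Pro x' y'}
    {n' : Pro y' z'} (α : Cell m m') (β : Cell n n') (h : tgt α = src β),
    src (hcomp α β h) = src α
  tgt_hcomp : ∀ {x y z x' y' z' : D} {m : Pro x y} {n : Pro y z} {m' : Pro x' y'}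
    {n' : Pro y' z'} (α : Cell m m') (β : Cell n n') (h : tgt α = src β),
    tgt (hcomp α β h) = tgt β
  hcomp_one : ∀ {x y z : D} (m : Pro x y) (n : Pro y z),
    hcomp (one m) (one n) (by rw [tgt_one, src_one]) = one (pcomp m n)
  vcomp_hcomp : ∀ {x y z x' y' z' x'' y'' z'' : D} {m : Pro x y} {n : Pro y z}
    {m' : Pro x' y'} {n' : Pro y' z'} {m'' : Pro x'' y''} {n'' : Pro y'' z''}
    (α : Cell m m') (β : Cell n n') (h : tgt α = src β)
    (α' : Cell m' m'') (β' : Cell n' n'') (h' : tgt α' = src β'),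
    vcomp (hcomp α β h) (hcomp α' β' h') =
      hcomp (vcomp α α') (vcomp β β') (by rw [tgt_vcomp, src_vcomp, h, h'])
  /-- associator -/
  assoc : ∀ {x y z t : D} (m : Pro x y) (n : Pro y z) (q : Pro z t),
    Cell (pcomp (pcomp m n) q) (pcomp m (pcomp n q))
  assocInv : ∀ {x y z t : D} (m : Pro x y) (n : Pro y z) (q : Pro z t),
    Cell (pcomp m (pcomp n q)) (pcomp (pcomp m n) q)
  src_assoc : ∀ {x y z t : D} (m : Pro x y) (n : Pro y z) (q : Pro z t),
    src (assoc m n q) = 𝟙 x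
  tgt_assoc : ∀ {x y z t : D} (m : Pro x y) (n : Pro y z) (q : Pro z t),
    tgt (assoc m n q) = 𝟙 t
  assoc_assocInv : ∀ {x y z t : D} (m : Pro x y) (n : Pro y z) (q : Pro z t),
    vcomp (assoc m n q) (assocInv m n q) = one _
  assocInv_assoc : ∀ {x y z t : D} (m : Pro x y) (n : Pro y z) (q : Pro z t),
    vcomp (assocInv m n q) (assoc m n q) = one _
  assoc_naturality : ∀ {x y z t x' y' z' t' : D} {m : Pro x y} {n : Pro y z} {q : Pro z t}
    {m' : Pro x' y'} {n' : Pro y' z'} {q' : Pro z' t'}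
    (α : Cell m m') (β : Cell n n') (γ : Cell q q') (h : tgt α = src β) (h' : tgt β = src γ),
    vcomp (hcomp (hcomp α β h) γ (by rw [tgt_hcomp, h'])) (assoc m' n' q') =
      vcomp (assoc m n q) (hcomp α (hcomp β γ h') (by rw [src_hcomp, h]))
  /-- left unitor `id_x ⊙ m ≅ m` -/
  leftUnitor : ∀ {x y : D} (m : Pro x y), Cell (pcomp (pid x) m) m
  leftUnitorInv : ∀ {x y : D} (m : Pro x y), Cell m (pcomp (pid x) m)
  src_leftUnitor : ∀ {x y : D} (m : Pro x y), src (leftUnitor m) = 𝟙 x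
  tgt_leftUnitor : ∀ {x y : D} (m : Pro x y), tgt (leftUnitor m) = 𝟙 y
  leftUnitor_inv : ∀ {x y : D} (m : Pro x y), vcomp (leftUnitor m) (leftUnitorInv m) = one _
  inv_leftUnitor : ∀ {x y : D} (m : Pro x y), vcomp (leftUnitorInv m) (leftUnitor m) = one _
  leftUnitor_naturality : ∀ {x y x' y' : D} {m : Pro x y} {m' : Pro x' y'} (α : Cell m m'),
    vcomp (hcomp (pidMap (src α)) α (tgt_pidMap _)) (leftUnitor m') = vcomp (leftUnitor m) α
  /-- right unitor `m ⊙ id_y ≅ m` -/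
  rightUnitor : ∀ {x y : D} (m : Pro x y), Cell (pcomp m (pid y)) m
  rightUnitorInv : ∀ {x y : D} (m : Pro x y), Cell m (pcomp m (pid y))
  src_rightUnitor : ∀ {x y : D} (m : Pro x y), src (rightUnitor m) = 𝟙 x
  tgt_rightUnitor : ∀ {x y : D} (m : Pro x y), tgt (rightUnitor m) = 𝟙 y
  rightUnitor_inv : ∀ {x y : D} (m : Pro x y), vcomp (rightUnitor m) (rightUnitorInv m) = one _
  inv_rightUnitor : ∀ {x y : D} (m : Pro x y), vcomp (rightUnitorInv m) (rightUnitor m) = one _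
  rightUnitor_naturality : ∀ {x y x' y' : D} {m : Pro x y} {m' : Pro x' y'} (α : Cell m m'),
    vcomp (hcomp α (pidMap (tgt α)) (src_pidMap _).symm) (rightUnitor m') =
      vcomp (rightUnitor m) α
  pentagon : ∀ {x y z t s : D} (m : Pro x y) (n : Pro y z) (q : Pro z t) (r : Pro t s),
    vcomp (hcomp (assoc m n q) (one r) (by rw [tgt_assoc, src_one]))
      (vcomp (assoc m (pcomp n q) r)
        (hcomp (one m) (assoc n q r) (by rw [tgt_one, src_assoc]))) =
      vcomp (assoc (pcomp m n) q r) (assoc m n (pcomp q r))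
  triangle : ∀ {x y z : D} (m : Pro x y) (n : Pro y z),
    vcomp (assoc m (pid y) n)
      (hcomp (one m) (leftUnitor n) (by rw [tgt_one, src_leftUnitor])) =
      hcomp (rightUnitor m) (one n) (by rw [tgt_rightUnitor, src_one])

namespace DoubleCategory

infixr:70 " ⊙ " => DoubleCategory.pcomp
infixr:60 " ≫ᶜ " => DoubleCategory.vcomp

attribute [simp] src_one tgt_one src_vcomp tgt_vcomp one_vcomp vcomp_one vcomp_assoc src_pidMap
  tgt_pidMap pidMap_id src_hcomp tgt_hcomp hcomp_one src_assoc tgt_assoc assoc_assocInv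
  assocInv_assoc src_leftUnitor tgt_leftUnitor leftUnitor_inv inv_leftUnitor src_rightUnitor
  tgt_rightUnitor rightUnitor_inv inv_rightUnitor

variable {D : Type u} [Category.{v} D] [DoubleCategory.{c, p} D]

@[simp] theorem src_assocInv {x y z t : D} (m : Pro x y) (n : Pro y z) (q : Pro z t) :
    src (assocInv m n q) = 𝟙 x := by
  have h := congrArg src (assoc_assocInv m n q)
  rwa [src_vcomp, src_assoc, src_one, Category.id_comp] at h

@[simp] theorem tgt_assocInv {x y z t : D} (m : Pro x y) (n : Pro y z) (q : Pro z t) :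
    tgt (assocInv m n q) = 𝟙 t := by
  have h := congrArg tgt (assoc_assocInv m n q)
  rwa [tgt_vcomp, tgt_assoc, tgt_one, Category.id_comp] at h

@[simp] theorem src_leftUnitorInv {x y : D} (m : Pro x y) : src (leftUnitorInv m) = 𝟙 x := by
  have h := congrArg src (leftUnitor_inv m)
  rwa [src_vcomp, src_leftUnitor, src_one, Category.id_comp] at h

@[simp] theorem tgt_leftUnitorInv {x y : D} (m : Pro x y) : tgt (leftUnitorInv m) = 𝟙 y := by
  have h := congrArg tgt (leftUnitor_inv m)
  rwa [tgt_vcomp, tgt_leftUnitor, tgt_one, Category.id_comp] at h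

@[simp] theorem src_rightUnitorInv {x y : D} (m : Pro x y) : src (rightUnitorInv m) = 𝟙 x := by
  have h := congrArg src (rightUnitor_inv m)
  rwa [src_vcomp, src_rightUnitor, src_one, Category.id_comp] at h

@[simp] theorem tgt_rightUnitorInv {x y : D} (m : Pro x y) : tgt (rightUnitorInv m) = 𝟙 y := by
  have h := congrArg tgt (rightUnitor_inv m)
  rwa [tgt_vcomp, tgt_rightUnitor, tgt_one, Category.id_comp] at h

/-- A cell is invertible if it is an isomorphism in the category of proarrows and cells. -/
def IsInvertible {x y x' y' : D} {m : Pro x y} {m' : Pro x' y'} (α : Cell m m') : Prop :=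
  ∃ β : Cell m' m, α ≫ᶜ β = one m ∧ β ≫ᶜ α = one m'

theorem hcomp_congr {x y z x' y' z' : D} {m : Pro x y} {n : Pro y z} {m' : Pro x' y'}
    {n' : Pro y' z'} {α α' : Cell m m'} {β β' : Cell n n'} (h : tgt α = src β)
    (hα : α = α') (hβ : β = β') : hcomp α β h = hcomp α' β' (hα ▸ hβ ▸ h) := by
  subst hα hβ; rfl

theorem hcomp_vcomp_one {x x' x'' y z : D} {m : Pro x y} {m' : Pro x' y} {m'' : Pro x'' y}
    (α : Cell m m') (β : Cell m' m'') (n : Pro y z) (h : tgt α = src (one n))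
    (h' : tgt β = src (one n)) (h'' : tgt (α ≫ᶜ β) = src (one n)) :
    hcomp (α ≫ᶜ β) (one n) h'' = hcomp α (one n) h ≫ᶜ hcomp β (one n) h' := by
  rw [vcomp_hcomp]
  exact hcomp_congr _ rfl (one_vcomp _).symm

theorem one_hcomp_vcomp {x y z z' z'' : D} {n : Pro y z} {n' : Pro y z'} {n'' : Pro y z''}
    (m : Pro x y) (α : Cell n n') (β : Cell n' n'') (h : tgt (one m) = src α)
    (h' : tgt (one m) = src β) (h'' : tgt (one m) = src (α ≫ᶜ β)) :
    hcomp (one m) (α ≫ᶜ β) h'' = hcomp (one m) α h ≫ᶜ hcomp (one m) β h' := by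
  rw [vcomp_hcomp]
  exact hcomp_congr _ (one_vcomp _).symm rfl

theorem vcomp_reassoc {x₁ y₁ x₂ y₂ x₃ y₃ x₄ y₄ x₅ y₅ : D} {m₁ : Pro x₁ y₁} {m₂ : Pro x₂ y₂}
    {m₃ : Pro x₃ y₃} {m₄ : Pro x₄ y₄} {m₅ : Pro x₅ y₅} {α : Cell m₁ m₂} {β : Cell m₂ m₃}
    {γ : Cell m₁ m₄} {δ : Cell m₄ m₃} (h : α ≫ᶜ β = γ ≫ᶜ δ) (ε : Cell m₃ m₅) :
    α ≫ᶜ β ≫ᶜ ε = γ ≫ᶜ δ ≫ᶜ ε := by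
  rw [← vcomp_assoc, h, vcomp_assoc]

theorem vcomp_hcomp_assoc {x y z x' y' z' x'' y'' z'' s t : D} {m : Pro x y} {n : Pro y z}
    {m' : Pro x' y'} {n' : Pro y' z'} {m'' : Pro x'' y''} {n'' : Pro y'' z''} {r : Pro s t}
    (α : Cell m m') (β : Cell n n') (h : tgt α = src β)
    (α' : Cell m' m'') (β' : Cell n' n'') (h' : tgt α' = src β') (γ : Cell (m'' ⊙ n'') r) :
    hcomp α β h ≫ᶜ hcomp α' β' h' ≫ᶜ γ =
      hcomp (α ≫ᶜ α') (β ≫ᶜ β') (by rw [tgt_vcomp, src_vcomp, h, h']) ≫ᶜ γ := by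
  rw [← vcomp_assoc, vcomp_hcomp]

@[simp] theorem assoc_assocInv_assoc {x y z t s s' : D} (m : Pro x y) (n : Pro y z) (q : Pro z t)
    {r : Pro s s'} (α : Cell ((m ⊙ n) ⊙ q) r) : assoc m n q ≫ᶜ assocInv m n q ≫ᶜ α = α := by
  rw [← vcomp_assoc, assoc_assocInv, one_vcomp]

@[simp] theorem assocInv_assoc_assoc {x y z t s s' : D} (m : Pro x y) (n : Pro y z) (q : Pro z t)
    {r : Pro s s'} (α : Cell (m ⊙ n ⊙ q) r) : assocInv m n q ≫ᶜ assoc m n q ≫ᶜ α = α := by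
  rw [← vcomp_assoc, assocInv_assoc, one_vcomp]

@[simp] theorem leftUnitor_inv_assoc {x y s s' : D} (m : Pro x y)
    {r : Pro s s'} (α : Cell (pid x ⊙ m) r) : leftUnitor m ≫ᶜ leftUnitorInv m ≫ᶜ α = α := by
  rw [← vcomp_assoc, leftUnitor_inv, one_vcomp]

@[simp] theorem inv_leftUnitor_assoc {x y s s' : D} (m : Pro x y)
    {r : Pro s s'} (α : Cell m r) : leftUnitorInv m ≫ᶜ leftUnitor m ≫ᶜ α = α := by
  rw [← vcomp_assoc, inv_leftUnitor, one_vcomp]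

@[simp] theorem rightUnitor_inv_assoc {x y s s' : D} (m : Pro x y)
    {r : Pro s s'} (α : Cell (m ⊙ pid y) r) :
    rightUnitor m ≫ᶜ rightUnitorInv m ≫ᶜ α = α := by
  rw [← vcomp_assoc, rightUnitor_inv, one_vcomp]

@[simp] theorem inv_rightUnitor_assoc {x y s s' : D} (m : Pro x y)
    {r : Pro s s'} (α : Cell m r) : rightUnitorInv m ≫ᶜ rightUnitor m ≫ᶜ α = α := by
  rw [← vcomp_assoc, inv_rightUnitor, one_vcomp]

theorem assocInv_naturality {x y z t x' y' z' t' : D} {m : Pro x y} {n : Pro y z} {q : Pro z t}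
    {m' : Pro x' y'} {n' : Pro y' z'} {q' : Pro z' t'}
    (α : Cell m m') (β : Cell n n') (γ : Cell q q') (h : tgt α = src β) (h' : tgt β = src γ) :
    hcomp α (hcomp β γ h') (by rw [src_hcomp, h]) ≫ᶜ assocInv m' n' q' =
      assocInv m n q ≫ᶜ hcomp (hcomp α β h) γ (by rw [tgt_hcomp, h']) := by
  have := congrArg (fun t => assocInv m n q ≫ᶜ t ≫ᶜ assocInv m' n' q')
    (assoc_naturality α β γ h h')
  simpa using this.symm

theorem leftUnitorInv_naturality {x y x' y' : D} {m : Pro x y} {m' : Pro x' y'}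
    (α : Cell m m') :
    α ≫ᶜ leftUnitorInv m' =
      leftUnitorInv m ≫ᶜ hcomp (pidMap (src α)) α (tgt_pidMap _) := by
  have := congrArg (fun t => leftUnitorInv m ≫ᶜ t ≫ᶜ leftUnitorInv m')
    (leftUnitor_naturality α)
  simpa using this.symm

theorem rightUnitorInv_naturality {x y x' y' : D} {m : Pro x y} {m' : Pro x' y'}
    (α : Cell m m') :
    α ≫ᶜ rightUnitorInv m' =
      rightUnitorInv m ≫ᶜ hcomp α (pidMap (tgt α)) (src_pidMap _).symm := by
  have := congrArg (fun t => rightUnitorInv m ≫ᶜ t ≫ᶜ rightUnitorInv m')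
    (rightUnitor_naturality α)
  simpa using this.symm

/-! ### The underlying bicategory -/

/-- A globular cell between parallel proarrows: both sides are identity arrows. -/
@[ext] structure Globular {x y : D} (m n : Pro x y) where
  cell : Cell m n
  src_cell : src cell = 𝟙 x
  tgt_cell : tgt cell = 𝟙 y

attribute [simp] Globular.src_cell Globular.tgt_cell

variable (D) in
/-- The underlying bicategory: objects, proarrows, and globular cells. -/
def UBicat : Type u := D

instance globularCategory (x y : D) : Category (Pro x y) where
  Hom := Globular
  id m := ⟨one m, by simp, by simp⟩
  comp α β := ⟨α.cell ≫ᶜ β.cell, by simp, by simp⟩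
  id_comp _ := Globular.ext (one_vcomp _)
  comp_id _ := Globular.ext (vcomp_one _)
  assoc _ _ _ := Globular.ext (vcomp_assoc _ _ _)

/-- External composition with an identity cell on the left. -/
def Globular.whiskerLeft {x y z : D} (m : Pro x y) {n n' : Pro y z} (β : Globular n n') :
    Globular (m ⊙ n) (m ⊙ n') :=
  ⟨hcomp (one m) β.cell (by simp), by simp, by simp⟩

/-- External composition with an identity cell on the right. -/
def Globular.whiskerRight {x y z : D} {m m' : Pro x y} (α : Globular m m') (n : Pro y z) :
    Globular (m ⊙ n) (m' ⊙ n) :=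
  ⟨hcomp α.cell (one n) (by simp), by simp, by simp⟩

/-- The associator as an isomorphism of proarrows. -/
def assocIso {x y z t : D} (m : Pro x y) (n : Pro y z) (q : Pro z t) :
    (m ⊙ n) ⊙ q ≅ m ⊙ n ⊙ q where
  hom := ⟨assoc m n q, by simp, by simp⟩
  inv := ⟨assocInv m n q, by simp, by simp⟩
  hom_inv_id := Globular.ext (assoc_assocInv m n q)
  inv_hom_id := Globular.ext (assocInv_assoc m n q)

/-- The left unitor as an isomorphism of proarrows. -/
def leftUnitorIso {x y : D} (m : Pro x y) : pid x ⊙ m ≅ m where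
  hom := ⟨leftUnitor m, by simp, by simp⟩
  inv := ⟨leftUnitorInv m, by simp, by simp⟩
  hom_inv_id := Globular.ext (leftUnitor_inv m)
  inv_hom_id := Globular.ext (inv_leftUnitor m)

/-- The right unitor as an isomorphism of proarrows. -/
def rightUnitorIso {x y : D} (m : Pro x y) : m ⊙ pid y ≅ m where
  hom := ⟨rightUnitor m, by simp, by simp⟩
  inv := ⟨rightUnitorInv m, by simp, by simp⟩
  hom_inv_id := Globular.ext (rightUnitor_inv m)
  inv_hom_id := Globular.ext (inv_rightUnitor m)

namespace Globular

theorem id_whiskerLeft {x y : D} {m m' : Pro x y} (α : m ⟶ m') :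
    hcomp (one (pid x)) α.cell (by simp) =
      leftUnitor m ≫ᶜ α.cell ≫ᶜ leftUnitorInv m' := by
  rw [leftUnitorInv_naturality, leftUnitor_inv_assoc]
  exact hcomp_congr _ (by simp) rfl

theorem comp_whiskerLeft {x y z t : D} (m : Pro x y) (n : Pro y z) {q q' : Pro z t}
    (α : q ⟶ q') : hcomp (one (m ⊙ n)) α.cell (by simp) = assoc m n q ≫ᶜ
      hcomp (one m) (hcomp (one n) α.cell (by simp)) (by simp) ≫ᶜ assocInv m n q' := by
  rw [assocInv_naturality (h := by simp), assoc_assocInv_assoc]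
  exact hcomp_congr _ (by simp) rfl

theorem whiskerRight_id {x y : D} {m m' : Pro x y} (α : m ⟶ m') :
    hcomp α.cell (one (pid y)) (by simp) =
      rightUnitor m ≫ᶜ α.cell ≫ᶜ rightUnitorInv m' := by
  rw [rightUnitorInv_naturality, rightUnitor_inv_assoc]
  exact hcomp_congr _ rfl (by simp)

theorem whiskerRight_comp {x y z t : D} {m m' : Pro x y} (α : m ⟶ m') (n : Pro y z)
    (q : Pro z t) : hcomp α.cell (one (n ⊙ q)) (by simp) = assocInv m n q ≫ᶜ
      hcomp (hcomp α.cell (one n) (by simp)) (one q) (by simp) ≫ᶜ assoc m' n q := by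
  rw [assoc_naturality (h' := by simp), assocInv_assoc_assoc]
  exact hcomp_congr _ rfl (by simp)

theorem whisker_assoc {x y z t : D} (m : Pro x y) {n n' : Pro y z} (α : n ⟶ n')
    (q : Pro z t) : hcomp (hcomp (one m) α.cell (by simp)) (one q) (by simp) = assoc m n q ≫ᶜ
      hcomp (one m) (hcomp α.cell (one q) (by simp)) (by simp) ≫ᶜ assocInv m n' q := by
  rw [assocInv_naturality (h := by simp), assoc_assocInv_assoc]

theorem whisker_exchange {x y z : D} {m m' : Pro x y} {n n' : Pro y z} (α : m ⟶ m')
    (β : n ⟶ n') :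
    hcomp (one m) β.cell (by simp) ≫ᶜ hcomp α.cell (one n') (by simp) =
      hcomp α.cell (one n) (by simp) ≫ᶜ hcomp (one m') β.cell (by simp) := by
  rw [vcomp_hcomp, vcomp_hcomp]
  exact hcomp_congr _ (by simp) (by simp)

end Globular

instance : Bicategory (UBicat D) where
  Hom x y := Pro (D := D) x y
  id x := pid (D := D) x
  comp m n := pcomp (D := D) m n
  homCategory x y := globularCategory (D := D) x y
  whiskerLeft m _ _ β := Globular.whiskerLeft (D := D) m β
  whiskerRight α n := Globular.whiskerRight (D := D) α n
  associator m n q := assocIso (D := D) m n q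
  leftUnitor m := leftUnitorIso (D := D) m
  rightUnitor m := rightUnitorIso (D := D) m
  whiskerLeft_id _ _ := Globular.ext (hcomp_one _ _)
  whiskerLeft_comp _ _ _ _ _ _ := Globular.ext
    ((hcomp_congr _ (one_vcomp _).symm rfl).trans (vcomp_hcomp _ _ _ _ _ _).symm)
  id_whiskerLeft α := Globular.ext (Globular.id_whiskerLeft (D := D) α)
  comp_whiskerLeft m n _ _ α := Globular.ext (Globular.comp_whiskerLeft (D := D) m n α)
  id_whiskerRight _ _ := Globular.ext (hcomp_one _ _)
  comp_whiskerRight _ _ _ := Globular.ext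
    ((hcomp_congr _ rfl (one_vcomp _).symm).trans (vcomp_hcomp _ _ _ _ _ _).symm)
  whiskerRight_id α := Globular.ext (Globular.whiskerRight_id (D := D) α)
  whiskerRight_comp α n q := Globular.ext (Globular.whiskerRight_comp (D := D) α n q)
  whisker_assoc m _ _ α q := Globular.ext (Globular.whisker_assoc (D := D) m α q)
  whisker_exchange α β := Globular.ext (Globular.whisker_exchange (D := D) α β)
  pentagon _ _ _ _ := Globular.ext (pentagon _ _ _ _)
  triangle _ _ := Globular.ext (triangle _ _)

end DoubleCategory

open DoubleCategory

/-! ## Lax double functors and natural transformations -/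

/-- A lax double functor: strictly functorial on arrows and cells, with globular laxity
comparisons `F m ⊙ F n → F (m ⊙ n)` and `id_{F x} → F id_x`. -/
structure LaxDoubleFunctor (D : Type u) [Category.{v} D] [DoubleCategory.{c, p} D]
    (E : Type u₁) [Category.{v₁} E] [DoubleCategory.{c₁, p₁} E] where
  obj : D → E
  map : ∀ {x y : D}, (x ⟶ y) → (obj x ⟶ obj y)
  map_id : ∀ x : D, map (𝟙 x) = 𝟙 (obj x)
  map_comp : ∀ {x y z : D} (f : x ⟶ y) (g : y ⟶ z), map (f ≫ g) = map f ≫ map g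
  mapPro : ∀ {x y : D}, Pro x y → Pro (obj x) (obj y)
  mapCell : ∀ {x y x' y' : D} {m : Pro x y} {m' : Pro x' y'},
    Cell m m' → Cell (mapPro m) (mapPro m')
  src_mapCell : ∀ {x y x' y' : D} {m : Pro x y} {m' : Pro x' y'} (α : Cell m m'),
    src (mapCell α) = map (src α)
  tgt_mapCell : ∀ {x y x' y' : D} {m : Pro x y} {m' : Pro x' y'} (α : Cell m m'),
    tgt (mapCell α) = map (tgt α)
  mapCell_one : ∀ {x y : D} (m : Pro x y), mapCell (one m) = one (mapPro m)
  mapCell_vcomp : ∀ {x y x' y' x'' y'' : D} {m : Pro x y} {m' : Pro x' y'} {m'' : Pro x'' y''}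
    (α : Cell m m') (β : Cell m' m''), mapCell (α ≫ᶜ β) = mapCell α ≫ᶜ mapCell β
  /-- composition comparison `F_{m,n}` -/
  lcomp : ∀ {x y z : D} (m : Pro x y) (n : Pro y z), Cell (mapPro m ⊙ mapPro n) (mapPro (m ⊙ n))
  src_lcomp : ∀ {x y z : D} (m : Pro x y) (n : Pro y z), src (lcomp m n) = 𝟙 (obj x)
  tgt_lcomp : ∀ {x y z : D} (m : Pro x y) (n : Pro y z), tgt (lcomp m n) = 𝟙 (obj z)
  /-- identity comparison `F_x` -/
  lunit : ∀ x : D, Cell (pid (obj x)) (mapPro (pid x))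
  src_lunit : ∀ x : D, src (lunit x) = 𝟙 (obj x)
  tgt_lunit : ∀ x : D, tgt (lunit x) = 𝟙 (obj x)
  lcomp_naturality : ∀ {x y z x' y' z' : D} {m : Pro x y} {n : Pro y z} {m' : Pro x' y'}
    {n' : Pro y' z'} (α : Cell m m') (β : Cell n n') (h : tgt α = src β),
    hcomp (mapCell α) (mapCell β) (by rw [tgt_mapCell, src_mapCell, h]) ≫ᶜ lcomp m' n' =
      lcomp m n ≫ᶜ mapCell (hcomp α β h)
  lunit_naturality : ∀ {x y : D} (f : x ⟶ y),
    pidMap (map f) ≫ᶜ lunit y = lunit x ≫ᶜ mapCell (pidMap f)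
  lcomp_assoc : ∀ {x y z t : D} (m : Pro x y) (n : Pro y z) (q : Pro z t),
    hcomp (lcomp m n) (one (mapPro q)) (by rw [tgt_lcomp, src_one]) ≫ᶜ lcomp (m ⊙ n) q ≫ᶜ
        mapCell (assoc m n q) =
      assoc (mapPro m) (mapPro n) (mapPro q) ≫ᶜ
        hcomp (one (mapPro m)) (lcomp n q) (by rw [tgt_one, src_lcomp]) ≫ᶜ lcomp m (n ⊙ q)
  lunit_left : ∀ {x y : D} (m : Pro x y),
    hcomp (lunit x) (one (mapPro m)) (by rw [tgt_lunit, src_one]) ≫ᶜ lcomp (pid x) m ≫ᶜ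
        mapCell (leftUnitor m) = leftUnitor (mapPro m)
  lunit_right : ∀ {x y : D} (m : Pro x y),
    hcomp (one (mapPro m)) (lunit y) (by rw [tgt_one, src_lunit]) ≫ᶜ lcomp m (pid y) ≫ᶜ
        mapCell (rightUnitor m) = rightUnitor (mapPro m)

namespace LaxDoubleFunctor

attribute [simp] map_id map_comp src_mapCell tgt_mapCell mapCell_one mapCell_vcomp src_lcomp
  tgt_lcomp src_lunit tgt_lunit

variable {D : Type u} [Category.{v} D] [DoubleCategory.{c, p} D]
  {E : Type u₁} [Category.{v₁} E] [DoubleCategory.{c₁, p₁} E]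
  {C : Type u₂} [Category.{v₂} C] [DoubleCategory.{c₂, p₂} C]

/-- A lax double functor is normal if its identity comparisons are invertible. -/
def IsNormal (F : LaxDoubleFunctor D E) : Prop := ∀ x : D, IsInvertible (F.lunit x)

variable (D) in
/-- The identity double functor. -/
def id : LaxDoubleFunctor D D where
  obj x := x
  map f := f
  map_id _ := rfl
  map_comp _ _ := rfl
  mapPro m := m
  mapCell α := α
  src_mapCell _ := rfl
  tgt_mapCell _ := rfl
  mapCell_one _ := rfl
  mapCell_vcomp _ _ := rfl
  lcomp m n := one (m ⊙ n)
  src_lcomp _ _ := src_one _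
  tgt_lcomp _ _ := tgt_one _
  lunit x := one (pid x)
  src_lunit _ := src_one _
  tgt_lunit _ := tgt_one _
  lcomp_naturality _ _ _ := by simp
  lunit_naturality _ := by simp
  lcomp_assoc _ _ _ := by simp
  lunit_left _ := by simp
  lunit_right _ := by simp

/-- The composite `G ∘ F` of lax double functors. -/
def comp (F : LaxDoubleFunctor C D) (G : LaxDoubleFunctor D E) : LaxDoubleFunctor C E where
  obj x := G.obj (F.obj x)
  map f := G.map (F.map f)
  map_id _ := by simp
  map_comp _ _ := by simp
  mapPro m := G.mapPro (F.mapPro m)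
  mapCell α := G.mapCell (F.mapCell α)
  src_mapCell _ := by simp
  tgt_mapCell _ := by simp
  mapCell_one _ := by simp
  mapCell_vcomp _ _ := by simp
  lcomp m n := G.lcomp (F.mapPro m) (F.mapPro n) ≫ᶜ G.mapCell (F.lcomp m n)
  src_lcomp _ _ := by simp
  tgt_lcomp _ _ := by simp
  lunit x := G.lunit (F.obj x) ≫ᶜ G.mapCell (F.lunit x)
  src_lunit _ := by simp
  tgt_lunit _ := by simp
  lcomp_naturality α β h := by
    rw [← vcomp_assoc, G.lcomp_naturality (h := by simp [h]), vcomp_assoc, ← G.mapCell_vcomp,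
      F.lcomp_naturality (h := h), G.mapCell_vcomp, vcomp_assoc]
  lunit_naturality f := by
    rw [← vcomp_assoc, G.lunit_naturality, vcomp_assoc, ← G.mapCell_vcomp,
      F.lunit_naturality, G.mapCell_vcomp, vcomp_assoc]
  lcomp_assoc m n q := by
    have e₁ := G.lcomp_naturality (F.lcomp m n) (one (F.mapPro q)) (by simp)
    have e₂ := G.lcomp_naturality (one (F.mapPro m)) (F.lcomp n q) (by simp)
    simp only [mapCell_one] at e₁ e₂
    rw [hcomp_vcomp_one _ _ _ (by simp) (by simp), one_hcomp_vcomp _ _ _ (by simp) (by simp)]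
    simp only [vcomp_assoc]
    rw [← vcomp_assoc (hcomp (G.mapCell (F.lcomp m n)) _ _), e₁,
      ← vcomp_assoc (hcomp _ (G.mapCell (F.lcomp n q)) _), e₂]
    simp only [vcomp_assoc, ← mapCell_vcomp]
    rw [F.lcomp_assoc]
    simp only [mapCell_vcomp]
    rw [← vcomp_assoc, ← vcomp_assoc, vcomp_assoc (hcomp _ _ _), G.lcomp_assoc]
    simp only [vcomp_assoc]
  lunit_left m := by
    have e₁ := G.lcomp_naturality (F.lunit _) (one (F.mapPro m)) (by simp)
    simp only [mapCell_one] at e₁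
    rw [hcomp_vcomp_one _ _ _ (by simp) (by simp)]
    simp only [vcomp_assoc]
    rw [← vcomp_assoc (hcomp (G.mapCell (F.lunit _)) _ _), e₁]
    simp only [vcomp_assoc, ← mapCell_vcomp]
    rw [F.lunit_left, G.lunit_left]
  lunit_right m := by
    have e₁ := G.lcomp_naturality (one (F.mapPro m)) (F.lunit _) (by simp)
    simp only [mapCell_one] at e₁
    rw [one_hcomp_vcomp _ _ _ (by simp) (by simp)]
    simp only [vcomp_assoc]
    rw [← vcomp_assoc (hcomp _ (G.mapCell (F.lunit _)) _), e₁]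
    simp only [vcomp_assoc, ← mapCell_vcomp]
    rw [F.lunit_right, G.lunit_right]

end LaxDoubleFunctor

/-- A (strict, tight) natural transformation of lax double functors. -/
@[ext] structure DoubleNatTrans {D : Type u} [Category.{v} D] [DoubleCategory.{c, p} D]
    {E : Type u₁} [Category.{v₁} E] [DoubleCategory.{c₁, p₁} E]
    (F G : LaxDoubleFunctor D E) where
  /-- component at an object -/
  app : ∀ x : D, F.obj x ⟶ G.obj x
  /-- component at a proarrow -/
  cell : ∀ {x y : D} (m : Pro x y), Cell (F.mapPro m) (G.mapPro m)
  src_cell : ∀ {x y : D} (m : Pro x y), src (cell m) = app x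
  tgt_cell : ∀ {x y : D} (m : Pro x y), tgt (cell m) = app y
  naturality : ∀ {x y : D} (f : x ⟶ y), F.map f ≫ app y = app x ≫ G.map f
  cell_naturality : ∀ {x y x' y' : D} {m : Pro x y} {m' : Pro x' y'} (α : Cell m m'),
    F.mapCell α ≫ᶜ cell m' = cell m ≫ᶜ G.mapCell α
  cell_lcomp : ∀ {x y z : D} (m : Pro x y) (n : Pro y z),
    F.lcomp m n ≫ᶜ cell (m ⊙ n) =
      hcomp (cell m) (cell n) (by rw [tgt_cell, src_cell]) ≫ᶜ G.lcomp m n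
  cell_lunit : ∀ x : D, F.lunit x ≫ᶜ cell (pid x) = pidMap (app x) ≫ᶜ G.lunit x

namespace DoubleNatTrans

attribute [simp] src_cell tgt_cell

variable {D : Type u} [Category.{v} D] [DoubleCategory.{c, p} D]
  {E : Type u₁} [Category.{v₁} E] [DoubleCategory.{c₁, p₁} E]

/-- The identity natural transformation. -/
def id (F : LaxDoubleFunctor D E) : DoubleNatTrans F F where
  app x := 𝟙 _
  cell m := one _
  src_cell _ := by simp
  tgt_cell _ := by simp
  naturality _ := by simp
  cell_naturality _ := by simp
  cell_lcomp _ _ := by simp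
  cell_lunit _ := by simp

/-- Composition of natural transformations. -/
def comp {F G H : LaxDoubleFunctor D E} (α : DoubleNatTrans F G) (β : DoubleNatTrans G H) :
    DoubleNatTrans F H where
  app x := α.app x ≫ β.app x
  cell m := α.cell m ≫ᶜ β.cell m
  src_cell _ := by simp
  tgt_cell _ := by simp
  naturality f := by
    rw [← Category.assoc, α.naturality, Category.assoc, β.naturality, Category.assoc]
  cell_naturality γ := by
    rw [← vcomp_assoc, α.cell_naturality, vcomp_assoc, β.cell_naturality, vcomp_assoc]
  cell_lcomp m n := by
    rw [← vcomp_assoc, α.cell_lcomp, vcomp_assoc, β.cell_lcomp, ← vcomp_assoc, vcomp_hcomp]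
  cell_lunit x := by
    rw [← vcomp_assoc, α.cell_lunit, vcomp_assoc, β.cell_lunit, ← vcomp_assoc, pidMap_comp]

instance : Category (LaxDoubleFunctor D E) where
  Hom := DoubleNatTrans
  id := id
  comp := comp
  id_comp _ := DoubleNatTrans.ext (by funext; exact Category.id_comp _)
    (by funext; exact one_vcomp _)
  comp_id _ := DoubleNatTrans.ext (by funext; exact Category.comp_id _)
    (by funext; exact vcomp_one _)
  assoc _ _ _ := DoubleNatTrans.ext (by funext; exact Category.assoc _ _ _)
    (by funext; exact vcomp_assoc _ _ _)

end DoubleNatTrans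

namespace LaxDoubleFunctor

variable {D : Type u} [Category.{v} D] [DoubleCategory.{c, p} D]
  {E : Type u₁} [Category.{v₁} E] [DoubleCategory.{c₁, p₁} E] (F : LaxDoubleFunctor D E)

/-- Action on globular cells. -/
def mapGlobular {x y : D} {m n : Pro x y} (α : Globular m n) :
    Globular (F.mapPro m) (F.mapPro n) :=
  ⟨F.mapCell α.cell, by simp, by simp⟩

/-- The identity comparison as a globular cell. -/
def globUnit (x : D) : Globular (pid (F.obj x)) (F.mapPro (pid x)) :=
  ⟨F.lunit x, by simp, by simp⟩

/-- The composition comparison as a globular cell. -/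
def globComp {x y z : D} (m : Pro x y) (n : Pro y z) :
    Globular (F.mapPro m ⊙ F.mapPro n) (F.mapPro (m ⊙ n)) :=
  ⟨F.lcomp m n, by simp, by simp⟩

theorem glob_nat_left {x y z : D} {m m' : Pro x y} (η : Globular m m') (n : Pro y z) :
    F.lcomp m n ≫ᶜ F.mapCell (hcomp η.cell (one n) (by simp)) =
      hcomp (F.mapCell η.cell) (one (F.mapPro n)) (by simp) ≫ᶜ F.lcomp m' n := by
  rw [← F.lcomp_naturality]
  exact congrArg (· ≫ᶜ _) (hcomp_congr _ rfl (by simp))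

theorem glob_nat_right {x y z : D} (m : Pro x y) {n n' : Pro y z} (η : Globular n n') :
    F.lcomp m n ≫ᶜ F.mapCell (hcomp (one m) η.cell (by simp)) =
      hcomp (one (F.mapPro m)) (F.mapCell η.cell) (by simp) ≫ᶜ F.lcomp m n' := by
  rw [← F.lcomp_naturality]
  exact congrArg (· ≫ᶜ _) (hcomp_congr _ (by simp) rfl)

theorem glob_left {x y : D} (m : Pro x y) :
    F.mapCell (leftUnitorInv m) = leftUnitorInv (F.mapPro m) ≫ᶜ
      hcomp (F.lunit x) (one (F.mapPro m)) (by simp) ≫ᶜ F.lcomp (pid x) m := by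
  have e := congrArg (fun t => leftUnitorInv _ ≫ᶜ t ≫ᶜ F.mapCell (leftUnitorInv m))
    (F.lunit_left m)
  simp only [vcomp_assoc, ← F.mapCell_vcomp, leftUnitor_inv] at e
  simpa using e.symm

theorem glob_right {x y : D} (m : Pro x y) :
    F.mapCell (rightUnitorInv m) = rightUnitorInv (F.mapPro m) ≫ᶜ
      hcomp (one (F.mapPro m)) (F.lunit y) (by simp) ≫ᶜ F.lcomp m (pid y) := by
  have e := congrArg (fun t => rightUnitorInv _ ≫ᶜ t ≫ᶜ F.mapCell (rightUnitorInv m))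
    (F.lunit_right m)
  simp only [vcomp_assoc, ← F.mapCell_vcomp, rightUnitor_inv] at e
  simpa using e.symm

end LaxDoubleFunctor

/-! ## Protransformations and modifications -/

section Protransformations

open Bicategory

variable {D : Type u} [Category.{v} D] [DoubleCategory.{c, p} D]
  {E : Type u₁} [Category.{v₁} E] [DoubleCategory.{c₁, p₁} E]

/-- The data of a lax protransformation `τ : F ⇸ G`: components at objects and arrows, and
naturality comparisons `τ_x ⊙ G m → F m ⊙ τ_y`. -/
structure LaxProtransData (F G : LaxDoubleFunctor D E) where
  app : ∀ x : D, Pro (F.obj x) (G.obj x)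
  arr : ∀ {x y : D}, (x ⟶ y) → Cell (app x) (app y)
  src_arr : ∀ {x y : D} (f : x ⟶ y), src (arr f) = F.map f
  tgt_arr : ∀ {x y : D} (f : x ⟶ y), tgt (arr f) = G.map f
  nat : ∀ {x y : D} (m : Pro x y), Cell (app x ⊙ G.mapPro m) (F.mapPro m ⊙ app y)
  src_nat : ∀ {x y : D} (m : Pro x y), src (nat m) = 𝟙 (F.obj x)
  tgt_nat : ∀ {x y : D} (m : Pro x y), tgt (nat m) = 𝟙 (G.obj y)

/-- The data of an oplax protransformation `τ : F ⇸ G`: components at objects and arrows, and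
naturality comparisons `F m ⊙ τ_y → τ_x ⊙ G m`. -/
structure OplaxProtransData (F G : LaxDoubleFunctor D E) where
  app : ∀ x : D, Pro (F.obj x) (G.obj x)
  arr : ∀ {x y : D}, (x ⟶ y) → Cell (app x) (app y)
  src_arr : ∀ {x y : D} (f : x ⟶ y), src (arr f) = F.map f
  tgt_arr : ∀ {x y : D} (f : x ⟶ y), tgt (arr f) = G.map f
  nat : ∀ {x y : D} (m : Pro x y), Cell (F.mapPro m ⊙ app y) (app x ⊙ G.mapPro m)
  src_nat : ∀ {x y : D} (m : Pro x y), src (nat m) = 𝟙 (F.obj x)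
  tgt_nat : ∀ {x y : D} (m : Pro x y), tgt (nat m) = 𝟙 (G.obj y)

attribute [simp] LaxProtransData.src_arr LaxProtransData.tgt_arr LaxProtransData.src_nat
  LaxProtransData.tgt_nat OplaxProtransData.src_arr OplaxProtransData.tgt_arr
  OplaxProtransData.src_nat OplaxProtransData.tgt_nat

/-- The axioms of a lax protransformation. -/
structure LaxProtransData.IsLax {F G : LaxDoubleFunctor D E} (τ : LaxProtransData F G) :
    Prop where
  arr_id : ∀ x : D, τ.arr (𝟙 x) = one (τ.app x)
  arr_comp : ∀ {x y z : D} (f : x ⟶ y) (g : y ⟶ z), τ.arr (f ≫ g) = τ.arr f ≫ᶜ τ.arr g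
  naturality : ∀ {x y w z : D} {m : Pro x y} {n : Pro w z} (α : Cell m n),
    τ.nat m ≫ᶜ hcomp (F.mapCell α) (τ.arr (tgt α)) (by simp) =
      hcomp (τ.arr (src α)) (G.mapCell α) (by simp) ≫ᶜ τ.nat n
  nat_comp : ∀ {x y z : D} (m : Pro x y) (n : Pro y z),
    assocInv (τ.app x) (G.mapPro m) (G.mapPro n) ≫ᶜ
        hcomp (τ.nat m) (one (G.mapPro n)) (by simp) ≫ᶜ
        assoc (F.mapPro m) (τ.app y) (G.mapPro n) ≫ᶜ
        hcomp (one (F.mapPro m)) (τ.nat n) (by simp) ≫ᶜ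
        assocInv (F.mapPro m) (F.mapPro n) (τ.app z) ≫ᶜ
        hcomp (F.lcomp m n) (one (τ.app z)) (by simp) =
      hcomp (one (τ.app x)) (G.lcomp m n) (by simp) ≫ᶜ τ.nat (m ⊙ n)
  nat_id : ∀ x : D,
    hcomp (one (τ.app x)) (G.lunit x) (by simp) ≫ᶜ τ.nat (pid x) =
      rightUnitor (τ.app x) ≫ᶜ leftUnitorInv (τ.app x) ≫ᶜ
        hcomp (F.lunit x) (one (τ.app x)) (by simp)

/-- The axioms of an oplax protransformation. -/
structure OplaxProtransData.IsOplax {F G : LaxDoubleFunctor D E} (τ : OplaxProtransData F G) :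
    Prop where
  arr_id : ∀ x : D, τ.arr (𝟙 x) = one (τ.app x)
  arr_comp : ∀ {x y z : D} (f : x ⟶ y) (g : y ⟶ z), τ.arr (f ≫ g) = τ.arr f ≫ᶜ τ.arr g
  naturality : ∀ {x y w z : D} {m : Pro x y} {n : Pro w z} (α : Cell m n),
    τ.nat m ≫ᶜ hcomp (τ.arr (src α)) (G.mapCell α) (by simp) =
      hcomp (F.mapCell α) (τ.arr (tgt α)) (by simp) ≫ᶜ τ.nat n
  nat_comp : ∀ {x y z : D} (m : Pro x y) (n : Pro y z),
    assoc (F.mapPro m) (F.mapPro n) (τ.app z) ≫ᶜ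
        hcomp (one (F.mapPro m)) (τ.nat n) (by simp) ≫ᶜ
        assocInv (F.mapPro m) (τ.app y) (G.mapPro n) ≫ᶜ
        hcomp (τ.nat m) (one (G.mapPro n)) (by simp) ≫ᶜ
        assoc (τ.app x) (G.mapPro m) (G.mapPro n) ≫ᶜ
        hcomp (one (τ.app x)) (G.lcomp m n) (by simp) =
      hcomp (F.lcomp m n) (one (τ.app z)) (by simp) ≫ᶜ τ.nat (m ⊙ n)
  nat_id : ∀ x : D,
    hcomp (F.lunit x) (one (τ.app x)) (by simp) ≫ᶜ τ.nat (pid x) =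
      leftUnitor (τ.app x) ≫ᶜ rightUnitorInv (τ.app x) ≫ᶜ
        hcomp (one (τ.app x)) (G.lunit x) (by simp)

/-- A lax protransformation is pseudo if its naturality comparisons are invertible. -/
def LaxProtransData.IsPseudo {F G : LaxDoubleFunctor D E} (τ : LaxProtransData F G) : Prop :=
  ∀ (x y : D) (m : Pro x y), IsInvertible (τ.nat m)

/-- An oplax protransformation is pseudo if its naturality comparisons are invertible. -/
def OplaxProtransData.IsPseudo {F G : LaxDoubleFunctor D E} (τ : OplaxProtransData F G) : Prop :=
  ∀ (x y : D) (m : Pro x y), IsInvertible (τ.nat m)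

/-- A pseudo protransformation, presented as a lax one with invertible comparisons. -/
structure PseudoProtrans (F G : LaxDoubleFunctor D E) extends LaxProtransData F G where
  isLax : toLaxProtransData.IsLax
  isPseudo : toLaxProtransData.IsPseudo

/-- Replacing the comparisons of an oplax protransformation by their inverses. -/
noncomputable def OplaxProtransData.inverse {F G : LaxDoubleFunctor D E}
    (τ : OplaxProtransData F G) (h : τ.IsPseudo) : LaxProtransData F G where
  app := τ.app
  arr := τ.arr
  src_arr := τ.src_arr
  tgt_arr := τ.tgt_arr
  nat m := (h _ _ m).choose
  src_nat m := by
    have h' := congrArg src (h _ _ m).choose_spec.1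
    rwa [src_vcomp, src_nat, src_one, Category.id_comp] at h'
  tgt_nat m := by
    have h' := congrArg tgt (h _ _ m).choose_spec.1
    rwa [tgt_vcomp, tgt_nat, tgt_one, Category.id_comp] at h'

theorem OplaxProtransData.IsOplax.inverse_naturality {F G : LaxDoubleFunctor D E}
    {τ : OplaxProtransData F G} (h₁ : τ.IsOplax)
    (N : ∀ {x y : D} (m : Pro x y), Cell (τ.app x ⊙ G.mapPro m) (F.mapPro m ⊙ τ.app y))
    (e₁ : ∀ {x y : D} (m : Pro x y), τ.nat m ≫ᶜ N m = one _)
    (e₂ : ∀ {x y : D} (m : Pro x y), N m ≫ᶜ τ.nat m = one _)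
    {x y w z : D} {m : Pro x y} {n : Pro w z}
    (α : Cell m n) : N m ≫ᶜ hcomp (F.mapCell α) (τ.arr (tgt α)) (by simp) =
      hcomp (τ.arr (src α)) (G.mapCell α) (by simp) ≫ᶜ N n := by
  have e := congrArg (fun t => N m ≫ᶜ t ≫ᶜ N n) (h₁.naturality α)
  beta_reduce at e
  rw [vcomp_assoc, vcomp_assoc, e₁, vcomp_one, ← vcomp_assoc, ← vcomp_assoc,
    e₂, one_vcomp] at e
  exact e.symm

theorem OplaxProtransData.inverse_cancel {F G : LaxDoubleFunctor D E}
    {τ : OplaxProtransData F G}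
    (N : ∀ {x y : D} (m : Pro x y), Cell (τ.app x ⊙ G.mapPro m) (F.mapPro m ⊙ τ.app y))
    (e₁ : ∀ {x y : D} (m : Pro x y), τ.nat m ≫ᶜ N m = one _)
    {x y : D} (m : Pro x y) {s t : E} {r : Pro s t}
    (a b : Cell r _) (hab : a ≫ᶜ τ.nat m = b ≫ᶜ τ.nat m) : a = b := by
  have := congrArg (fun t => t ≫ᶜ N m) hab
  simpa only [vcomp_assoc, e₁, vcomp_one] using this

theorem OplaxProtransData.IsOplax.inverse_nat_comp {F G : LaxDoubleFunctor D E}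
    {τ : OplaxProtransData F G} (h₁ : τ.IsOplax)
    (N : ∀ {x y : D} (m : Pro x y), Cell (τ.app x ⊙ G.mapPro m) (F.mapPro m ⊙ τ.app y))
    (e₁ : ∀ {x y : D} (m : Pro x y), τ.nat m ≫ᶜ N m = one _)
    (e₂ : ∀ {x y : D} (m : Pro x y), N m ≫ᶜ τ.nat m = one _)
    (s₁ : ∀ {x y : D} (m : Pro x y), src (N m) = 𝟙 _)
    (s₂ : ∀ {x y : D} (m : Pro x y), tgt (N m) = 𝟙 _)
    {x y z : D} (m : Pro x y) (n : Pro y z) :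
    assocInv (τ.app x) (G.mapPro m) (G.mapPro n) ≫ᶜ
        hcomp (N m) (one (G.mapPro n)) (by simp [s₂]) ≫ᶜ
        assoc (F.mapPro m) (τ.app y) (G.mapPro n) ≫ᶜ
        hcomp (one (F.mapPro m)) (N n) (by simp [s₁]) ≫ᶜ
        assocInv (F.mapPro m) (F.mapPro n) (τ.app z) ≫ᶜ
        hcomp (F.lcomp m n) (one (τ.app z)) (by simp) =
      hcomp (one (τ.app x)) (G.lcomp m n) (by simp) ≫ᶜ N (m ⊙ n) := by
  apply OplaxProtransData.inverse_cancel N e₁ (m ⊙ n)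
  have e₃ : ∀ (h h'), hcomp (one (F.mapPro m)) (N n) h ≫ᶜ
      hcomp (one (F.mapPro m)) (τ.nat n) h' = one _ := by
    intro h h'
    rw [vcomp_hcomp, ← hcomp_one]
    exact hcomp_congr _ (one_vcomp _) (e₂ _)
  have e₄ : ∀ (h h'), hcomp (N m) (one (G.mapPro n)) h ≫ᶜ
      hcomp (τ.nat m) (one (G.mapPro n)) h' = one _ := by
    intro h h'
    rw [vcomp_hcomp, ← hcomp_one]
    exact hcomp_congr _ (e₂ _) (one_vcomp _)
  simp only [vcomp_assoc]
  rw [e₂, vcomp_one, ← h₁.nat_comp m n, assocInv_assoc_assoc,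
    ← vcomp_assoc (hcomp (one _) (N n) _), e₃, one_vcomp, assoc_assocInv_assoc,
    ← vcomp_assoc (hcomp (N m) _ _), e₄, one_vcomp, assocInv_assoc_assoc]

theorem OplaxProtransData.IsOplax.inverse_nat_id {F G : LaxDoubleFunctor D E}
    {τ : OplaxProtransData F G} (h₁ : τ.IsOplax)
    (N : ∀ {x y : D} (m : Pro x y), Cell (τ.app x ⊙ G.mapPro m) (F.mapPro m ⊙ τ.app y))
    (e₁ : ∀ {x y : D} (m : Pro x y), τ.nat m ≫ᶜ N m = one _)
    (e₂ : ∀ {x y : D} (m : Pro x y), N m ≫ᶜ τ.nat m = one _)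
    (x : D) :
    hcomp (one (τ.app x)) (G.lunit x) (by simp) ≫ᶜ N (pid x) =
      rightUnitor (τ.app x) ≫ᶜ leftUnitorInv (τ.app x) ≫ᶜ
        hcomp (F.lunit x) (one (τ.app x)) (by simp) := by
  apply OplaxProtransData.inverse_cancel N e₁ (pid x)
  simp only [vcomp_assoc]
  rw [e₂, vcomp_one, h₁.nat_id, inv_leftUnitor_assoc, rightUnitor_inv_assoc]

theorem OplaxProtransData.nat_inverse {F G : LaxDoubleFunctor D E} (τ : OplaxProtransData F G)
    (h : τ.IsPseudo) {x y : D} (m : Pro x y) : τ.nat m ≫ᶜ (τ.inverse h).nat m = one _ :=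
  (h x y m).choose_spec.1

theorem OplaxProtransData.inverse_nat {F G : LaxDoubleFunctor D E} (τ : OplaxProtransData F G)
    (h : τ.IsPseudo) {x y : D} (m : Pro x y) : (τ.inverse h).nat m ≫ᶜ τ.nat m = one _ :=
  (h x y m).choose_spec.2

theorem OplaxProtransData.inverse_isLax {F G : LaxDoubleFunctor D E}
    (τ : OplaxProtransData F G) (h₁ : τ.IsOplax) (h₂ : τ.IsPseudo) : (τ.inverse h₂).IsLax where
  arr_id := h₁.arr_id
  arr_comp := h₁.arr_comp
  naturality α := h₁.inverse_naturality (τ.inverse h₂).nat (τ.nat_inverse h₂) (τ.inverse_nat h₂) α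
  nat_comp m n := h₁.inverse_nat_comp (τ.inverse h₂).nat (τ.nat_inverse h₂) (τ.inverse_nat h₂)
    (τ.inverse h₂).src_nat (τ.inverse h₂).tgt_nat m n
  nat_id x := h₁.inverse_nat_id (τ.inverse h₂).nat (τ.nat_inverse h₂) (τ.inverse_nat h₂) x

/-- An oplax protransformation with invertible comparisons, as a pseudo protransformation. -/
noncomputable def OplaxProtransData.toPseudo {F G : LaxDoubleFunctor D E}
    (τ : OplaxProtransData F G) (h₁ : τ.IsOplax) (h₂ : τ.IsPseudo) : PseudoProtrans F G where
  toLaxProtransData := τ.inverse h₂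
  isLax := τ.inverse_isLax h₁ h₂
  isPseudo _ _ m := ⟨τ.nat m, τ.inverse_nat h₂ m, τ.nat_inverse h₂ m⟩

/-! ### Identity and composite protransformations -/

/-- The lax functor of underlying bicategories. -/
def LaxDoubleFunctor.toUBicat (F : LaxDoubleFunctor D E) :
    LaxFunctor (UBicat D) (UBicat E) where
  obj x := F.obj x
  map m := F.mapPro (D := D) m
  map₂ α := F.mapGlobular α
  map₂_id _ := Globular.ext (F.mapCell_one _)
  map₂_comp _ _ := Globular.ext (F.mapCell_vcomp _ _)
  mapId x := F.globUnit x
  mapComp m n := F.globComp m n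
  mapComp_naturality_left η g := Globular.ext (F.glob_nat_left η g)
  mapComp_naturality_right f _ _ η := Globular.ext (F.glob_nat_right f η)
  map₂_associator f g h := Globular.ext (F.lcomp_assoc f g h)
  map₂_leftUnitor f := Globular.ext (F.glob_left f)
  map₂_rightUnitor f := Globular.ext (F.glob_right f)

/-- The naturality comparison as a globular cell. -/
def LaxProtransData.globNat {F G : LaxDoubleFunctor D E} (τ : LaxProtransData F G) {x y : D}
    (m : Pro x y) : Globular (τ.app x ⊙ G.mapPro m) (F.mapPro m ⊙ τ.app y) :=
  ⟨τ.nat m, by simp, by simp⟩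

theorem LaxProtransData.IsLax.glob_naturality {F G : LaxDoubleFunctor D E}
    {τ : LaxProtransData F G} (h : τ.IsLax) {x y : D} {m n : Pro x y} (α : Globular m n) :
    τ.nat m ≫ᶜ hcomp (F.mapCell α.cell) (one (τ.app y)) (by simp) =
      hcomp (one (τ.app x)) (G.mapCell α.cell) (by simp) ≫ᶜ τ.nat n := by
  have e := h.naturality α.cell
  have e₁ : τ.arr (tgt α.cell) = one (τ.app y) := by rw [α.tgt_cell, h.arr_id]
  have e₂ : τ.arr (src α.cell) = one (τ.app x) := by rw [α.src_cell, h.arr_id]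
  rw [hcomp_congr _ rfl e₁, hcomp_congr _ e₂ rfl] at e
  exact e

/-- The lax transformation of underlying bicategories. -/
def LaxProtransData.IsLax.toLaxTrans {F G : LaxDoubleFunctor D E} {τ : LaxProtransData F G}
    (h : τ.IsLax) : Lax.LaxTrans F.toUBicat G.toUBicat where
  app x := τ.app x
  naturality m := τ.globNat m
  naturality_naturality η := Globular.ext (h.glob_naturality η)
  naturality_id x := Globular.ext (h.nat_id x)
  naturality_comp m n := Globular.ext (h.nat_comp m n).symm

/-- The identity protransformation. -/
def LaxProtransData.id (F : LaxDoubleFunctor D E) : LaxProtransData F F where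
  app x := pid (F.obj x)
  arr f := pidMap (F.map f)
  src_arr _ := by simp
  tgt_arr _ := by simp
  nat m := leftUnitor (F.mapPro m) ≫ᶜ rightUnitorInv (F.mapPro m)
  src_nat _ := by simp
  tgt_nat _ := by simp

/-- Composition of lax protransformations. -/
def LaxProtransData.comp {F G H : LaxDoubleFunctor D E} (σ : LaxProtransData F G)
    (τ : LaxProtransData G H) : LaxProtransData F H where
  app x := σ.app x ⊙ τ.app x
  arr f := hcomp (σ.arr f) (τ.arr f) (by simp)
  src_arr _ := by simp
  tgt_arr _ := by simp
  nat {x y} m := assoc (σ.app x) (τ.app x) (H.mapPro m) ≫ᶜ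
    hcomp (one (σ.app x)) (τ.nat m) (by simp) ≫ᶜ
    assocInv (σ.app x) (G.mapPro m) (τ.app y) ≫ᶜ
    hcomp (σ.nat m) (one (τ.app y)) (by simp) ≫ᶜ
    assoc (F.mapPro m) (σ.app y) (τ.app y)
  src_nat _ := by simp
  tgt_nat _ := by simp

theorem LaxProtransData.id_isLax (F : LaxDoubleFunctor D E) : (LaxProtransData.id F).IsLax where
  arr_id x := by simp [LaxProtransData.id]
  arr_comp f g := by simp [LaxProtransData.id, pidMap_comp]
  naturality {x y w z m n} α := by
    have e₁ := leftUnitor_naturality (F.mapCell α)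
    have e₂ := rightUnitorInv_naturality (F.mapCell α)
    rw [hcomp_congr (α := pidMap (src (F.mapCell α))) (α' := pidMap (F.map (src α))) _
      (by simp) rfl] at e₁
    rw [hcomp_congr (β := pidMap (tgt (F.mapCell α))) (β' := pidMap (F.map (tgt α))) _ rfl
      (by simp)] at e₂
    have e : (leftUnitor (F.mapPro m) ≫ᶜ rightUnitorInv (F.mapPro m)) ≫ᶜ
        hcomp (F.mapCell α) (pidMap (F.map (tgt α))) (by simp) =
      hcomp (pidMap (F.map (src α))) (F.mapCell α) (by simp) ≫ᶜ
        leftUnitor (F.mapPro n) ≫ᶜ rightUnitorInv (F.mapPro n) := by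
      rw [vcomp_assoc, ← e₂, vcomp_reassoc e₁]
    exact e
  nat_comp m n := congrArg Globular.cell ((Lax.LaxTrans.id F.toUBicat).naturality_comp m n).symm
  nat_id x := congrArg Globular.cell ((Lax.LaxTrans.id F.toUBicat).naturality_id x)

theorem LaxProtransData.IsLax.comp {F G H : LaxDoubleFunctor D E} {σ : LaxProtransData F G}
    {τ : LaxProtransData G H} (hσ : σ.IsLax) (hτ : τ.IsLax) : (σ.comp τ).IsLax where
  arr_id x := by
    exact (hcomp_congr _ (hσ.arr_id x) (hτ.arr_id x)).trans (hcomp_one _ _)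
  arr_comp f g := by
    exact (hcomp_congr _ (hσ.arr_comp f g) (hτ.arr_comp f g)).trans (vcomp_hcomp _ _ _ _ _ _).symm
  naturality {x y w z m n} α := by
    have e₁ := (assoc_naturality (F.mapCell α) (σ.arr (tgt α)) (τ.arr (tgt α))
      (by simp) (by simp)).symm
    have e₂ : hcomp (σ.nat m) (one (τ.app y)) (by simp) ≫ᶜ
        hcomp (hcomp (F.mapCell α) (σ.arr (tgt α)) (by simp)) (τ.arr (tgt α)) (by simp) =
        hcomp (hcomp (σ.arr (src α)) (G.mapCell α) (by simp)) (τ.arr (tgt α)) (by simp) ≫ᶜ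
          hcomp (σ.nat n) (one (τ.app z)) (by simp) := by
      rw [vcomp_hcomp, vcomp_hcomp]
      exact hcomp_congr _ (hσ.naturality α) (by simp)
    have e₃ := (assocInv_naturality (σ.arr (src α)) (G.mapCell α) (τ.arr (tgt α))
      (by simp) (by simp)).symm
    have e₄ : hcomp (one (σ.app x)) (τ.nat m) (by simp) ≫ᶜ
        hcomp (σ.arr (src α)) (hcomp (G.mapCell α) (τ.arr (tgt α)) (by simp)) (by simp) =
        hcomp (σ.arr (src α)) (hcomp (τ.arr (src α)) (H.mapCell α) (by simp)) (by simp) ≫ᶜ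
          hcomp (one (σ.app w)) (τ.nat n) (by simp) := by
      rw [vcomp_hcomp, vcomp_hcomp]
      exact hcomp_congr _ (by simp) (hτ.naturality α)
    have e₅ := (assoc_naturality (σ.arr (src α)) (τ.arr (src α)) (H.mapCell α)
      (by simp) (by simp)).symm
    have e : (assoc (σ.app x) (τ.app x) (H.mapPro m) ≫ᶜ
        hcomp (one (σ.app x)) (τ.nat m) (by simp) ≫ᶜ
        assocInv (σ.app x) (G.mapPro m) (τ.app y) ≫ᶜ
        hcomp (σ.nat m) (one (τ.app y)) (by simp) ≫ᶜ
        assoc (F.mapPro m) (σ.app y) (τ.app y)) ≫ᶜ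
        hcomp (F.mapCell α) (hcomp (σ.arr (tgt α)) (τ.arr (tgt α)) (by simp)) (by simp) =
        hcomp (hcomp (σ.arr (src α)) (τ.arr (src α)) (by simp)) (H.mapCell α) (by simp) ≫ᶜ
        assoc (σ.app w) (τ.app w) (H.mapPro n) ≫ᶜ
        hcomp (one (σ.app w)) (τ.nat n) (by simp) ≫ᶜ
        assocInv (σ.app w) (G.mapPro n) (τ.app z) ≫ᶜ
        hcomp (σ.nat n) (one (τ.app z)) (by simp) ≫ᶜ
        assoc (F.mapPro n) (σ.app z) (τ.app z) := by
      simp only [vcomp_assoc]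
      rw [e₁, vcomp_reassoc e₂, vcomp_reassoc e₃, vcomp_reassoc e₄, vcomp_reassoc e₅]
    exact e
  nat_comp m n := congrArg Globular.cell
    (((hσ.toLaxTrans).vComp (hτ.toLaxTrans)).naturality_comp m n).symm
  nat_id x := congrArg Globular.cell (((hσ.toLaxTrans).vComp (hτ.toLaxTrans)).naturality_id x)

theorem hcomp_one_invertible {x y z : E} {m m' : Pro x y} {α : Cell m m'} (h : IsInvertible α)
    (hs : tgt α = 𝟙 y) (n : Pro y z) : IsInvertible (hcomp α (one n) (by simp [hs])) := by
  obtain ⟨β, h₁, h₂⟩ := h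
  have hβ : tgt β = 𝟙 y := by
    have h' := congrArg tgt h₁
    rwa [tgt_vcomp, hs, tgt_one, Category.id_comp] at h'
  refine ⟨hcomp β (one n) (by simp [hβ]), ?_, ?_⟩
  · rw [vcomp_hcomp, ← hcomp_one]
    exact hcomp_congr _ h₁ (one_vcomp _)
  · rw [vcomp_hcomp, ← hcomp_one]
    exact hcomp_congr _ h₂ (one_vcomp _)

theorem one_hcomp_invertible {x y z : E} {m m' : Pro y z} {α : Cell m m'} (h : IsInvertible α)
    (hs : src α = 𝟙 y) (n : Pro x y) : IsInvertible (hcomp (one n) α (by simp [hs])) := by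
  obtain ⟨β, h₁, h₂⟩ := h
  have hβ : src β = 𝟙 y := by
    have h' := congrArg src h₁
    rwa [src_vcomp, hs, src_one, Category.id_comp] at h'
  refine ⟨hcomp (one n) β (by simp [hβ]), ?_, ?_⟩
  · rw [vcomp_hcomp, ← hcomp_one]
    exact hcomp_congr _ (one_vcomp _) h₁
  · rw [vcomp_hcomp, ← hcomp_one]
    exact hcomp_congr _ (one_vcomp _) h₂

theorem IsInvertible.vcomp {x y x' y' x'' y'' : E} {m : Pro x y} {m' : Pro x' y'}
    {m'' : Pro x'' y''} {α : Cell m m'} {β : Cell m' m''} (hα : IsInvertible α)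
    (hβ : IsInvertible β) : IsInvertible (α ≫ᶜ β) := by
  obtain ⟨α', h₁, h₂⟩ := hα
  obtain ⟨β', h₃, h₄⟩ := hβ
  refine ⟨β' ≫ᶜ α', ?_, ?_⟩
  · rw [vcomp_assoc, ← vcomp_assoc β, h₃, one_vcomp, h₁]
  · rw [vcomp_assoc, ← vcomp_assoc α', h₂, one_vcomp, h₄]

/-- The identity pseudo protransformation. -/
def PseudoProtrans.id (F : LaxDoubleFunctor D E) : PseudoProtrans F F where
  toLaxProtransData := LaxProtransData.id F
  isLax := LaxProtransData.id_isLax F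
  isPseudo _ _ m := ⟨rightUnitor (F.mapPro m) ≫ᶜ leftUnitorInv (F.mapPro m),
    by simp [LaxProtransData.id], by simp [LaxProtransData.id]⟩

/-- Composition of pseudo protransformations. -/
def PseudoProtrans.comp {F G H : LaxDoubleFunctor D E} (σ : PseudoProtrans F G)
    (τ : PseudoProtrans G H) : PseudoProtrans F H where
  toLaxProtransData := σ.toLaxProtransData.comp τ.toLaxProtransData
  isLax := σ.isLax.comp τ.isLax
  isPseudo x y m := IsInvertible.vcomp ⟨_, assoc_assocInv _ _ _, assocInv_assoc _ _ _⟩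
    (IsInvertible.vcomp (one_hcomp_invertible (τ.isPseudo x y m) (τ.src_nat m) _)
      (IsInvertible.vcomp ⟨_, assocInv_assoc _ _ _, assoc_assocInv _ _ _⟩
        (IsInvertible.vcomp (hcomp_one_invertible (σ.isPseudo x y m) (σ.tgt_nat m) _)
          ⟨_, assoc_assocInv _ _ _, assocInv_assoc _ _ _⟩)))

/-- A modification with left side `α`, right side `β`, bounded by pseudo
protransformations. -/
@[ext] structure Modification {F G H K : LaxDoubleFunctor D E} (σ : PseudoProtrans F G)
    (τ : PseudoProtrans H K) where
  left : F ⟶ H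
  right : G ⟶ K
  app : ∀ x : D, Cell (σ.app x) (τ.app x)
  src_app : ∀ x : D, src (app x) = left.app x
  tgt_app : ∀ x : D, tgt (app x) = right.app x
  arr_naturality : ∀ {x y : D} (f : x ⟶ y), app x ≫ᶜ τ.arr f = σ.arr f ≫ᶜ app y
  pro_naturality : ∀ {x y : D} (m : Pro x y),
    hcomp (app x) (right.cell m) (by rw [tgt_app, DoubleNatTrans.src_cell]) ≫ᶜ τ.nat m =
      σ.nat m ≫ᶜ hcomp (left.cell m) (app y) (by rw [src_app, DoubleNatTrans.tgt_cell])

attribute [simp] Modification.src_app Modification.tgt_app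

namespace Modification

variable {F G H F' G' H' F'' G'' H'' : LaxDoubleFunctor D E}

/-- The identity modification. -/
def one (σ : PseudoProtrans F G) : Modification σ σ where
  left := 𝟙 F
  right := 𝟙 G
  app x := DoubleCategory.one _
  src_app _ := src_one _
  tgt_app _ := tgt_one _
  arr_naturality f := by rw [one_vcomp, vcomp_one]
  pro_naturality m :=
    (congrArg (· ≫ᶜ σ.nat m) (hcomp_one _ _)).trans ((one_vcomp _).trans
      ((vcomp_one _).symm.trans (congrArg (σ.nat m ≫ᶜ ·) (hcomp_one _ _).symm)))

/-- Internal composition of modifications. -/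
def vcomp {σ : PseudoProtrans F G} {σ' : PseudoProtrans F' G'} {σ'' : PseudoProtrans F'' G''}
    (μ : Modification σ σ') (ν : Modification σ' σ'') : Modification σ σ'' where
  left := μ.left ≫ ν.left
  right := μ.right ≫ ν.right
  app x := μ.app x ≫ᶜ ν.app x
  src_app x := by rw [src_vcomp, μ.src_app, ν.src_app]; rfl
  tgt_app x := by rw [tgt_vcomp, μ.tgt_app, ν.tgt_app]; rfl
  arr_naturality f := by
    rw [vcomp_assoc, ν.arr_naturality, vcomp_reassoc (μ.arr_naturality f)]
  pro_naturality {x y} m := by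
    have e : hcomp (μ.app x ≫ᶜ ν.app x) (μ.right.cell m ≫ᶜ ν.right.cell m) (by simp) ≫ᶜ
          σ''.nat m =
        σ.nat m ≫ᶜ hcomp (μ.left.cell m ≫ᶜ ν.left.cell m) (μ.app y ≫ᶜ ν.app y) (by simp) := by
      rw [← vcomp_hcomp _ _ (by simp) _ _ (by simp), ← vcomp_hcomp _ _ (by simp) _ _ (by simp),
        vcomp_assoc, ν.pro_naturality, vcomp_reassoc (μ.pro_naturality m)]
    exact e

/-- The identity modification on a natural transformation. -/
def pidMap (α : F ⟶ G) : Modification (PseudoProtrans.id F) (PseudoProtrans.id G) where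
  left := α
  right := α
  app x := DoubleCategory.pidMap (α.app x)
  src_app _ := src_pidMap _
  tgt_app _ := tgt_pidMap _
  arr_naturality f := by
    have e : DoubleCategory.pidMap (α.app _) ≫ᶜ DoubleCategory.pidMap (G.map f) =
        DoubleCategory.pidMap (F.map f) ≫ᶜ DoubleCategory.pidMap (α.app _) := by
      rw [← pidMap_comp, ← pidMap_comp, α.naturality]
    exact e
  pro_naturality {x y} m := by
    have e₁ := leftUnitor_naturality (α.cell m)
    have e₂ := rightUnitorInv_naturality (α.cell m)
    rw [hcomp_congr (α := DoubleCategory.pidMap (src (α.cell m)))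
      (α' := DoubleCategory.pidMap (α.app x)) _ (by simp) rfl] at e₁
    rw [hcomp_congr (β := DoubleCategory.pidMap (tgt (α.cell m)))
      (β' := DoubleCategory.pidMap (α.app y)) _ rfl (by simp)] at e₂
    have e : hcomp (DoubleCategory.pidMap (α.app x)) (α.cell m) (by simp) ≫ᶜ
          leftUnitor (G.mapPro m) ≫ᶜ rightUnitorInv (G.mapPro m) =
        (leftUnitor (F.mapPro m) ≫ᶜ rightUnitorInv (F.mapPro m)) ≫ᶜ
          hcomp (α.cell m) (DoubleCategory.pidMap (α.app y)) (by simp) := by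
      rw [vcomp_assoc, ← e₂, vcomp_reassoc e₁]
    exact e

/-- External composition of modifications. -/
def hcomp {σ : PseudoProtrans F G} {τ : PseudoProtrans G H} {σ' : PseudoProtrans F' G'}
    {τ' : PseudoProtrans G' H'} (μ : Modification σ σ') (ν : Modification τ τ')
    (h : μ.right = ν.left) : Modification (σ.comp τ) (σ'.comp τ') where
  left := μ.left
  right := ν.right
  app x := DoubleCategory.hcomp (μ.app x) (ν.app x) (by simp [h])
  src_app x := (src_hcomp _ _ _).trans (μ.src_app x)
  tgt_app x := (tgt_hcomp _ _ _).trans (ν.tgt_app x)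
  arr_naturality {x y} f := by
    have e : DoubleCategory.hcomp (μ.app x) (ν.app x) (by simp [h]) ≫ᶜ
          DoubleCategory.hcomp (σ'.arr f) (τ'.arr f) (by simp) =
        DoubleCategory.hcomp (σ.arr f) (τ.arr f) (by simp) ≫ᶜ
          DoubleCategory.hcomp (μ.app y) (ν.app y) (by simp [h]) := by
      rw [vcomp_hcomp, vcomp_hcomp]
      exact hcomp_congr _ (μ.arr_naturality f) (ν.arr_naturality f)
    exact e
  pro_naturality {x y} m := by
    have e₁ := assoc_naturality (μ.app x) (ν.app x) (ν.right.cell m) (by simp [h]) (by simp)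
    have e₂ : DoubleCategory.hcomp (μ.app x)
          (DoubleCategory.hcomp (ν.app x) (ν.right.cell m) (by simp)) (by simp [h]) ≫ᶜ
          DoubleCategory.hcomp (DoubleCategory.one (σ'.app x)) (τ'.nat m) (by simp) =
        DoubleCategory.hcomp (DoubleCategory.one (σ.app x)) (τ.nat m) (by simp) ≫ᶜ
          DoubleCategory.hcomp (μ.app x)
            (DoubleCategory.hcomp (μ.right.cell m) (ν.app y) (by simp [h])) (by simp) := by
      rw [vcomp_hcomp, vcomp_hcomp]
      refine hcomp_congr _ (by simp) ((ν.pro_naturality m).trans ?_)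
      exact congrArg (τ.nat m ≫ᶜ ·) (hcomp_congr _ (by rw [h]) rfl)
    have e₃ := assocInv_naturality (μ.app x) (μ.right.cell m) (ν.app y) (by simp) (by simp [h])
    have e₄ : DoubleCategory.hcomp
          (DoubleCategory.hcomp (μ.app x) (μ.right.cell m) (by simp)) (ν.app y)
          (by simp [h]) ≫ᶜ
          DoubleCategory.hcomp (σ'.nat m) (DoubleCategory.one (τ'.app y)) (by simp) =
        DoubleCategory.hcomp (σ.nat m) (DoubleCategory.one (τ.app y)) (by simp) ≫ᶜ
          DoubleCategory.hcomp (DoubleCategory.hcomp (μ.left.cell m) (μ.app y) (by simp))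
            (ν.app y) (by simp [h]) := by
      rw [vcomp_hcomp, vcomp_hcomp]
      exact hcomp_congr _ (μ.pro_naturality m) (by simp)
    have e₅ := assoc_naturality (μ.left.cell m) (μ.app y) (ν.app y) (by simp) (by simp [h])
    have e : DoubleCategory.hcomp (DoubleCategory.hcomp (μ.app x) (ν.app x) (by simp [h]))
          (ν.right.cell m) (by simp) ≫ᶜ
          assoc (σ'.app x) (τ'.app x) (H'.mapPro m) ≫ᶜ
          DoubleCategory.hcomp (DoubleCategory.one (σ'.app x)) (τ'.nat m) (by simp) ≫ᶜ
          assocInv (σ'.app x) (G'.mapPro m) (τ'.app y) ≫ᶜ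
          DoubleCategory.hcomp (σ'.nat m) (DoubleCategory.one (τ'.app y)) (by simp) ≫ᶜ
          assoc (F'.mapPro m) (σ'.app y) (τ'.app y) =
        (assoc (σ.app x) (τ.app x) (H.mapPro m) ≫ᶜ
          DoubleCategory.hcomp (DoubleCategory.one (σ.app x)) (τ.nat m) (by simp) ≫ᶜ
          assocInv (σ.app x) (G.mapPro m) (τ.app y) ≫ᶜ
          DoubleCategory.hcomp (σ.nat m) (DoubleCategory.one (τ.app y)) (by simp) ≫ᶜ
          assoc (F.mapPro m) (σ.app y) (τ.app y)) ≫ᶜ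
          DoubleCategory.hcomp (μ.left.cell m)
            (DoubleCategory.hcomp (μ.app y) (ν.app y) (by simp [h])) (by simp) := by
      simp only [vcomp_assoc]
      rw [← e₅, ← vcomp_reassoc e₄, ← vcomp_reassoc e₃, ← vcomp_reassoc e₂, ← vcomp_reassoc e₁]
    exact e

/-- A globular modification from its components. -/
def ofGlobular {σ τ : PseudoProtrans F G} (μ : ∀ x : D, Globular (σ.app x) (τ.app x))
    (h₁ : ∀ {x y : D} (f : x ⟶ y), (μ x).cell ≫ᶜ τ.arr f = σ.arr f ≫ᶜ (μ y).cell)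
    (h₂ : ∀ {x y : D} (m : Pro x y),
      DoubleCategory.hcomp (μ x).cell (DoubleCategory.one (G.mapPro m)) (by simp) ≫ᶜ τ.nat m =
        σ.nat m ≫ᶜ
          DoubleCategory.hcomp (DoubleCategory.one (F.mapPro m)) (μ y).cell (by simp)) :
    Modification σ τ where
  left := 𝟙 F
  right := 𝟙 G
  app x := (μ x).cell
  src_app x := (μ x).src_cell
  tgt_app x := (μ x).tgt_cell
  arr_naturality := h₁
  pro_naturality := h₂

theorem assoc_aux {B : Type*} [Bicategory B] {a b c d a' b' c' d' : B} {p : a ⟶ b} {q : b ⟶ c}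
    {r : c ⟶ d} {p' : a' ⟶ b'} {q' : b' ⟶ c'} {r' : c' ⟶ d'} {f : a ⟶ a'} {g : b ⟶ b'}
    {h : c ⟶ c'} {k : d ⟶ d'} (s : p ≫ g ⟶ f ≫ p') (t : q ≫ h ⟶ g ≫ q')
    (u : r ≫ k ⟶ h ≫ r') :
    (α_ p q r).hom ▷ k ≫ (α_ p (q ≫ r) k).hom ≫ p ◁ ((α_ q r k).hom ≫ q ◁ u ≫
        (α_ q h r').inv ≫ t ▷ r' ≫ (α_ g q' r').hom) ≫ (α_ p g (q' ≫ r')).inv ≫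
        s ▷ (q' ≫ r') ≫ (α_ f p' (q' ≫ r')).hom =
      ((α_ (p ≫ q) r k).hom ≫ (p ≫ q) ◁ u ≫ (α_ (p ≫ q) h r').inv ≫
        ((α_ p q h).hom ≫ p ◁ t ≫ (α_ p g q').inv ≫ s ▷ q' ≫ (α_ f p' q').hom) ▷ r' ≫
        (α_ f (p' ≫ q') r').hom) ≫ f ◁ (α_ p' q' r').hom := by
  bicategory

theorem left_aux {B : Type*} [Bicategory B] {a b a' b' : B} {p : a ⟶ b}
    {p' : a' ⟶ b'} {f : a ⟶ a'} {g : b ⟶ b'} (s : p ≫ g ⟶ f ≫ p') :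
    (λ_ p).hom ▷ g ≫ s =
      ((α_ (𝟙 a) p g).hom ≫ 𝟙 a ◁ s ≫ (α_ (𝟙 a) f p').inv ≫
        ((λ_ f).hom ≫ (ρ_ f).inv) ▷ p' ≫ (α_ f (𝟙 a') p').hom) ≫ f ◁ (λ_ p').hom := by
  bicategory

theorem right_aux {B : Type*} [Bicategory B] {a b a' b' : B} {p : a ⟶ b}
    {p' : a' ⟶ b'} {f : a ⟶ a'} {g : b ⟶ b'} (s : p ≫ g ⟶ f ≫ p') :
    (ρ_ p).hom ▷ g ≫ s =
      ((α_ p (𝟙 b) g).hom ≫ p ◁ ((λ_ g).hom ≫ (ρ_ g).inv) ≫ (α_ p g (𝟙 b')).inv ≫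
        s ▷ 𝟙 b' ≫ (α_ f p' (𝟙 b')).hom) ≫ f ◁ (ρ_ p').hom := by
  bicategory

/-- The inverse of a globular modification with componentwise inverses. -/
def inverse {σ τ : PseudoProtrans F G} (μ : Modification σ τ)
    (hl : μ.left = 𝟙 F) (hr : μ.right = 𝟙 G) (ν : ∀ x : D, Globular (τ.app x) (σ.app x))
    (e₁ : ∀ x : D, μ.app x ≫ᶜ (ν x).cell = DoubleCategory.one _)
    (e₂ : ∀ x : D, (ν x).cell ≫ᶜ μ.app x = DoubleCategory.one _) : Modification τ σ :=
  ofGlobular ν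
    (fun {x y} f => by
      have e := congrArg (fun t => (ν x).cell ≫ᶜ t ≫ᶜ (ν y).cell) (μ.arr_naturality f)
      simp only [vcomp_assoc] at e
      rw [e₁, vcomp_one, ← vcomp_assoc (ν x).cell, e₂, one_vcomp] at e
      exact e.symm)
    (fun {x y} m => by
      have hx : tgt (μ.app x) = 𝟙 _ := by rw [μ.tgt_app, hr]; rfl
      have hy : src (μ.app y) = 𝟙 _ := by rw [μ.src_app, hl]; rfl
      have e₃ : DoubleCategory.hcomp (μ.app x) (DoubleCategory.one (G.mapPro m)) (by simp [hx]) ≫ᶜ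
            τ.nat m =
          σ.nat m ≫ᶜ
            DoubleCategory.hcomp (DoubleCategory.one (F.mapPro m)) (μ.app y) (by simp [hy]) := by
        refine Eq.trans ?_ ((μ.pro_naturality m).trans ?_)
        · exact congrArg (· ≫ᶜ _) (hcomp_congr _ rfl (by rw [hr]; rfl))
        · exact congrArg (_ ≫ᶜ ·) (hcomp_congr _ (by rw [hl]; rfl) rfl)
      have e₄ : ∀ (h h'), DoubleCategory.hcomp (ν x).cell (DoubleCategory.one (G.mapPro m)) h ≫ᶜ
          DoubleCategory.hcomp (μ.app x) (DoubleCategory.one (G.mapPro m)) h' =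
          DoubleCategory.one _ := by
        intro h h'
        rw [vcomp_hcomp, ← hcomp_one]
        exact hcomp_congr _ (e₂ x) (one_vcomp _)
      have e₅ : ∀ (h h'), DoubleCategory.hcomp (DoubleCategory.one (F.mapPro m)) (μ.app y) h ≫ᶜ
          DoubleCategory.hcomp (DoubleCategory.one (F.mapPro m)) (ν y).cell h' =
          DoubleCategory.one _ := by
        intro h h'
        rw [vcomp_hcomp, ← hcomp_one]
        exact hcomp_congr _ (one_vcomp _) (e₁ y)
      have e := congrArg (fun t =>
        DoubleCategory.hcomp (ν x).cell (DoubleCategory.one (G.mapPro m)) (by simp) ≫ᶜ t ≫ᶜ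
        DoubleCategory.hcomp (DoubleCategory.one (F.mapPro m)) (ν y).cell (by simp)) e₃
      simp only [vcomp_assoc] at e
      rw [e₅, vcomp_one, ← vcomp_assoc (DoubleCategory.hcomp (ν x).cell _ _), e₄, one_vcomp] at e
      exact e.symm)

/-- The associator modification. -/
def assoc (σ : PseudoProtrans F G) (τ : PseudoProtrans G H) {K : LaxDoubleFunctor D E}
    (ρ : PseudoProtrans H K) :
    Modification ((σ.comp τ).comp ρ) (σ.comp (τ.comp ρ)) :=
  ofGlobular
    (fun x => (assocIso (σ.app x) (τ.app x) (ρ.app x)).hom)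
    (fun f => (assoc_naturality (σ.arr f) (τ.arr f) (ρ.arr f) (by simp) (by simp)).symm)
    (fun m => congrArg Globular.cell (assoc_aux (B := UBicat E) (σ.globNat m) (τ.globNat m)
      (ρ.globNat m)))

/-- The left unitor modification. -/
def leftUnitor (σ : PseudoProtrans F G) : Modification ((PseudoProtrans.id F).comp σ) σ :=
  ofGlobular
    (fun x => (leftUnitorIso (σ.app x)).hom)
    (fun {x y} f => by
      have e := (leftUnitor_naturality (σ.arr f)).symm
      rw [hcomp_congr (α := DoubleCategory.pidMap (src (σ.arr f)))
        (α' := DoubleCategory.pidMap (F.map f)) _ (by simp) rfl] at e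
      exact e)
    (fun m => congrArg Globular.cell (left_aux (B := UBicat E) (σ.globNat m)))

/-- The right unitor modification. -/
def rightUnitor (σ : PseudoProtrans F G) : Modification (σ.comp (PseudoProtrans.id G)) σ :=
  ofGlobular
    (fun x => (rightUnitorIso (σ.app x)).hom)
    (fun {x y} f => by
      have e := (rightUnitor_naturality (σ.arr f)).symm
      rw [hcomp_congr (β := DoubleCategory.pidMap (tgt (σ.arr f)))
        (β' := DoubleCategory.pidMap (G.map f)) _ rfl (by simp)] at e
      exact e)
    (fun m => congrArg Globular.cell (right_aux (B := UBicat E) (σ.globNat m)))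

end Modification

variable (D E) in
/-- The objects of the double category `LaxPs D E`: lax double functors. -/
def LaxPs := LaxDoubleFunctor D E

instance : Category (LaxPs D E) := inferInstanceAs (Category (LaxDoubleFunctor D E))

/-- The double category of lax double functors, natural transformations, pseudo
protransformations and modifications. -/
instance LaxPs.doubleCategory : DoubleCategory (LaxPs D E) where
  Pro F G := PseudoProtrans (D := D) (E := E) F G
  Cell σ τ := Modification σ τ
  src μ := μ.left
  tgt μ := μ.right
  one σ := Modification.one σ
  vcomp μ ν := μ.vcomp ν
  src_one _ := rfl
  tgt_one _ := rfl
  src_vcomp _ _ := rfl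
  tgt_vcomp _ _ := rfl
  one_vcomp μ := Modification.ext (Category.id_comp _) (Category.id_comp _)
    (by funext; exact one_vcomp _)
  vcomp_one μ := Modification.ext (Category.comp_id _) (Category.comp_id _)
    (by funext; exact vcomp_one _)
  vcomp_assoc μ ν ξ := Modification.ext (Category.assoc _ _ _) (Category.assoc _ _ _)
    (by funext; exact vcomp_assoc _ _ _)
  pid F := PseudoProtrans.id (D := D) (E := E) F
  pidMap α := Modification.pidMap (D := D) (E := E) α
  src_pidMap _ := rfl
  tgt_pidMap _ := rfl
  pidMap_id _ := Modification.ext rfl rfl (by funext; exact pidMap_id _)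
  pidMap_comp _ _ := Modification.ext rfl rfl (by funext; exact pidMap_comp _ _)
  pcomp σ τ := σ.comp τ
  hcomp μ ν h := μ.hcomp ν h
  src_hcomp _ _ _ := rfl
  tgt_hcomp _ _ _ := rfl
  hcomp_one _ _ := Modification.ext rfl rfl (by funext; exact hcomp_one _ _)
  vcomp_hcomp _ _ _ _ _ _ := Modification.ext rfl rfl (by funext; exact vcomp_hcomp _ _ _ _ _ _)
  assoc σ τ ρ := Modification.assoc σ τ ρ
  assocInv σ τ ρ := (Modification.assoc σ τ ρ).inverse rfl rfl
    (fun x => (assocIso (σ.app x) (τ.app x) (ρ.app x)).inv)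
    (fun _ => assoc_assocInv _ _ _) (fun _ => assocInv_assoc _ _ _)
  src_assoc _ _ _ := rfl
  tgt_assoc _ _ _ := rfl
  assoc_assocInv _ _ _ := Modification.ext (Category.id_comp _) (Category.id_comp _)
    (by funext; exact assoc_assocInv _ _ _)
  assocInv_assoc _ _ _ := Modification.ext (Category.id_comp _) (Category.id_comp _)
    (by funext; exact assocInv_assoc _ _ _)
  assoc_naturality μ ν ξ h h' := Modification.ext
    ((Category.comp_id _).trans (Category.id_comp _).symm)
    ((Category.comp_id _).trans (Category.id_comp _).symm)
    (by funext; exact assoc_naturality _ _ _ _ _)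
  leftUnitor σ := Modification.leftUnitor σ
  leftUnitorInv σ := (Modification.leftUnitor σ).inverse rfl rfl
    (fun x => (leftUnitorIso (σ.app x)).inv)
    (fun _ => leftUnitor_inv _) (fun _ => inv_leftUnitor _)
  src_leftUnitor _ := rfl
  tgt_leftUnitor _ := rfl
  leftUnitor_inv _ := Modification.ext (Category.id_comp _) (Category.id_comp _)
    (by funext; exact leftUnitor_inv _)
  inv_leftUnitor _ := Modification.ext (Category.id_comp _) (Category.id_comp _)
    (by funext; exact inv_leftUnitor _)
  leftUnitor_naturality μ := Modification.ext
    ((Category.comp_id _).trans (Category.id_comp _).symm)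
    ((Category.comp_id _).trans (Category.id_comp _).symm)
    (by
      funext x
      refine Eq.trans ?_ (leftUnitor_naturality (μ.app x))
      exact congrArg (· ≫ᶜ _) (hcomp_congr _ (congrArg pidMap (μ.src_app x).symm) rfl))
  rightUnitor σ := Modification.rightUnitor σ
  rightUnitorInv σ := (Modification.rightUnitor σ).inverse rfl rfl
    (fun x => (rightUnitorIso (σ.app x)).inv)
    (fun _ => rightUnitor_inv _) (fun _ => inv_rightUnitor _)
  src_rightUnitor _ := rfl
  tgt_rightUnitor _ := rfl
  rightUnitor_inv _ := Modification.ext (Category.id_comp _) (Category.id_comp _)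
    (by funext; exact rightUnitor_inv _)
  inv_rightUnitor _ := Modification.ext (Category.id_comp _) (Category.id_comp _)
    (by funext; exact inv_rightUnitor _)
  rightUnitor_naturality μ := Modification.ext
    ((Category.comp_id _).trans (Category.id_comp _).symm)
    ((Category.comp_id _).trans (Category.id_comp _).symm)
    (by
      funext x
      refine Eq.trans ?_ (rightUnitor_naturality (μ.app x))
      exact congrArg (· ≫ᶜ _) (hcomp_congr _ rfl (congrArg pidMap (μ.tgt_app x).symm)))
  pentagon σ τ ρ π := Modification.ext (Category.id_comp _) (Category.id_comp _)
    (by funext; exact pentagon _ _ _ _)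
  triangle _ _ := Modification.ext (Category.id_comp _) (Category.id_comp _)
    (by funext; exact triangle _ _)

end Protransformations

/-! ## Companions, conjoints, adjoint equivalences -/

section Companions

variable {D : Type u} [Category.{v} D] [DoubleCategory.{c, p} D]

/-- A companion of an arrow `f : x ⟶ y`. -/
structure Companion {x y : D} (f : x ⟶ y) where
  pro : Pro x y
  unit : Cell (pid x) pro
  counit : Cell pro (pid y)
  src_unit : src unit = 𝟙 x
  tgt_unit : tgt unit = f
  src_counit : src counit = f
  tgt_counit : tgt counit = 𝟙 y
  hcomp_eq : leftUnitorInv pro ≫ᶜ hcomp unit counit (by rw [tgt_unit, src_counit]) ≫ᶜ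
    rightUnitor pro = one pro
  vcomp_eq : unit ≫ᶜ counit = pidMap f

/-- A conjoint of an arrow `f : x ⟶ y`. -/
structure Conjoint {x y : D} (f : x ⟶ y) where
  pro : Pro y x
  unit : Cell (pid x) pro
  counit : Cell pro (pid y)
  src_unit : src unit = f
  tgt_unit : tgt unit = 𝟙 x
  src_counit : src counit = 𝟙 y
  tgt_counit : tgt counit = f
  hcomp_eq : rightUnitorInv pro ≫ᶜ hcomp counit unit (by rw [tgt_counit, src_unit]) ≫ᶜ
    leftUnitor pro = one pro
  vcomp_eq : unit ≫ᶜ counit = pidMap f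

attribute [simp] Companion.src_unit Companion.tgt_unit Companion.src_counit Companion.tgt_counit
  Conjoint.src_unit Conjoint.tgt_unit Conjoint.src_counit Conjoint.tgt_counit

/-- Reshaping a cell by sliding its sides along companions, giving the globular cell
`m ⊙ g_! → f_! ⊙ n`, that is, the external composite of the unit of `f_!`, the cell, and the counit
of `g_!`. -/
def slideCompanion {x y w z : D} {m : Pro x y} {n : Pro w z} {f : x ⟶ w} {g : y ⟶ z}
    (α : Cell m n) (hf : src α = f) (hg : tgt α = g) (F : Companion f) (G : Companion g) :
    Cell (m ⊙ G.pro) (F.pro ⊙ n) :=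
  hcomp (leftUnitorInv m) (one G.pro) (by simp) ≫ᶜ
    hcomp (hcomp F.unit α (by simp [hf])) G.counit (by simp [hg]) ≫ᶜ
    rightUnitor (F.pro ⊙ n)

/-- Reshaping a cell by sliding its sides along conjoints, giving the globular cell
`f^* ⊙ m → n ⊙ g^*`, that is, the external composite of the counit of `f^*`, the cell, and the unit
of `g^*`. -/
def slideConjoint {x y w z : D} {m : Pro x y} {n : Pro w z} {f : x ⟶ w} {g : y ⟶ z}
    (α : Cell m n) (hf : src α = f) (hg : tgt α = g) (F : Conjoint f) (G : Conjoint g) :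
    Cell (F.pro ⊙ m) (n ⊙ G.pro) :=
  rightUnitorInv (F.pro ⊙ m) ≫ᶜ
    hcomp (hcomp F.counit α (by simp [hf])) G.unit (by simp [hg]) ≫ᶜ
    hcomp (leftUnitor n) (one G.pro) (by simp)

/-- For a commutative square of arrows `f ≫ k = h ≫ g`, the cell `h_! → k_!` with sides `f` and
`g`, obtained from the external identity on the common composite by sliding `h` and `k`. -/
def slideSquareCompanion {x y w z : D} {f : x ⟶ y} {k : y ⟶ z} {h : x ⟶ w} {g : w ⟶ z}
    (e : f ≫ k = h ≫ g) (H : Companion h) (K : Companion k) : Cell H.pro K.pro :=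
  leftUnitorInv H.pro ≫ᶜ
    hcomp (pidMap f ≫ᶜ K.unit) (H.counit ≫ᶜ pidMap g) (by simpa using e) ≫ᶜ
    rightUnitor K.pro

/-- For a commutative square of arrows `f ≫ k = h ≫ g`, the cell `h^* → k^*` with sides `g` and
`f`, obtained from the external identity on the common composite by sliding `h` and `k`. -/
def slideSquareConjoint {x y w z : D} {f : x ⟶ y} {k : y ⟶ z} {h : x ⟶ w} {g : w ⟶ z}
    (e : f ≫ k = h ≫ g) (H : Conjoint h) (K : Conjoint k) : Cell H.pro K.pro :=
  rightUnitorInv H.pro ≫ᶜ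
    hcomp (H.counit ≫ᶜ pidMap g) (pidMap f ≫ᶜ K.unit) (by simpa using e.symm) ≫ᶜ
    leftUnitor K.pro

/-- An adjoint equivalence `left ⊣ right` between proarrows, that is, in the underlying
bicategory. -/
structure ProAdjointEquivalence {x y : D} (left : Pro x y) (right : Pro y x) where
  unit : Globular (pid x) (left ⊙ right)
  counit : Globular (right ⊙ left) (pid y)
  unit_invertible : IsInvertible unit.cell
  counit_invertible : IsInvertible counit.cell
  triangle_left : leftUnitorInv left ≫ᶜ hcomp unit.cell (one left) (by simp) ≫ᶜ
    assoc left right left ≫ᶜ hcomp (one left) counit.cell (by simp) ≫ᶜ rightUnitor left = one left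
  triangle_right : rightUnitorInv right ≫ᶜ hcomp (one right) unit.cell (by simp) ≫ᶜ
    assocInv right left right ≫ᶜ hcomp counit.cell (one right) (by simp) ≫ᶜ leftUnitor right =
      one right

variable {E : Type u₁} [Category.{v₁} E] [DoubleCategory.{c₁, p₁} E]
  {F G : LaxDoubleFunctor D E}

/-- The data of the companion `α_! : F ⇸ G` of a natural transformation `α`, for a choice of
companions of the components of `α` at objects. -/
def DoubleNatTrans.companionData (α : DoubleNatTrans F G) (A : ∀ x : D, Companion (α.app x)) :
    OplaxProtransData F G where
  app x := (A x).pro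
  arr {x y} f := slideSquareCompanion (α.naturality f) (A x) (A y)
  src_arr _ := by simp [slideSquareCompanion]
  tgt_arr _ := by simp [slideSquareCompanion]
  nat {x y} m := slideCompanion (α.cell m) (α.src_cell m) (α.tgt_cell m) (A x) (A y)
  src_nat _ := by simp [slideCompanion]
  tgt_nat _ := by simp [slideCompanion]

/-- The data of the conjoint `α^* : G ⇸ F` of a natural transformation `α`, for a choice of
conjoints of the components of `α` at objects. -/
def DoubleNatTrans.conjointData (α : DoubleNatTrans F G) (A : ∀ x : D, Conjoint (α.app x)) :
    LaxProtransData G F where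
  app x := (A x).pro
  arr {x y} f := slideSquareConjoint (α.naturality f) (A x) (A y)
  src_arr _ := by simp [slideSquareConjoint]
  tgt_arr _ := by simp [slideSquareConjoint]
  nat {x y} m := slideConjoint (α.cell m) (α.src_cell m) (α.tgt_cell m) (A x) (A y)
  src_nat _ := by simp [slideConjoint]
  tgt_nat _ := by simp [slideConjoint]

/-- An adjunction `L ⊣ R` in the 2-category of double categories, lax double functors and natural
transformations. -/
structure DoubleAdjunction (L : LaxDoubleFunctor D E) (R : LaxDoubleFunctor E D) where
  unit : DoubleNatTrans (LaxDoubleFunctor.id D) (L.comp R)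
  counit : DoubleNatTrans (R.comp L) (LaxDoubleFunctor.id E)
  left_triangle : ∀ x : D, L.map (unit.app x) ≫ counit.app (L.obj x) = 𝟙 (L.obj x)
  left_triangle_cell : ∀ {x y : D} (m : Pro x y),
    L.mapCell (unit.cell m) ≫ᶜ counit.cell (L.mapPro m) = one (L.mapPro m)
  right_triangle : ∀ x : E, unit.app (R.obj x) ≫ R.map (counit.app x) = 𝟙 (R.obj x)
  right_triangle_cell : ∀ {x y : E} (m : Pro x y),
    unit.cell (R.mapPro m) ≫ᶜ R.mapCell (counit.cell m) = one (R.mapPro m)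

end Companions

/-! ## Families -/

section Families

/-- The two kinds of index sets for products: arbitrary (small) sets or finite sets. -/
inductive IndexKind
  | arbitrary
  | finite

/-- A type is an allowed index set. -/
def IndexKind.Mem : IndexKind → Type w → Prop
  | .arbitrary, _ => True
  | .finite, T => Finite T

theorem IndexKind.mem_of_finite (κ : IndexKind) (T : Type w) [h : Finite T] : κ.Mem T := by
  cases κ
  · trivial
  · exact h

theorem IndexKind.mem_sigma (κ : IndexKind) {J : Type w} {A : J → Type w} (hJ : κ.Mem J)
    (hA : ∀ j, κ.Mem (A j)) : κ.Mem (Σ j, A j) := by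
  cases κ
  · trivial
  · have : Finite J := hJ
    have : ∀ j, Finite (A j) := hA
    exact inferInstanceAs (Finite (Σ j, A j))

theorem IndexKind.mem_prod (κ : IndexKind) {A B : Type w} (hA : κ.Mem A)
    (hB : κ.Mem B) : κ.Mem (A × B) := by
  cases κ
  · trivial
  · have : Finite A := hA
    have : Finite B := hB
    exact inferInstanceAs (Finite (A × B))

/-- The identity span on `I`: its fibre over `(i, j)` has exactly one element if `i = j`, and
none otherwise. -/
inductive IdSpan {I : Type w} : I → I → Type w
  | refl (i : I) : IdSpan i i

instance {I : Type w} (i j : I) : Subsingleton (IdSpan i j) :=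
  ⟨fun a b => by cases a; cases b; rfl⟩

/-- Identity spans are functorial in the index set. -/
def IdSpan.map {I K : Type w} (f : K → I) : ∀ {k l : K}, IdSpan k l → IdSpan (f k) (f l)
  | _, _, .refl k => .refl (f k)

/-- The family of proarrows over the identity span given by a parallel family. -/
def IdSpan.pro {D : Type u} [Category.{v} D] [DoubleCategory.{c, p} D] {I : Type w} {x y : I → D}
    (m : ∀ i, Pro (x i) (y i)) : ∀ {i j : I}, IdSpan i j → Pro (x i) (y j)
  | _, _, .refl i => m i

/-- The family of cells over the identity span given by a parallel family. -/
def IdSpan.cell {D : Type u} [Category.{v} D] [DoubleCategory.{c, p} D] {I K : Type w}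
    {x y : I → D} {x' y' : K → D} {m : ∀ i, Pro (x i) (y i)} {m' : ∀ k, Pro (x' k) (y' k)}
    (f : K → I) (α : ∀ k, Cell (m (f k)) (m' k)) :
    ∀ {k l : K} (b : IdSpan k l), Cell (IdSpan.pro m (IdSpan.map f b)) (IdSpan.pro m' b)
  | _, _, .refl k => α k

variable (κ : IndexKind) (D : Type u) [Category.{v} D] [DoubleCategory.{c, p} D]

/-- Objects of `Fam κ D`: families of objects of `D` indexed by a set (of the kind `κ`). -/
structure Fam where
  idx : Type w
  mem : κ.Mem idx
  obj : idx → D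

variable {κ D}

/-- Arrows `(I, x) ⟶ (K, w)` of `Fam κ D`: a function `K → I` with arrows `x_{f k} ⟶ w_k`. -/
@[ext] structure Fam.Hom (X W : Fam.{w} κ D) where
  idx : W.idx → X.idx
  arr : ∀ k, X.obj (idx k) ⟶ W.obj k

instance : Category (Fam.{w} κ D) where
  Hom := Fam.Hom
  id X := ⟨fun i => i, fun _ => 𝟙 _⟩
  comp f g := ⟨fun k => f.idx (g.idx k), fun k => f.arr (g.idx k) ≫ g.arr k⟩
  id_comp f := Fam.Hom.ext rfl (heq_of_eq (by funext; exact Category.id_comp _))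
  comp_id f := Fam.Hom.ext rfl (heq_of_eq (by funext; exact Category.comp_id _))
  assoc f g h := Fam.Hom.ext rfl (heq_of_eq (by funext; exact Category.assoc _ _ _))

/-- Proarrows `(I, x) ⇸ (J, y)` of `Fam κ D`: a span of index sets from `I` to `J` with a proarrow
`x_i ⇸ y_j` for each element of the apex lying over `i` and `j`. The span is given by
its fibres: `idx i j` is the set of elements of the apex lying over `i` and `j`. -/
structure Fam.Proarrow (X Y : Fam.{w} κ D) where
  idx : X.idx → Y.idx → Type w
  mem : ∀ i j, κ.Mem (idx i j)
  pro : ∀ {i j}, idx i j → Pro (X.obj i) (Y.obj j)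

/-- Cells of `Fam κ D`: arrows `src`, `tgt` of families, a map of spans over them (in the direction
opposite to the cell), and for each element of the bottom span a cell of `D`. -/
structure Fam.Square {X Y W Z : Fam.{w} κ D} (m : Fam.Proarrow X Y) (n : Fam.Proarrow W Z) where
  src : X ⟶ W
  tgt : Y ⟶ Z
  idx : ∀ {k l}, n.idx k l → m.idx (src.idx k) (tgt.idx l)
  cell : ∀ {k l} (b : n.idx k l), Cell (m.pro (idx b)) (n.pro b)
  src_cell : ∀ {k l} (b : n.idx k l), DoubleCategory.src (cell b) = src.arr k
  tgt_cell : ∀ {k l} (b : n.idx k l), DoubleCategory.tgt (cell b) = tgt.arr l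

attribute [simp] Fam.Square.src_cell Fam.Square.tgt_cell

theorem Fam.Square.ext_sigma {X Y W Z : Fam.{w} κ D} {m : Fam.Proarrow X Y}
    {n : Fam.Proarrow W Z} {s : W.idx → X.idx} {t : Z.idx → Y.idx}
    {sa sa' : ∀ k, X.obj (s k) ⟶ W.obj k} {ta ta' : ∀ k, Y.obj (t k) ⟶ Z.obj k}
    {i i' : ∀ {k l}, n.idx k l → m.idx (s k) (t l)}
    {f : ∀ {k l} (b : n.idx k l), Cell (m.pro (i b)) (n.pro b)}
    {f' : ∀ {k l} (b : n.idx k l), Cell (m.pro (i' b)) (n.pro b)} {h₁ h₂ h₁' h₂'}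
    (hs : sa = sa') (ht : ta = ta')
    (hf : ∀ {k l} (b : n.idx k l), (⟨i b, f b⟩ : Σ a, Cell (m.pro a) (n.pro b)) = ⟨i' b, f' b⟩) :
    (⟨⟨s, sa⟩, ⟨t, ta⟩, i, f, h₁, h₂⟩ : Fam.Square m n) = ⟨⟨s, sa'⟩, ⟨t, ta'⟩, i', f', h₁', h₂'⟩ := by
  subst hs ht
  have hi : @i = @i' := by
    funext k l b
    exact congrArg Sigma.fst (hf b)
  subst hi
  have hf' : @f = @f' := by
    funext k l b
    exact eq_of_heq (Sigma.mk.inj (hf b)).2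
  subst hf'
  rfl

theorem Fam.Square.ext_cell {X Y W Z : Fam.{w} κ D} {m : Fam.Proarrow X Y}
    {n : Fam.Proarrow W Z} {s : W.idx → X.idx} {t : Z.idx → Y.idx}
    {sa sa' : ∀ k, X.obj (s k) ⟶ W.obj k} {ta ta' : ∀ k, Y.obj (t k) ⟶ Z.obj k}
    {i : ∀ {k l}, n.idx k l → m.idx (s k) (t l)}
    {f f' : ∀ {k l} (b : n.idx k l), Cell (m.pro (i b)) (n.pro b)} {h₁ h₂ h₁' h₂'}
    (hs : sa = sa') (ht : ta = ta') (hf : ∀ {k l} (b : n.idx k l), f b = f' b) :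
    (⟨⟨s, sa⟩, ⟨t, ta⟩, i, f, h₁, h₂⟩ : Fam.Square m n) = ⟨⟨s, sa'⟩, ⟨t, ta'⟩, i, f', h₁', h₂'⟩ :=
  Fam.Square.ext_sigma hs ht (fun b => by rw [hf b])

/-- The proarrow of families over the identity span. -/
def Fam.parallel {I : Type w} (hI : κ.Mem I) {x y : I → D} (m : ∀ i, Pro (x i) (y i)) :
    Fam.Proarrow (κ := κ) ⟨I, hI, x⟩ ⟨I, hI, y⟩ where
  idx i j := IdSpan i j
  mem _ _ := κ.mem_of_finite _
  pro a := IdSpan.pro m a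

/-- External composition, over the composite (pullback) span. -/
def Fam.pcomp {X Y Z : Fam.{w} κ D} (m : Fam.Proarrow X Y) (n : Fam.Proarrow Y Z) :
    Fam.Proarrow X Z where
  idx i k := Σ j, m.idx i j × n.idx j k
  mem i k := κ.mem_sigma Y.mem fun j => κ.mem_prod (m.mem i j) (n.mem j k)
  pro a := m.pro a.2.1 ⊙ n.pro a.2.2

/-- The map of spans underlying the left unitor. -/
def Fam.leftUnitorIdx {X Y : Fam.{w} κ D} (m : Fam.Proarrow X Y) :
    ∀ (i : X.idx) (j : Y.idx), (Σ k, IdSpan i k × m.idx k j) → m.idx i j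
  | _, _, ⟨_, .refl _, b⟩ => b

/-- The map of spans underlying the right unitor. -/
def Fam.rightUnitorIdx {X Y : Fam.{w} κ D} (m : Fam.Proarrow X Y) :
    ∀ (i : X.idx) (j : Y.idx), (Σ k, m.idx i k × IdSpan k j) → m.idx i j
  | _, _, ⟨_, b, .refl _⟩ => b

/-- The cells of the inverse of the left unitor. -/
def Fam.leftUnitorInvCell {X Y : Fam.{w} κ D} (m : Fam.Proarrow X Y) :
    ∀ (i : X.idx) (j : Y.idx) (b : Σ k, IdSpan i k × m.idx k j),
      Cell (m.pro (Fam.leftUnitorIdx m i j b))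
        (IdSpan.pro (fun i => pid (X.obj i)) b.2.1 ⊙ m.pro b.2.2)
  | _, _, ⟨_, .refl _, b⟩ => leftUnitorInv (m.pro b)

/-- The cells of the inverse of the right unitor. -/
def Fam.rightUnitorInvCell {X Y : Fam.{w} κ D} (m : Fam.Proarrow X Y) :
    ∀ (i : X.idx) (j : Y.idx) (b : Σ k, m.idx i k × IdSpan k j),
      Cell (m.pro (Fam.rightUnitorIdx m i j b))
        (m.pro b.2.1 ⊙ IdSpan.pro (fun i => pid (Y.obj i)) b.2.2)
  | _, _, ⟨_, b, .refl _⟩ => rightUnitorInv (m.pro b)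

namespace Fam.Square

variable {X Y Z T X' Y' Z' T' : Fam.{w} κ D}

/-- The identity cell. -/
def one (m : Fam.Proarrow X Y) : Fam.Square m m where
  src := 𝟙 X
  tgt := 𝟙 Y
  idx b := b
  cell _ := DoubleCategory.one _
  src_cell _ := src_one _
  tgt_cell _ := tgt_one _

/-- Internal composition. -/
def vcomp {X'' Y'' : Fam.{w} κ D} {m : Fam.Proarrow X Y} {m' : Fam.Proarrow X' Y'}
    {m'' : Fam.Proarrow X'' Y''} (α : Fam.Square m m') (β : Fam.Square m' m'') :
    Fam.Square m m'' where
  src := α.src ≫ β.src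
  tgt := α.tgt ≫ β.tgt
  idx b := α.idx (β.idx b)
  cell b := α.cell (β.idx b) ≫ᶜ β.cell b
  src_cell b := by rw [src_vcomp, α.src_cell, β.src_cell]; rfl
  tgt_cell b := by rw [tgt_vcomp, α.tgt_cell, β.tgt_cell]; rfl

/-- The cell between parallel families given by a reindexing function and a family of cells. -/
def parallel {I K : Type w} (hI : κ.Mem I) (hK : κ.Mem K) {x y : I → D} {x' y' : K → D}
    {m : ∀ i, Pro (x i) (y i)} {m' : ∀ k, Pro (x' k) (y' k)} (f : K → I)
    (s : ∀ k, x (f k) ⟶ x' k) (t : ∀ k, y (f k) ⟶ y' k) (α : ∀ k, Cell (m (f k)) (m' k))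
    (hs : ∀ k, DoubleCategory.src (α k) = s k) (ht : ∀ k, DoubleCategory.tgt (α k) = t k) :
    Fam.Square (Fam.parallel hI m) (Fam.parallel hK m') where
  src := ⟨f, s⟩
  tgt := ⟨f, t⟩
  idx b := IdSpan.map f b
  cell b := IdSpan.cell f α b
  src_cell b := by cases b; exact hs _
  tgt_cell b := by cases b; exact ht _

/-- The external identity cell. -/
def pidMap (f : X ⟶ X') : Fam.Square (Fam.parallel X.mem fun i => pid (X.obj i))
    (Fam.parallel X'.mem fun i => pid (X'.obj i)) where
  src := f
  tgt := f
  idx b := IdSpan.map f.idx b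
  cell b := IdSpan.cell f.idx (fun k => DoubleCategory.pidMap (f.arr k)) b
  src_cell b := by cases b; exact src_pidMap _
  tgt_cell b := by cases b; exact tgt_pidMap _

/-- The left unitor. -/
def leftUnitor (m : Fam.Proarrow X Y) :
    Fam.Square (Fam.pcomp (Fam.parallel X.mem fun i => pid (X.obj i)) m) m where
  src := 𝟙 _
  tgt := 𝟙 _
  idx b := ⟨_, .refl _, b⟩
  cell b := DoubleCategory.leftUnitor (m.pro b)
  src_cell _ := src_leftUnitor _
  tgt_cell _ := tgt_leftUnitor _

/-- The inverse of the left unitor. -/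
def leftUnitorInv (m : Fam.Proarrow X Y) :
    Fam.Square m (Fam.pcomp (Fam.parallel X.mem fun i => pid (X.obj i)) m) where
  src := 𝟙 _
  tgt := 𝟙 _
  idx {i j} b := leftUnitorIdx m i j b
  cell {i j} b := leftUnitorInvCell m i j b
  src_cell := by rintro _ _ ⟨_, ⟨⟩, b⟩; exact src_leftUnitorInv _
  tgt_cell := by rintro _ _ ⟨_, ⟨⟩, b⟩; exact tgt_leftUnitorInv _

/-- The right unitor. -/
def rightUnitor (m : Fam.Proarrow X Y) :
    Fam.Square (Fam.pcomp m (Fam.parallel Y.mem fun i => pid (Y.obj i))) m where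
  src := 𝟙 _
  tgt := 𝟙 _
  idx b := ⟨_, b, .refl _⟩
  cell b := DoubleCategory.rightUnitor (m.pro b)
  src_cell _ := src_rightUnitor _
  tgt_cell _ := tgt_rightUnitor _

/-- The inverse of the right unitor. -/
def rightUnitorInv (m : Fam.Proarrow X Y) :
    Fam.Square m (Fam.pcomp m (Fam.parallel Y.mem fun i => pid (Y.obj i))) where
  src := 𝟙 _
  tgt := 𝟙 _
  idx {i j} b := rightUnitorIdx m i j b
  cell {i j} b := rightUnitorInvCell m i j b
  src_cell := by rintro _ _ ⟨_, b, ⟨⟩⟩; exact src_rightUnitorInv _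
  tgt_cell := by rintro _ _ ⟨_, b, ⟨⟩⟩; exact tgt_rightUnitorInv _

/-- External composition. -/
def hcomp {m : Fam.Proarrow X Y} {n : Fam.Proarrow Y Z} {m' : Fam.Proarrow X' Y'}
    {n' : Fam.Proarrow Y' Z'} (α : Fam.Square m m') (β : Fam.Square n n') (h : α.tgt = β.src) :
    Fam.Square (Fam.pcomp m n) (Fam.pcomp m' n') :=
  match α, β, h with
  | ⟨s, t, i, f, hs, ht⟩, ⟨_, t', i', f', hs', ht'⟩, rfl =>
    { src := s
      tgt := t'
      idx := fun b => ⟨t.idx b.1, i b.2.1, i' b.2.2⟩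
      cell := fun b => DoubleCategory.hcomp (f b.2.1) (f' b.2.2) (by rw [ht, hs'])
      src_cell := fun b => (src_hcomp _ _ _).trans (hs _)
      tgt_cell := fun b => (tgt_hcomp _ _ _).trans (ht' _) }

end Fam.Square

/-- The double category of families: the free completion of `D` under lax products. -/
instance Fam.doubleCategory : DoubleCategory (Fam.{w} κ D) where
  Pro X Y := Fam.Proarrow X Y
  Cell m n := Fam.Square m n
  src α := α.src
  tgt α := α.tgt
  one m := Fam.Square.one m
  vcomp α β := α.vcomp β
  src_one _ := rfl
  tgt_one _ := rfl
  src_vcomp _ _ := rfl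
  tgt_vcomp _ _ := rfl
  one_vcomp _ := Fam.Square.ext_cell (by funext; exact Category.id_comp _)
    (by funext; exact Category.id_comp _) (fun _ => one_vcomp _)
  vcomp_one _ := Fam.Square.ext_cell (by funext; exact Category.comp_id _)
    (by funext; exact Category.comp_id _) (fun _ => vcomp_one _)
  vcomp_assoc _ _ _ := Fam.Square.ext_cell (by funext; exact Category.assoc _ _ _)
    (by funext; exact Category.assoc _ _ _) (fun _ => vcomp_assoc _ _ _)
  pid X := Fam.parallel X.mem (fun i => pid (X.obj i))
  pidMap f := Fam.Square.pidMap f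
  src_pidMap _ := rfl
  tgt_pidMap _ := rfl
  pidMap_id _ := Fam.Square.ext_sigma rfl rfl (fun b => by
    cases b; exact Sigma.ext rfl (heq_of_eq (pidMap_id _)))
  pidMap_comp _ _ := Fam.Square.ext_sigma rfl rfl (fun b => by
    cases b; exact Sigma.ext rfl (heq_of_eq (pidMap_comp _ _)))
  pcomp m n := Fam.pcomp m n
  hcomp α β h := α.hcomp β h
  src_hcomp := by rintro _ _ _ _ _ _ _ _ _ _ ⟨⟩ ⟨⟩ ⟨⟩; rfl
  tgt_hcomp := by rintro _ _ _ _ _ _ _ _ _ _ ⟨⟩ ⟨⟩ ⟨⟩; rfl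
  hcomp_one _ _ := Fam.Square.ext_cell rfl rfl (fun _ => hcomp_one _ _)
  vcomp_hcomp := by
    rintro _ _ _ _ _ _ _ _ _ _ _ _ _ _ _ ⟨⟩ ⟨⟩ ⟨⟩ ⟨⟩ ⟨⟩ ⟨⟩
    exact Fam.Square.ext_cell rfl rfl (fun _ => vcomp_hcomp _ _ _ _ _ _)
  assoc m n q :=
    { src := 𝟙 _
      tgt := 𝟙 _
      idx := fun b => ⟨b.2.2.1, ⟨b.1, b.2.1, b.2.2.2.1⟩, b.2.2.2.2⟩
      cell := fun _ => assoc _ _ _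
      src_cell := fun _ => src_assoc _ _ _
      tgt_cell := fun _ => tgt_assoc _ _ _ }
  assocInv m n q :=
    { src := 𝟙 _
      tgt := 𝟙 _
      idx := fun b => ⟨b.2.1.1, b.2.1.2.1, ⟨b.1, b.2.1.2.2, b.2.2⟩⟩
      cell := fun _ => assocInv _ _ _
      src_cell := fun _ => src_assocInv _ _ _
      tgt_cell := fun _ => tgt_assocInv _ _ _ }
  src_assoc _ _ _ := rfl
  tgt_assoc _ _ _ := rfl
  assoc_assocInv _ _ _ := Fam.Square.ext_cell (by funext; exact Category.id_comp _)
    (by funext; exact Category.id_comp _) (fun _ => assoc_assocInv _ _ _)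
  assocInv_assoc _ _ _ := Fam.Square.ext_cell (by funext; exact Category.id_comp _)
    (by funext; exact Category.id_comp _) (fun _ => assocInv_assoc _ _ _)
  assoc_naturality := by
    rintro _ _ _ _ _ _ _ _ _ _ _ _ _ _ ⟨⟩ ⟨⟩ ⟨⟩ ⟨⟩ ⟨⟩
    exact Fam.Square.ext_cell
      (by funext; exact (Category.comp_id _).trans (Category.id_comp _).symm)
      (by funext; exact (Category.comp_id _).trans (Category.id_comp _).symm)
      (fun _ => assoc_naturality _ _ _ _ _)
  leftUnitor m := Fam.Square.leftUnitor m
  leftUnitorInv m := Fam.Square.leftUnitorInv m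
  src_leftUnitor _ := rfl
  tgt_leftUnitor _ := rfl
  leftUnitor_inv _ := Fam.Square.ext_sigma (by funext; exact Category.id_comp _)
    (by funext; exact Category.id_comp _) (by
      rintro _ _ ⟨_, ⟨⟩, b⟩; exact Sigma.ext rfl (heq_of_eq (leftUnitor_inv _)))
  inv_leftUnitor _ := Fam.Square.ext_cell (by funext; exact Category.id_comp _)
    (by funext; exact Category.id_comp _) (fun _ => inv_leftUnitor _)
  leftUnitor_naturality := by
    rintro _ _ _ _ _ _ ⟨s, t, i, f, hs, ht⟩
    apply Fam.Square.ext_cell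
    · funext
      exact (Category.comp_id _).trans (Category.id_comp _).symm
    · funext
      exact (Category.comp_id _).trans (Category.id_comp _).symm
    · intro _ _ b
      refine Eq.trans ?_ (leftUnitor_naturality (f b))
      exact congrArg (· ≫ᶜ _) (hcomp_congr _ (congrArg pidMap (hs b).symm) rfl)
  rightUnitor m := Fam.Square.rightUnitor m
  rightUnitorInv m := Fam.Square.rightUnitorInv m
  src_rightUnitor _ := rfl
  tgt_rightUnitor _ := rfl
  rightUnitor_inv _ := Fam.Square.ext_sigma (by funext; exact Category.id_comp _)
    (by funext; exact Category.id_comp _) (by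
      rintro _ _ ⟨_, b, ⟨⟩⟩; exact Sigma.ext rfl (heq_of_eq (rightUnitor_inv _)))
  inv_rightUnitor _ := Fam.Square.ext_cell (by funext; exact Category.id_comp _)
    (by funext; exact Category.id_comp _) (fun _ => inv_rightUnitor _)
  rightUnitor_naturality := by
    rintro _ _ _ _ _ _ ⟨s, t, i, f, hs, ht⟩
    apply Fam.Square.ext_cell
    · funext
      exact (Category.comp_id _).trans (Category.id_comp _).symm
    · funext
      exact (Category.comp_id _).trans (Category.id_comp _).symm
    · intro _ _ b
      refine Eq.trans ?_ (rightUnitor_naturality (f b))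
      exact congrArg (· ≫ᶜ _) (hcomp_congr _ rfl (congrArg pidMap (ht b).symm))
  pentagon _ _ _ _ := Fam.Square.ext_cell (by funext; exact Category.id_comp _)
    (by funext; exact Category.id_comp _) (fun _ => pentagon _ _ _ _)
  triangle _ _ := by
    apply Fam.Square.ext_sigma
    · funext
      exact Category.id_comp _
    · funext
      exact Category.id_comp _
    · rintro _ _ _
      exact Sigma.ext rfl (heq_of_eq (triangle _ _))

end Families

/-! ## Products -/

section Products

variable {D : Type u} [Category.{v} D] [DoubleCategory.{c, p} D]

/-- The power double category `D^I`, with everything computed componentwise. -/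
instance powerDoubleCategory (I : Type w) : DoubleCategory (I → D) where
  Pro x y := ∀ i, Pro (x i) (y i)
  Cell m n := ∀ i, Cell (m i) (n i)
  src α := fun i => src (α i)
  tgt α := fun i => tgt (α i)
  one m := fun i => one (m i)
  vcomp α β := fun i => α i ≫ᶜ β i
  src_one _ := by funext; exact src_one _
  tgt_one _ := by funext; exact tgt_one _
  src_vcomp _ _ := by funext; exact src_vcomp _ _
  tgt_vcomp _ _ := by funext; exact tgt_vcomp _ _
  one_vcomp _ := by funext; exact one_vcomp _
  vcomp_one _ := by funext; exact vcomp_one _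
  vcomp_assoc _ _ _ := by funext; exact vcomp_assoc _ _ _
  pid x := fun i => pid (x i)
  pidMap f := fun i => pidMap (f i)
  src_pidMap _ := by funext; exact src_pidMap _
  tgt_pidMap _ := by funext; exact tgt_pidMap _
  pidMap_id _ := by funext; exact pidMap_id _
  pidMap_comp _ _ := by funext; exact pidMap_comp _ _
  pcomp m n := fun i => m i ⊙ n i
  hcomp α β h := fun i => hcomp (α i) (β i) (congrFun h i)
  src_hcomp _ _ _ := by funext; exact src_hcomp _ _ _
  tgt_hcomp _ _ _ := by funext; exact tgt_hcomp _ _ _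
  hcomp_one _ _ := by funext; exact hcomp_one _ _
  vcomp_hcomp _ _ _ _ _ _ := by funext; exact vcomp_hcomp _ _ _ _ _ _
  assoc m n q := fun i => assoc (m i) (n i) (q i)
  assocInv m n q := fun i => assocInv (m i) (n i) (q i)
  src_assoc _ _ _ := by funext; exact src_assoc _ _ _
  tgt_assoc _ _ _ := by funext; exact tgt_assoc _ _ _
  assoc_assocInv _ _ _ := by funext; exact assoc_assocInv _ _ _
  assocInv_assoc _ _ _ := by funext; exact assocInv_assoc _ _ _
  assoc_naturality _ _ _ h h' := by
    funext i; exact assoc_naturality _ _ _ (congrFun h i) (congrFun h' i)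
  leftUnitor m := fun i => leftUnitor (m i)
  leftUnitorInv m := fun i => leftUnitorInv (m i)
  src_leftUnitor _ := by funext; exact src_leftUnitor _
  tgt_leftUnitor _ := by funext; exact tgt_leftUnitor _
  leftUnitor_inv _ := by funext; exact leftUnitor_inv _
  inv_leftUnitor _ := by funext; exact inv_leftUnitor _
  leftUnitor_naturality _ := by funext; exact leftUnitor_naturality _
  rightUnitor m := fun i => rightUnitor (m i)
  rightUnitorInv m := fun i => rightUnitorInv (m i)
  src_rightUnitor _ := by funext; exact src_rightUnitor _
  tgt_rightUnitor _ := by funext; exact tgt_rightUnitor _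
  rightUnitor_inv _ := by funext; exact rightUnitor_inv _
  inv_rightUnitor _ := by funext; exact inv_rightUnitor _
  rightUnitor_naturality _ := by funext; exact rightUnitor_naturality _
  pentagon _ _ _ _ := by funext; exact pentagon _ _ _ _
  triangle _ _ := by funext; exact triangle _ _

variable (D) in
/-- The reindexing double functor `D^f : D^I → D^J` along a function `f : J → I`. -/
def reindex {I J : Type w} (f : J → I) : LaxDoubleFunctor (I → D) (J → D) where
  obj x := fun j => x (f j)
  map g := fun j => g (f j)
  map_id _ := rfl
  map_comp _ _ := rfl
  mapPro m := fun j => m (f j)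
  mapCell α := fun j => α (f j)
  src_mapCell _ := rfl
  tgt_mapCell _ := rfl
  mapCell_one _ := rfl
  mapCell_vcomp _ _ := rfl
  lcomp m n := one _
  src_lcomp _ _ := src_one _
  tgt_lcomp _ _ := tgt_one _
  lunit x := one _
  src_lunit _ := src_one _
  tgt_lunit _ := tgt_one _
  lcomp_naturality _ _ _ := (vcomp_one _).trans (one_vcomp _).symm
  lunit_naturality _ := (vcomp_one _).trans (one_vcomp _).symm
  lcomp_assoc _ _ _ := by
    simp only [hcomp_one, one_vcomp, vcomp_one]
    rfl
  lunit_left _ := by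
    simp only [hcomp_one, one_vcomp]
    rfl
  lunit_right _ := by
    simp only [hcomp_one, one_vcomp]
    rfl

/-- The element of the composite of two identity spans. -/
def IdSpan.double {I : Type w} : ∀ {i j : I}, IdSpan i j → Σ k, IdSpan i k × IdSpan k j
  | _, _, .refl i => ⟨i, .refl i, .refl i⟩

/-- The composition comparison for parallel families. -/
def Fam.Square.parallelComp {κ : IndexKind} {I : Type w} (hI : κ.Mem I) {x y z : I → D}
    (m : ∀ i, Pro (x i) (y i)) (n : ∀ i, Pro (y i) (z i)) :
    Fam.Square (Fam.pcomp (Fam.parallel hI m) (Fam.parallel hI n))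
      (Fam.parallel hI fun i => m i ⊙ n i) where
  src := 𝟙 _
  tgt := 𝟙 _
  idx b := IdSpan.double b
  cell := fun {k l} b => match k, l, b with
    | _, _, .refl i => DoubleCategory.one (m i ⊙ n i)
  src_cell b := by cases b; exact src_one _
  tgt_cell b := by cases b; exact tgt_one _

theorem parallel_lcomp {κ : IndexKind} {I K : Type w} (hI : κ.Mem I) (hK : κ.Mem K)
    {x y z : I → D} {x' y' z' : K → D} {m : ∀ i, Pro (x i) (y i)} {n : ∀ i, Pro (y i) (z i)}
    {m' : ∀ k, Pro (x' k) (y' k)} {n' : ∀ k, Pro (y' k) (z' k)} (f : K → I)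
    (s : ∀ k, x (f k) ⟶ x' k) (t t' : ∀ k, y (f k) ⟶ y' k) (r : ∀ k, z (f k) ⟶ z' k)
    (α : ∀ k, Cell (m (f k)) (m' k)) (β : ∀ k, Cell (n (f k)) (n' k))
    (hs : ∀ k, src (α k) = s k) (ht : ∀ k, tgt (α k) = t k)
    (ht' : ∀ k, src (β k) = t' k) (hr : ∀ k, tgt (β k) = r k) (h : t = t')
    (e : (⟨f, t⟩ : Fam.Hom ⟨I, hI, y⟩ ⟨K, hK, y'⟩) = ⟨f, t'⟩) :
    ((Fam.Square.parallel hI hK f s t α hs ht).hcomp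
        (Fam.Square.parallel hI hK f t' r β ht' hr) e).vcomp
        (Fam.Square.parallelComp hK m' n') =
      (Fam.Square.parallelComp hI m n).vcomp
        (Fam.Square.parallel (m := fun i => m i ⊙ n i) (m' := fun k => m' k ⊙ n' k) hI hK f s r
          (fun k => hcomp (α k) (β k) (by rw [ht, ht', h]))
          (fun k => (src_hcomp _ _ _).trans (hs k)) (fun k => (tgt_hcomp _ _ _).trans (hr k))) := by
  subst h
  apply Fam.Square.ext_sigma
  · funext
    exact (Category.comp_id _).trans (Category.id_comp _).symm
  · funext
    exact (Category.comp_id _).trans (Category.id_comp _).symm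
  · rintro _ _ ⟨⟩
    exact Sigma.ext rfl (heq_of_eq ((vcomp_one _).trans (one_vcomp _).symm))

theorem one_lcomp_assoc {x y z t : D} (m : Pro x y) (n : Pro y z) (q : Pro z t) :
    hcomp (one (m ⊙ n)) (one q) (by simp) ≫ᶜ one _ ≫ᶜ assoc m n q =
      assoc m n q ≫ᶜ hcomp (one m) (one (n ⊙ q)) (by simp) ≫ᶜ one _ := by
  simp

theorem one_lunit_left {x y : D} (m : Pro x y) :
    hcomp (one (pid x)) (one m) (by simp) ≫ᶜ one _ ≫ᶜ leftUnitor m = leftUnitor m := by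
  simp

theorem one_lunit_right {x y : D} (m : Pro x y) :
    hcomp (one m) (one (pid y)) (by simp) ≫ᶜ one _ ≫ᶜ rightUnitor m = rightUnitor m := by
  simp

variable (D) in
/-- The inclusion `D^I → Fam κ D` of parallel families. -/
def parallelFamilies (κ : IndexKind) {I : Type w} (hI : κ.Mem I) :
    LaxDoubleFunctor (I → D) (Fam.{w} κ D) where
  obj x := ⟨I, hI, x⟩
  map f := ⟨fun i => i, f⟩
  map_id _ := rfl
  map_comp _ _ := rfl
  mapPro m := Fam.parallel hI m
  mapCell α := Fam.Square.parallel hI hI (fun i => i) (src α) (tgt α) α (fun _ => rfl)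
    (fun _ => rfl)
  src_mapCell _ := rfl
  tgt_mapCell _ := rfl
  mapCell_one m := by
    apply Fam.Square.ext_sigma
    · funext
      exact src_one _
    · funext
      exact tgt_one _
    · rintro _ _ ⟨⟩
      rfl
  mapCell_vcomp α β := by
    apply Fam.Square.ext_sigma
    · funext
      exact src_vcomp _ _
    · funext
      exact tgt_vcomp _ _
    · rintro _ _ ⟨⟩
      rfl
  lcomp m n := Fam.Square.parallelComp hI m n
  src_lcomp _ _ := rfl
  tgt_lcomp _ _ := rfl
  lunit x := one _
  src_lunit _ := rfl
  tgt_lunit _ := rfl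
  lcomp_naturality α β h := by
    refine (parallel_lcomp hI hI (fun i => i) (src α) (tgt α) (src β) (tgt β) α β
      (fun _ => rfl) (fun _ => rfl) (fun _ => rfl) (fun _ => rfl) h _).trans ?_
    apply Fam.Square.ext_cell
    · funext i
      exact congrArg (𝟙 _ ≫ ·) (src_hcomp _ _ (congrFun h i)).symm
    · funext i
      exact congrArg (𝟙 _ ≫ ·) (tgt_hcomp _ _ (congrFun h i)).symm
    · intros
      rfl
  lunit_naturality f := by
    apply Fam.Square.ext_sigma
    · funext i
      exact (Category.comp_id _).trans ((Category.id_comp _).trans (src_pidMap _)).symm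
    · funext i
      exact (Category.comp_id _).trans ((Category.id_comp _).trans (tgt_pidMap _)).symm
    · rintro _ _ ⟨⟩
      exact Sigma.ext rfl (heq_of_eq ((vcomp_one _).trans (one_vcomp _).symm))
  lcomp_assoc m n q := by
    apply Fam.Square.ext_sigma
    · funext i
      exact congrArg (𝟙 _ ≫ 𝟙 _ ≫ ·) (src_assoc _ _ _)
    · funext i
      exact congrArg (𝟙 _ ≫ 𝟙 _ ≫ ·) (tgt_assoc _ _ _)
    · rintro _ _ ⟨⟩
      exact Sigma.ext rfl (heq_of_eq (one_lcomp_assoc _ _ _))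
  lunit_left m := by
    apply Fam.Square.ext_sigma
    · funext i
      exact (Category.id_comp _).trans ((Category.id_comp _).trans (src_leftUnitor _))
    · funext i
      exact (Category.id_comp _).trans ((Category.id_comp _).trans (tgt_leftUnitor _))
    · rintro _ _ ⟨⟩
      exact Sigma.ext rfl (heq_of_eq (one_lunit_left _))
  lunit_right m := by
    apply Fam.Square.ext_sigma
    · funext i
      exact (Category.id_comp _).trans ((Category.id_comp _).trans (src_rightUnitor _))
    · funext i
      exact (Category.id_comp _).trans ((Category.id_comp _).trans (tgt_rightUnitor _))
    · rintro _ _ ⟨⟩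
      exact Sigma.ext rfl (heq_of_eq (one_lunit_right _))

theorem IndexKind.mem_unit (κ : IndexKind) : κ.Mem PUnit.{w + 1} := κ.mem_of_finite _

/-- The family of proarrows with the single member `m`. -/
def Fam.single (κ : IndexKind) {x y : D} (m : Pro x y) :
    Fam.Proarrow.{w} (κ := κ) ⟨PUnit, κ.mem_unit, fun _ => x⟩ ⟨PUnit, κ.mem_unit, fun _ => y⟩ where
  idx _ _ := PUnit
  mem _ _ := κ.mem_unit
  pro _ := m

/-- The cell between single-member families given by a cell. -/
def Fam.Square.single (κ : IndexKind) {x y x' y' : D} {m : Pro x y} {m' : Pro x' y'}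
    (s : x ⟶ x') (t : y ⟶ y') (α : Cell m m') (hs : DoubleCategory.src α = s)
    (ht : DoubleCategory.tgt α = t) :
    Fam.Square (Fam.single.{w} κ m) (Fam.single.{w} κ m') where
  src := ⟨fun i => i, fun _ => s⟩
  tgt := ⟨fun i => i, fun _ => t⟩
  idx b := b
  cell _ := α
  src_cell _ := hs
  tgt_cell _ := ht

/-- The composition comparison for single-member families. -/
def Fam.Square.singleComp (κ : IndexKind) {x y z : D} (m : Pro x y) (n : Pro y z) :
    Fam.Square (Fam.pcomp (Fam.single.{w} κ m) (Fam.single.{w} κ n)) (Fam.single.{w} κ (m ⊙ n)) where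
  src := 𝟙 _
  tgt := 𝟙 _
  idx _ := ⟨PUnit.unit, PUnit.unit, PUnit.unit⟩
  cell _ := DoubleCategory.one (m ⊙ n)
  src_cell _ := src_one _
  tgt_cell _ := tgt_one _

theorem single_lcomp (κ : IndexKind) {x y z x' y' z' : D} {m : Pro x y} {n : Pro y z}
    {m' : Pro x' y'} {n' : Pro y' z'} (s : x ⟶ x') (t t' : y ⟶ y') (r : z ⟶ z')
    (α : Cell m m') (β : Cell n n') (hs : src α = s) (ht : tgt α = t) (ht' : src β = t')
    (hr : tgt β = r) (h : t = t')
    (e : (Fam.Square.single.{w} κ s t α hs ht).tgt = (Fam.Square.single.{w} κ t' r β ht' hr).src) :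
    ((Fam.Square.single.{w} κ s t α hs ht).hcomp (Fam.Square.single κ t' r β ht' hr) e).vcomp
        (Fam.Square.singleComp κ m' n') =
      (Fam.Square.singleComp κ m n).vcomp
        (Fam.Square.single κ s r (hcomp α β (by rw [ht, ht', h]))
          ((src_hcomp _ _ _).trans hs) ((tgt_hcomp _ _ _).trans hr)) := by
  subst h
  apply Fam.Square.ext_cell
  · funext
    exact (Category.comp_id _).trans (Category.id_comp _).symm
  · funext
    exact (Category.comp_id _).trans (Category.id_comp _).symm
  · intros
    exact (vcomp_one _).trans (one_vcomp _).symm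

variable (D) in
/-- The diagonal double functor `Δ : D → Fam κ D`, sending everything to the family indexed by a
one-element set. -/
def diagonal (κ : IndexKind) : LaxDoubleFunctor D (Fam.{w} κ D) where
  obj x := ⟨PUnit, κ.mem_unit, fun _ => x⟩
  map f := ⟨fun i => i, fun _ => f⟩
  map_id _ := rfl
  map_comp _ _ := rfl
  mapPro m := Fam.single κ m
  mapCell α := Fam.Square.single κ (src α) (tgt α) α rfl rfl
  src_mapCell _ := rfl
  tgt_mapCell _ := rfl
  mapCell_one m := by
    apply Fam.Square.ext_cell
    · funext
      exact src_one _
    · funext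
      exact tgt_one _
    · intros
      rfl
  mapCell_vcomp α β := by
    apply Fam.Square.ext_cell
    · funext
      exact src_vcomp _ _
    · funext
      exact tgt_vcomp _ _
    · intros
      rfl
  lcomp m n := Fam.Square.singleComp κ m n
  src_lcomp _ _ := rfl
  tgt_lcomp _ _ := rfl
  lunit x :=
    { src := 𝟙 _
      tgt := 𝟙 _
      idx := fun _ => IdSpan.refl PUnit.unit
      cell := fun _ => one (pid x)
      src_cell := fun _ => src_one _
      tgt_cell := fun _ => tgt_one _ }
  src_lunit _ := rfl
  tgt_lunit _ := rfl
  lcomp_naturality α β h := by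
    refine (single_lcomp κ (src α) (tgt α) (src β) (tgt β) α β rfl rfl rfl rfl h _).trans ?_
    apply Fam.Square.ext_cell
    · funext i
      exact congrArg (𝟙 _ ≫ ·) (src_hcomp _ _ h).symm
    · funext i
      exact congrArg (𝟙 _ ≫ ·) (tgt_hcomp _ _ h).symm
    · intros
      rfl
  lunit_naturality f := by
    apply Fam.Square.ext_cell
    · funext i
      exact (Category.comp_id _).trans ((Category.id_comp _).trans (src_pidMap _)).symm
    · funext i
      exact (Category.comp_id _).trans ((Category.id_comp _).trans (tgt_pidMap _)).symm
    · intros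
      exact (vcomp_one _).trans (one_vcomp _).symm
  lcomp_assoc m n q := by
    apply Fam.Square.ext_cell
    · funext i
      exact congrArg (𝟙 _ ≫ 𝟙 _ ≫ ·) (src_assoc _ _ _)
    · funext i
      exact congrArg (𝟙 _ ≫ 𝟙 _ ≫ ·) (tgt_assoc _ _ _)
    · intros
      exact one_lcomp_assoc _ _ _
  lunit_left m := by
    apply Fam.Square.ext_cell
    · funext i
      exact (Category.id_comp _).trans ((Category.id_comp _).trans (src_leftUnitor _))
    · funext i
      exact (Category.id_comp _).trans ((Category.id_comp _).trans (tgt_leftUnitor _))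
    · intros
      exact one_lunit_left _
  lunit_right m := by
    apply Fam.Square.ext_cell
    · funext i
      exact (Category.id_comp _).trans ((Category.id_comp _).trans (src_rightUnitor _))
    · funext i
      exact (Category.id_comp _).trans ((Category.id_comp _).trans (tgt_rightUnitor _))
    · intros
      exact one_lunit_right _

variable (D) in
/-- A choice of lax products in `D`, indexed by sets of the kind `κ`: a right adjoint to the
diagonal, in the 2-category of double categories, lax double functors and natural
transformations. -/
structure LaxProducts (κ : IndexKind) where
  prod : LaxDoubleFunctor (Fam.{w} κ D) D
  adj : DoubleAdjunction (diagonal.{w} D κ) prod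

theorem id_src_one {x y : D} (m : Pro x y) : 𝟙 x ≫ 𝟙 x = 𝟙 x ≫ 𝟙 x ≫ src (one m) := by simp

theorem id_tgt_one {x y : D} (m : Pro x y) : 𝟙 y ≫ 𝟙 y = 𝟙 y ≫ 𝟙 y ≫ tgt (one m) := by simp

theorem one_hcomp_one {x y z : D} (m : Pro x y) (n : Pro y z) :
    one (m ⊙ n) ≫ᶜ one _ = hcomp (one m) (one n) (by simp) ≫ᶜ one _ ≫ᶜ one _ := by simp

theorem one_pidMap_one (x : D) :
    one (pid x) ≫ᶜ one _ = pidMap (𝟙 x) ≫ᶜ one _ ≫ᶜ one _ := by simp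

variable (D) in
/-- Reindexing of parallel families along `f : J → I`, as a natural transformation whose
components are the arrows `(I, x) ⟶ (J, x ∘ f)` of families given by `f` and identities. -/
def reindexTrans (κ : IndexKind) {I J : Type w} (hI : κ.Mem I) (hJ : κ.Mem J) (f : J → I) :
    DoubleNatTrans (parallelFamilies D κ hI) ((reindex D f).comp (parallelFamilies D κ hJ)) where
  app x := ⟨f, fun j => 𝟙 (x (f j))⟩
  cell m := Fam.Square.parallel hI hJ f (fun _ => 𝟙 _) (fun _ => 𝟙 _) (fun j => one (m (f j)))
    (fun _ => src_one _) (fun _ => tgt_one _)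
  src_cell _ := rfl
  tgt_cell _ := rfl
  naturality _ := Fam.Hom.ext rfl (heq_of_eq (by
    funext
    exact (Category.comp_id _).trans (Category.id_comp _).symm))
  cell_naturality α := by
    apply Fam.Square.ext_sigma
    · funext
      exact (Category.comp_id _).trans (Category.id_comp _).symm
    · funext
      exact (Category.comp_id _).trans (Category.id_comp _).symm
    · rintro _ _ ⟨⟩
      exact Sigma.ext rfl (heq_of_eq ((vcomp_one _).trans (one_vcomp _).symm))
  cell_lcomp m n := by
    apply Fam.Square.ext_sigma
    · funext
      exact id_src_one _
    · funext
      exact id_tgt_one _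
    · rintro _ _ ⟨⟩
      exact Sigma.ext rfl (heq_of_eq (one_hcomp_one _ _))
  cell_lunit x := by
    apply Fam.Square.ext_sigma
    · funext
      exact id_src_one _
    · funext
      exact id_tgt_one _
    · rintro _ _ ⟨⟩
      exact Sigma.ext rfl (heq_of_eq (one_pidMap_one _))

namespace DoubleNatTrans

variable {E : Type u₁} [Category.{v₁} E] [DoubleCategory.{c₁, p₁} E]
  {C : Type u₂} [Category.{v₂} C] [DoubleCategory.{c₂, p₂} C]

/-- Applying a lax double functor to a natural transformation. -/
def whiskerRight {F G : LaxDoubleFunctor C D} (α : DoubleNatTrans F G)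
    (H : LaxDoubleFunctor D E) : DoubleNatTrans (F.comp H) (G.comp H) where
  app x := H.map (α.app x)
  cell m := H.mapCell (α.cell m)
  src_cell m := (H.src_mapCell _).trans (congrArg H.map (α.src_cell m))
  tgt_cell m := (H.tgt_mapCell _).trans (congrArg H.map (α.tgt_cell m))
  naturality f := (H.map_comp _ _).symm.trans
    ((congrArg H.map (α.naturality f)).trans (H.map_comp _ _))
  cell_naturality γ := (H.mapCell_vcomp _ _).symm.trans
    ((congrArg H.mapCell (α.cell_naturality γ)).trans (H.mapCell_vcomp _ _))
  cell_lcomp m n := by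
    have := congrArg H.mapCell (α.cell_lcomp m n)
    simp only [LaxDoubleFunctor.mapCell_vcomp] at this
    simp only [LaxDoubleFunctor.comp, vcomp_assoc]
    rw [this, ← vcomp_assoc, ← H.lcomp_naturality, vcomp_assoc]
  cell_lunit x := by
    have := congrArg H.mapCell (α.cell_lunit x)
    simp only [LaxDoubleFunctor.mapCell_vcomp] at this
    simp only [LaxDoubleFunctor.comp, vcomp_assoc]
    rw [this, ← vcomp_assoc, ← H.lunit_naturality, vcomp_assoc]

end DoubleNatTrans

namespace LaxProducts

variable {κ : IndexKind} (P : LaxProducts.{w} D κ)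

/-- Lax products are normal if the product double functor is. -/
def IsNormal : Prop := P.prod.IsNormal

variable {I J : Type w} (hI : κ.Mem I) (hJ : κ.Mem J)

/-- The parallel product double functor `Π : D^I → D`. -/
def pi : LaxDoubleFunctor (I → D) D := (parallelFamilies D κ hI).comp P.prod

/-- The projection `π_i : Π x ⟶ x_i`. -/
def proj (x : I → D) (i : I) : (P.pi hI).obj x ⟶ x i :=
  (P.adj.counit.app ⟨I, hI, x⟩).arr i

/-- The projection cell `π_i : Π m → m_i`. -/
def projCell {x y : I → D} (m : Pro x y) (i : I) : Cell ((P.pi hI).mapPro m) (m i) :=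
  (P.adj.counit.cell (Fam.parallel hI m)).cell (IdSpan.refl i)

/-- The structure arrows and cells `Π(f)` between products, for a function `f : J → I`, as a natural
transformation from `Π` to `Π ∘ D^f`. -/
def structureTrans (f : J → I) :
    DoubleNatTrans (P.pi hI) ((reindex D f).comp (P.pi hJ)) where
  app x := ((reindexTrans D κ hI hJ f).whiskerRight P.prod).app x
  cell m := ((reindexTrans D κ hI hJ f).whiskerRight P.prod).cell m
  src_cell m := ((reindexTrans D κ hI hJ f).whiskerRight P.prod).src_cell m
  tgt_cell m := ((reindexTrans D κ hI hJ f).whiskerRight P.prod).tgt_cell m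
  naturality f' := ((reindexTrans D κ hI hJ f).whiskerRight P.prod).naturality f'
  cell_naturality α := ((reindexTrans D κ hI hJ f).whiskerRight P.prod).cell_naturality α
  cell_lcomp m n := by
    have := ((reindexTrans D κ hI hJ f).whiskerRight P.prod).cell_lcomp m n
    simpa [LaxDoubleFunctor.comp, pi] using this
  cell_lunit x := by
    have := ((reindexTrans D κ hI hJ f).whiskerRight P.prod).cell_lunit x
    simpa [LaxDoubleFunctor.comp, pi] using this

end LaxProducts

end Products

/-! ## Calculus of cells -/

/-! The structure arrow at a family is the image under the product functor of the reindexing arrow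
of families, which consists of the function `f₀` and identities; structure cells arise in the same
way. Transposing along the adjunction between the diagonal and the product turns an arrow or cell
into a parallel product into a family of arrows or cells, because a map of index sets into a
one-element set carries no information. This gives uniqueness (`LaxProducts.hom_ext`,
`LaxProducts.cell_ext`). Naturality of the counit at the reindexing arrow gives the equations with
the projections.

Reindexing arrows have companions and conjoints in families over any double category: external
identities spread over the graph of `f₀`, read in one direction or the other
(`Fam.reindexCompanion`, `Fam.reindexConjoint`). A normal lax double functor preserves companions
and conjoints, since the inverse of its identity comparison completes the image of the counit
(`LaxDoubleFunctor.nonempty_companion`, `LaxDoubleFunctor.nonempty_conjoint`). Hence the structure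
arrows have both.

The protransformation axioms have nothing to do with products: they hold for every natural
transformation with chosen companions or conjoints of its components. A cell into `f_! ⊙ n` is
determined by its left side and its composite with the counit of `f_!` (`Companion.hom_ext_hcomp`).
Under this test a reshaped cell becomes the original cell beside a counit, up to unitors
(`slideCompanion_counit`), so each axiom reduces to the corresponding axiom of the natural
transformation. Conjoints are handled by the mirror image.

If `f₀` is a bijection, projections along the inverse function invert the structure arrows and
cells. Units and counits of companions and conjoints of isomorphisms are invertible, hence so are
the reshaped cells. For any arrow the companion is left adjoint to the conjoint, and for an
isomorphism this is an adjoint equivalence. These componentwise adjunctions assemble into globular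
modifications (`DoubleNatTrans.unit_nat`, `DoubleNatTrans.counit_nat`), and the triangle identities
are checked componentwise. -/

namespace DoubleCategory

variable {D : Type u} [Category.{v} D] [DoubleCategory.{c, p} D]

/-! ### Coherence imported from the bicategory of globular cells. -/

section Coherence

open Bicategory

variable {x y z t : D}

/-- An equation between globular coherence cells is an equation of 2-cells in `UBicat D`, so a
bicategorical identity proves it, and `congrArg Globular.cell` extracts the underlying cells. -/
theorem leftUnitor_pid (x : D) : leftUnitor (pid x) = rightUnitor (pid x) :=
  congrArg Globular.cell (unitors_equal (B := UBicat D) (a := x))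

theorem leftUnitorInv_pid (x : D) : leftUnitorInv (pid x) = rightUnitorInv (pid x) :=
  congrArg Globular.cell (unitors_inv_equal (B := UBicat D) (a := x))

theorem leftUnitorInv_hcomp_one (m : Pro x y) (n : Pro y z) :
    hcomp (leftUnitorInv m) (one n) (by simp) ≫ᶜ assoc (pid x) m n = leftUnitorInv (m ⊙ n) :=
  congrArg Globular.cell (leftUnitor_comp_inv (B := UBicat D) (a := x) (b := y) (c := z) m n).symm

end Coherence

/-- Unitor naturality with the side `f` a free variable, tied to `α` only through the composability
proof. It therefore rewrites also where the side of `α` equals `f` without being syntactically the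
same. The next three lemmas serve the same purpose. -/
theorem pidMap_hcomp_leftUnitor {x y x' y' : D} {m : Pro x y} {m' : Pro x' y'} {f : x ⟶ x'}
    (α : Cell m m') (h : tgt (pidMap f) = src α) :
    hcomp (pidMap f) α h ≫ᶜ leftUnitor m' = leftUnitor m ≫ᶜ α := by
  obtain rfl : f = src α := by simpa using h
  exact leftUnitor_naturality α

theorem hcomp_pidMap_rightUnitor {x y x' y' : D} {m : Pro x y} {m' : Pro x' y'} {f : y ⟶ y'}
    (α : Cell m m') (h : tgt α = src (pidMap f)) :
    hcomp α (pidMap f) h ≫ᶜ rightUnitor m' = rightUnitor m ≫ᶜ α := by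
  obtain rfl : tgt α = f := by simpa using h
  exact rightUnitor_naturality α

theorem leftUnitorInv_pidMap_hcomp {x y x' y' : D} {m : Pro x y} {m' : Pro x' y'} {f : x ⟶ x'}
    (α : Cell m m') (h : tgt (pidMap f) = src α) :
    leftUnitorInv m ≫ᶜ hcomp (pidMap f) α h = α ≫ᶜ leftUnitorInv m' := by
  obtain rfl : f = src α := by simpa using h
  exact (leftUnitorInv_naturality α).symm

theorem rightUnitorInv_hcomp_pidMap {x y x' y' : D} {m : Pro x y} {m' : Pro x' y'} {f : y ⟶ y'}
    (α : Cell m m') (h : tgt α = src (pidMap f)) :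
    rightUnitorInv m ≫ᶜ hcomp α (pidMap f) h = α ≫ᶜ rightUnitorInv m' := by
  obtain rfl : tgt α = f := by simpa using h
  exact (rightUnitorInv_naturality α).symm

/-! ### Invertible cells -/

theorem IsInvertible.leftUnitor {x y : D} (m : Pro x y) : IsInvertible (leftUnitor m) :=
  ⟨_, leftUnitor_inv m, inv_leftUnitor m⟩

theorem IsInvertible.leftUnitorInv {x y : D} (m : Pro x y) : IsInvertible (leftUnitorInv m) :=
  ⟨_, inv_leftUnitor m, leftUnitor_inv m⟩

theorem IsInvertible.rightUnitor {x y : D} (m : Pro x y) : IsInvertible (rightUnitor m) :=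
  ⟨_, rightUnitor_inv m, inv_rightUnitor m⟩

theorem IsInvertible.rightUnitorInv {x y : D} (m : Pro x y) : IsInvertible (rightUnitorInv m) :=
  ⟨_, inv_rightUnitor m, rightUnitor_inv m⟩

theorem IsInvertible.one {x y : D} (m : Pro x y) : IsInvertible (one m) :=
  ⟨_, one_vcomp _, one_vcomp _⟩

theorem IsInvertible.hcomp {x y z x' y' z' : D} {m : Pro x y} {n : Pro y z} {m' : Pro x' y'}
    {n' : Pro y' z'} {α : Cell m m'} {β : Cell n n'} (hα : IsInvertible α) (hβ : IsInvertible β)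
    (h : tgt α = src β) : IsInvertible (hcomp α β h) := by
  obtain ⟨α', h₁, h₂⟩ := hα
  obtain ⟨β', h₃, h₄⟩ := hβ
  -- The inverses are externally composable because the arrow `tgt α = src β` has `tgt α'` as
  -- inverse on one side and `src β'` on the other, so these two agree.
  have h' : tgt α' = src β' := by
    have e₁ := congrArg tgt h₂
    have e₂ := congrArg src h₃
    simp only [src_vcomp, tgt_vcomp, src_one, tgt_one] at e₁ e₂
    rw [h] at e₁
    exact (Category.comp_id _).symm.trans ((congrArg (tgt α' ≫ ·) e₂.symm).trans
      ((Category.assoc _ _ _).symm.trans ((congrArg (· ≫ src β') e₁).trans (Category.id_comp _))))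
  refine ⟨DoubleCategory.hcomp α' β' h', ?_, ?_⟩
  · rw [vcomp_hcomp, ← hcomp_one]
    exact hcomp_congr _ h₁ h₃
  · rw [vcomp_hcomp, ← hcomp_one]
    exact hcomp_congr _ h₂ h₄

theorem IsInvertible.pidMap {x y : D} (f : x ⟶ y) [IsIso f] : IsInvertible (pidMap f) :=
  ⟨DoubleCategory.pidMap (inv f), by rw [← pidMap_comp, IsIso.hom_inv_id, pidMap_id],
    by rw [← pidMap_comp, IsIso.inv_hom_id, pidMap_id]⟩

/-! ### Companions -/

section Companion

variable {x y w z : D} {f : x ⟶ w}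

/-- The external companion identity rebuilds a cell from these data: insert the unit on the left and
the counit below the cell. With the counit test, equations between cells into a companion no longer
involve the companion itself. -/
theorem Companion.hom_ext (F : Companion f) {s t : D} {r : Pro s t} {β β' : Cell r F.pro}
    (hs : src β = src β') (e : β ≫ᶜ F.counit = β' ≫ᶜ F.counit) : β = β' := by
  -- By interchange and naturality of the left unitor, `γ` can be pulled out in front of the
  -- external companion identity, which is then the identity of `F.pro`.
  have key : ∀ γ : Cell r F.pro, γ = leftUnitorInv r ≫ᶜ
      hcomp (pidMap (src γ) ≫ᶜ F.unit) (γ ≫ᶜ F.counit) (by simp) ≫ᶜ rightUnitor F.pro := by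
    intro γ
    rw [← vcomp_hcomp _ _ (by simp) _ _ (by simp), vcomp_assoc, ← vcomp_assoc (leftUnitorInv r),
      leftUnitorInv_pidMap_hcomp, vcomp_assoc, F.hcomp_eq, vcomp_one]
  rw [key β, key β']
  exact congrArg (leftUnitorInv r ≫ᶜ · ≫ᶜ _) (hcomp_congr _ (by rw [hs]) e)

/-- The version of `Companion.hom_ext` with a further proarrow on the right. It is the tool for
checking every equation between comparison cells of an oplax protransformation. -/
theorem Companion.hom_ext_hcomp (F : Companion f) {n : Pro w z} {s t : D} {r : Pro s t}
    {β β' : Cell r (F.pro ⊙ n)} (hs : src β = src β')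
    (e : β ≫ᶜ hcomp F.counit (one n) (by simp) = β' ≫ᶜ hcomp F.counit (one n) (by simp)) :
    β = β' := by
  -- The external companion identity whiskered by `n`; the associators only rebracket the unit next
  -- to the counit.
  have h₁ : leftUnitorInv (F.pro ⊙ n) ≫ᶜ
      hcomp F.unit (hcomp F.counit (one n) (by simp)) (by simp) ≫ᶜ
      assocInv F.pro (pid w) n ≫ᶜ hcomp (rightUnitor F.pro) (one n) (by simp) = one _ := by
    rw [← leftUnitorInv_hcomp_one, vcomp_assoc, ← vcomp_reassoc
      (assoc_naturality F.unit F.counit (one n) (by simp) (by simp)), assoc_assocInv_assoc,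
      vcomp_hcomp, vcomp_hcomp, ← hcomp_one]
    exact hcomp_congr _ F.hcomp_eq (by simp)
  have key : ∀ γ : Cell r (F.pro ⊙ n), γ = leftUnitorInv r ≫ᶜ
      hcomp (pidMap (src γ) ≫ᶜ F.unit) (γ ≫ᶜ hcomp F.counit (one n) (by simp)) (by simp) ≫ᶜ
      assocInv F.pro (pid w) n ≫ᶜ hcomp (rightUnitor F.pro) (one n) (by simp) := by
    intro γ
    rw [← vcomp_hcomp _ _ (by simp) _ _ (by simp), vcomp_assoc, ← vcomp_assoc (leftUnitorInv r),
      leftUnitorInv_pidMap_hcomp, vcomp_assoc, h₁, vcomp_one]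
  rw [key β, key β']
  exact congrArg (leftUnitorInv r ≫ᶜ · ≫ᶜ _) (hcomp_congr _ (by rw [hs]) e)

/-- The counit of `f_!` meets the unit hidden in the reshaped cell and forms `id_f`, which the left
unitor absorbs. By `Companion.hom_ext_hcomp` this equation, together with the trivial left side,
characterises the reshaped cell. -/
theorem slideCompanion_counit {m : Pro x y} {n : Pro w z} {g : y ⟶ z} (α : Cell m n)
    (hf : src α = f) (hg : tgt α = g) (F : Companion f) (G : Companion g) :
    slideCompanion α hf hg F G ≫ᶜ hcomp F.counit (one n) (by simp) =
      hcomp α G.counit (by simp [hg]) ≫ᶜ rightUnitor n ≫ᶜ leftUnitorInv n := by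
  -- These push the right unitor to the end of both sides, so that everything before it is an
  -- external composite and interchange applies.
  have e₁ := hcomp_pidMap_rightUnitor (f := 𝟙 z) (hcomp F.counit (one n) (by simp)) (by simp)
  have e₂ := hcomp_pidMap_rightUnitor (f := 𝟙 z) (leftUnitorInv n) (by simp)
  rw [slideCompanion, vcomp_assoc, vcomp_assoc, ← e₁, ← e₂,
    vcomp_hcomp_assoc (h := by simp) (h' := by simp [hg]),
    vcomp_hcomp_assoc (h := by simp [hg]) (h' := by simp),
    vcomp_hcomp_assoc (h := by simp [hg]) (h' := by simp)]
  refine congrArg (· ≫ᶜ _) (hcomp_congr _ ?_ (by simp))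
  rw [vcomp_assoc, vcomp_hcomp, hcomp_congr (α' := pidMap f) (β' := α) _ F.vcomp_eq (vcomp_one _),
    leftUnitorInv_pidMap_hcomp]

/-- Here the unit of `g_!` is placed in front and meets the counit inside the reshaped cell; the
resulting `id_g` disappears into the right unitor. This form is what the unit of the
companion-conjoint adjunction requires. -/
theorem one_hcomp_unit_slideCompanion {m : Pro x y} {n : Pro w z} {g : y ⟶ z} (α : Cell m n)
    (hf : src α = f) (hg : tgt α = g) (F : Companion f) (G : Companion g) :
    hcomp (one m) G.unit (by simp) ≫ᶜ slideCompanion α hf hg F G =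
      rightUnitor m ≫ᶜ leftUnitorInv m ≫ᶜ hcomp F.unit α (by simp [hf]) := by
  rw [slideCompanion, vcomp_hcomp_assoc (h := by simp) (h' := by simp),
    vcomp_hcomp_assoc (h := by simp) (h' := by simp [hg]),
    ← hcomp_pidMap_rightUnitor (f := g) _ (by simp [hg])]
  exact congrArg (· ≫ᶜ _) (hcomp_congr _ (by simp) (by simp [G.vcomp_eq]))

/-- Adding the counit turns `K.unit` into an external identity, leaving only `H.counit`. With the
left side `f`, this determines the sliding cell by `Companion.hom_ext`. -/
theorem slideSquareCompanion_counit {k : y ⟶ z} {h : x ⟶ y} {h' : w ⟶ z} (e : f ≫ h' = h ≫ k)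
    (H : Companion h) (K : Companion h') :
    slideSquareCompanion e H K ≫ᶜ K.counit = H.counit ≫ᶜ pidMap k := by
  rw [slideSquareCompanion, vcomp_assoc, vcomp_assoc,
    ← hcomp_pidMap_rightUnitor (f := 𝟙 z) K.counit (by simp),
    vcomp_hcomp_assoc (h := by simpa using e) (h' := by simp), ← leftUnitor_pid]
  -- Since the two unitors of an external identity agree, the remaining right unitor is now a left
  -- one and can absorb the identity cell standing on the left.
  rw [hcomp_congr (α' := pidMap (f ≫ h')) (β' := H.counit ≫ᶜ pidMap k) _
    (by rw [vcomp_assoc, K.vcomp_eq, pidMap_comp]) (by simp), pidMap_hcomp_leftUnitor,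
    inv_leftUnitor_assoc]

/-- Tested on the counit of `K`, both sides become the external identity on the common composite of
the square. -/
theorem unit_slideSquareCompanion {k : y ⟶ z} {h : x ⟶ y} {h' : w ⟶ z} (e : f ≫ h' = h ≫ k)
    (H : Companion h) (K : Companion h') :
    H.unit ≫ᶜ slideSquareCompanion e H K = pidMap f ≫ᶜ K.unit := by
  apply K.hom_ext
  · simp [slideSquareCompanion]
  · rw [vcomp_assoc, slideSquareCompanion_counit, ← vcomp_assoc, H.vcomp_eq, vcomp_assoc,
      K.vcomp_eq, ← pidMap_comp, ← pidMap_comp, e]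

/-- The inverse is the counit followed by the external identity on `inv f`. One composite is the
internal companion identity, and the other reduces to the same identity after testing on the counit.
-/
theorem Companion.isInvertible_unit (F : Companion f) [IsIso f] : IsInvertible F.unit := by
  refine ⟨F.counit ≫ᶜ pidMap (inv f), ?_, F.hom_ext (by simp) ?_⟩
  · rw [← vcomp_assoc, F.vcomp_eq, ← pidMap_comp, IsIso.hom_inv_id, pidMap_id]
  · rw [vcomp_assoc, vcomp_assoc, F.vcomp_eq, ← pidMap_comp, IsIso.inv_hom_id, pidMap_id,
      vcomp_one, one_vcomp]

/-- The internal companion identity writes the counit as the inverse of the unit followed by `id_f`.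
-/
theorem Companion.isInvertible_counit (F : Companion f) [IsIso f] : IsInvertible F.counit := by
  obtain ⟨γ, h₁, h₂⟩ := F.isInvertible_unit
  have : F.counit = γ ≫ᶜ pidMap f := by
    rw [← F.vcomp_eq, ← vcomp_assoc, h₂, one_vcomp]
  rw [this]
  exact IsInvertible.vcomp ⟨_, h₂, h₁⟩ (.pidMap f)

theorem isInvertible_slideCompanion {m : Pro x y} {n : Pro w z} {g : y ⟶ z} {α : Cell m n}
    (hα : IsInvertible α) (hf : src α = f) (hg : tgt α = g) (F : Companion f) (G : Companion g)
    [IsIso f] [IsIso g] : IsInvertible (slideCompanion α hf hg F G) :=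
  IsInvertible.vcomp (.hcomp (.leftUnitorInv _) (.one _) _)
    (IsInvertible.vcomp (.hcomp (.hcomp F.isInvertible_unit hα _) G.isInvertible_counit _) (.rightUnitor _))

end Companion

end DoubleCategory

namespace DoubleCategory

variable {D : Type u} [Category.{v} D] [DoubleCategory.{c, p} D]

/-! ### Conjoints -/

section Conjoint

theorem one_hcomp_rightUnitorInv {x y z : D} (m : Pro x y) (n : Pro y z) :
    hcomp (one m) (rightUnitorInv n) (by simp) ≫ᶜ assocInv m n (pid z) = rightUnitorInv (m ⊙ n) :=
  congrArg Globular.cell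
    (Bicategory.rightUnitor_comp_inv (B := UBicat D) (a := x) (b := y) (c := z) m n).symm

variable {x y w z : D} {f : x ⟶ w}

/-- Mirror image of `Companion.hom_ext`. The counit of a conjoint has `f` on its right, so
reconstruction inserts the unit on the right, and it is the target that must be prescribed. -/
theorem Conjoint.hom_ext (F : Conjoint f) {s t : D} {r : Pro s t} {β β' : Cell r F.pro}
    (ht : tgt β = tgt β') (e : β ≫ᶜ F.counit = β' ≫ᶜ F.counit) : β = β' := by
  have key : ∀ γ : Cell r F.pro, γ = rightUnitorInv r ≫ᶜ
      hcomp (γ ≫ᶜ F.counit) (pidMap (tgt γ) ≫ᶜ F.unit) (by simp) ≫ᶜ leftUnitor F.pro := by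
    intro γ
    rw [← vcomp_hcomp _ _ (by simp) _ _ (by simp), vcomp_assoc, ← vcomp_assoc (rightUnitorInv r),
      rightUnitorInv_hcomp_pidMap, vcomp_assoc, F.hcomp_eq, vcomp_one]
  rw [key β, key β']
  exact congrArg (rightUnitorInv r ≫ᶜ · ≫ᶜ _) (hcomp_congr _ e (by rw [ht]))

/-- The conjoint is now the right-hand factor of the codomain, as it is in the comparison cells of a
lax protransformation. -/
theorem Conjoint.hom_ext_hcomp (F : Conjoint f) {n : Pro z w} {s t : D} {r : Pro s t}
    {β β' : Cell r (n ⊙ F.pro)} (ht : tgt β = tgt β')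
    (e : β ≫ᶜ hcomp (one n) F.counit (by simp) = β' ≫ᶜ hcomp (one n) F.counit (by simp)) :
    β = β' := by
  have h₁ : rightUnitorInv (n ⊙ F.pro) ≫ᶜ
      hcomp (hcomp (one n) F.counit (by simp)) F.unit (by simp) ≫ᶜ
      assoc n (pid w) F.pro ≫ᶜ hcomp (one n) (leftUnitor F.pro) (by simp) = one _ := by
    rw [← one_hcomp_rightUnitorInv, vcomp_assoc, ← vcomp_reassoc
      (assocInv_naturality (one n) F.counit F.unit (by simp) (by simp)), assocInv_assoc_assoc,
      vcomp_hcomp, vcomp_hcomp, ← hcomp_one]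
    exact hcomp_congr _ (by simp) F.hcomp_eq
  have key : ∀ γ : Cell r (n ⊙ F.pro), γ = rightUnitorInv r ≫ᶜ
      hcomp (γ ≫ᶜ hcomp (one n) F.counit (by simp)) (pidMap (tgt γ) ≫ᶜ F.unit) (by simp) ≫ᶜ
      assoc n (pid w) F.pro ≫ᶜ hcomp (one n) (leftUnitor F.pro) (by simp) := by
    intro γ
    rw [← vcomp_hcomp _ _ (by simp) _ _ (by simp), vcomp_assoc, ← vcomp_assoc (rightUnitorInv r),
      rightUnitorInv_hcomp_pidMap, vcomp_assoc, h₁, vcomp_one]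
  rw [key β, key β']
  exact congrArg (rightUnitorInv r ≫ᶜ · ≫ᶜ _) (hcomp_congr _ e (by rw [ht]))

/-- The unit of `g^*` inside the reshaped cell meets the counit placed after it and forms `id_g`,
which the right unitor absorbs. -/
theorem slideConjoint_counit {m : Pro x y} {n : Pro w z} {g : y ⟶ z} (α : Cell m n)
    (hf : src α = f) (hg : tgt α = g) (F : Conjoint f) (G : Conjoint g) :
    slideConjoint α hf hg F G ≫ᶜ hcomp (one n) G.counit (by simp) =
      hcomp F.counit α (by simp [hf]) ≫ᶜ leftUnitor n ≫ᶜ rightUnitorInv n := by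
  rw [slideConjoint, vcomp_assoc, vcomp_assoc, vcomp_hcomp (h := by simp) (h' := by simp),
    vcomp_hcomp (h := by simp [hg]) (h' := by simp), ← vcomp_assoc _ (leftUnitor n) (rightUnitorInv n),
    ← rightUnitorInv_hcomp_pidMap (f := g) _ (by simp [hg])]
  exact congrArg (_ ≫ᶜ ·) (hcomp_congr _ (by simp) (by simp [G.vcomp_eq]))

/-- The unit of `f^*` placed in front meets the counit inside the reshaped cell. As for companions,
this form is needed for the unit of the adjunction. -/
theorem unit_hcomp_one_slideConjoint {m : Pro x y} {n : Pro w z} {g : y ⟶ z} (α : Cell m n)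
    (hf : src α = f) (hg : tgt α = g) (F : Conjoint f) (G : Conjoint g) :
    hcomp F.unit (one m) (by simp) ≫ᶜ slideConjoint α hf hg F G =
      leftUnitor m ≫ᶜ rightUnitorInv m ≫ᶜ hcomp α G.unit (by simp [hg]) := by
  have e₁ := rightUnitorInv_hcomp_pidMap (f := 𝟙 y) (hcomp F.unit (one m) (by simp)) (by simp)
  have e₂ := rightUnitorInv_hcomp_pidMap (f := 𝟙 y) (leftUnitor m) (by simp)
  rw [slideConjoint, ← vcomp_assoc, ← e₁, ← vcomp_assoc (leftUnitor m), ← e₂, vcomp_assoc,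
    vcomp_assoc, vcomp_hcomp (h := by simp [hg]) (h' := by simp),
    vcomp_hcomp (h := by simp) (h' := by simp [hg]),
    vcomp_hcomp (h := by simp) (h' := by simp [hg])]
  refine congrArg (_ ≫ᶜ ·) (hcomp_congr _ ?_ (by simp))
  rw [← vcomp_assoc, vcomp_hcomp, hcomp_congr (α' := pidMap f) (β' := α) _ F.vcomp_eq (one_vcomp _),
    pidMap_hcomp_leftUnitor]

theorem slideSquareConjoint_counit {k : y ⟶ z} {h : x ⟶ y} {h' : w ⟶ z} (e : f ≫ h' = h ≫ k)
    (H : Conjoint h) (K : Conjoint h') :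
    slideSquareConjoint e H K ≫ᶜ K.counit = H.counit ≫ᶜ pidMap k := by
  rw [slideSquareConjoint, vcomp_assoc, vcomp_assoc,
    ← pidMap_hcomp_leftUnitor (f := 𝟙 z) K.counit (by simp),
    vcomp_hcomp_assoc (h := by simpa using e.symm) (h' := by simp), leftUnitor_pid]
  rw [hcomp_congr (β' := pidMap (f ≫ h')) (α' := H.counit ≫ᶜ pidMap k) _ (by simp)
    (by rw [vcomp_assoc, K.vcomp_eq, pidMap_comp]), hcomp_pidMap_rightUnitor,
    inv_rightUnitor_assoc]

theorem unit_slideSquareConjoint {k : y ⟶ z} {h : x ⟶ y} {h' : w ⟶ z} (e : f ≫ h' = h ≫ k)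
    (H : Conjoint h) (K : Conjoint h') :
    H.unit ≫ᶜ slideSquareConjoint e H K = pidMap f ≫ᶜ K.unit := by
  apply K.hom_ext
  · simp [slideSquareConjoint]
  · rw [vcomp_assoc, slideSquareConjoint_counit, ← vcomp_assoc, H.vcomp_eq, vcomp_assoc,
      K.vcomp_eq, ← pidMap_comp, ← pidMap_comp, e]

/-- As for companions, the inverse of the unit is the counit followed by the external identity on
`inv f`. -/
theorem Conjoint.isInvertible_unit (F : Conjoint f) [IsIso f] : IsInvertible F.unit := by
  refine ⟨F.counit ≫ᶜ pidMap (inv f), ?_, F.hom_ext (by simp) ?_⟩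
  · rw [← vcomp_assoc, F.vcomp_eq, ← pidMap_comp, IsIso.hom_inv_id, pidMap_id]
  · rw [vcomp_assoc, vcomp_assoc, F.vcomp_eq, ← pidMap_comp, IsIso.inv_hom_id, pidMap_id,
      vcomp_one, one_vcomp]

theorem Conjoint.isInvertible_counit (F : Conjoint f) [IsIso f] : IsInvertible F.counit := by
  obtain ⟨γ, h₁, h₂⟩ := F.isInvertible_unit
  have : F.counit = γ ≫ᶜ pidMap f := by
    rw [← F.vcomp_eq, ← vcomp_assoc, h₂, one_vcomp]
  rw [this]
  exact IsInvertible.vcomp ⟨_, h₂, h₁⟩ (.pidMap f)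

theorem isInvertible_slideConjoint {m : Pro x y} {n : Pro w z} {g : y ⟶ z} {α : Cell m n}
    (hα : IsInvertible α) (hf : src α = f) (hg : tgt α = g) (F : Conjoint f) (G : Conjoint g)
    [IsIso f] [IsIso g] : IsInvertible (slideConjoint α hf hg F G) :=
  IsInvertible.vcomp (.rightUnitorInv _)
    (IsInvertible.vcomp (.hcomp (.hcomp F.isInvertible_counit hα _) G.isInvertible_unit _)
      (.hcomp (.leftUnitor _) (.one _) _))

end Conjoint

/-! ### The adjunction between a companion and a conjoint -/

section Adjunction

variable {x y : D} {f : x ⟶ y} (A : Companion f) (B : Conjoint f)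

/-- The unit of the adjunction between a companion and a conjoint of an arrow. -/
def companionConjointUnit : Globular (pid x) (A.pro ⊙ B.pro) where
  cell := leftUnitorInv (pid x) ≫ᶜ hcomp A.unit B.unit (by simp)
  src_cell := by simp
  tgt_cell := by simp

/-- The counit of the adjunction between a companion and a conjoint of an arrow. -/
def companionConjointCounit : Globular (B.pro ⊙ A.pro) (pid y) where
  cell := hcomp B.counit A.counit (by simp) ≫ᶜ leftUnitor (pid y)
  src_cell := by simp
  tgt_cell := by simp

theorem isInvertible_companionConjointUnit [IsIso f] :
    IsInvertible (companionConjointUnit A B).cell :=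
  IsInvertible.vcomp (.leftUnitorInv _) (.hcomp A.isInvertible_unit B.isInvertible_unit _)

theorem isInvertible_companionConjointCounit [IsIso f] :
    IsInvertible (companionConjointCounit A B).cell :=
  IsInvertible.vcomp (.hcomp B.isInvertible_counit A.isInvertible_counit _) (.leftUnitor _)

/-- The triangle axiom leaves a right unitor of `pid x` whiskered by `m`, and this cancels because
the two unitors of an external identity coincide. -/
theorem leftUnitorInv_hcomp_assoc_leftUnitor {z : D} (m : Pro x z) :
    hcomp (leftUnitorInv (pid x)) (one m) (by simp) ≫ᶜ assoc (pid x) (pid x) m ≫ᶜ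
      hcomp (one (pid x)) (leftUnitor m) (by simp) = one _ := by
  rw [triangle, vcomp_hcomp, ← hcomp_one]
  exact hcomp_congr _ (by rw [leftUnitorInv_pid, inv_rightUnitor]) (by simp)

theorem one_hcomp_leftUnitorInv_assocInv_leftUnitor {z : D} (m : Pro z x) :
    hcomp (one m) (leftUnitorInv (pid x)) (by simp) ≫ᶜ assocInv m (pid x) (pid x) ≫ᶜ
      hcomp (rightUnitor m) (one (pid x)) (by simp) = one _ := by
  rw [← triangle, assocInv_assoc_assoc, vcomp_hcomp, ← hcomp_one]
  exact hcomp_congr _ (by simp) (by simp)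

/-- In this zigzag the unit and counit of the conjoint face each other in the middle and become
`id_f`, which is absorbed by a unitor. What remains is the external companion identity of `A`. -/
theorem companionConjoint_triangle_left :
    leftUnitorInv A.pro ≫ᶜ hcomp (companionConjointUnit A B).cell (one A.pro) (by simp) ≫ᶜ
      assoc A.pro B.pro A.pro ≫ᶜ hcomp (one A.pro) (companionConjointCounit A B).cell (by simp) ≫ᶜ
      rightUnitor A.pro = one A.pro := by
  rw [companionConjointUnit, companionConjointCounit,
    hcomp_vcomp_one _ _ _ (by simp) (by simp), vcomp_assoc,
    vcomp_reassoc (assoc_naturality A.unit B.unit (one A.pro) (by simp) (by simp)),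
    vcomp_hcomp_assoc (h := by simp) (h' := by simp)]
  -- The right-hand factor is where `B.unit` meets `B.counit`. It simplifies to a left unitor
  -- followed by `A.counit`.
  rw [hcomp_congr (α' := one _ ≫ᶜ A.unit) (β' := leftUnitor A.pro ≫ᶜ A.counit) _ (by simp) (by
      rw [← vcomp_assoc, vcomp_hcomp, ← pidMap_hcomp_leftUnitor (f := f) _ (by simp)]
      exact congrArg (· ≫ᶜ _) (hcomp_congr _ B.vcomp_eq (one_vcomp _))),
    ← vcomp_hcomp_assoc (h := by simp) (h' := by simp), ← vcomp_assoc (assoc _ _ _),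
    ← vcomp_assoc (hcomp (leftUnitorInv _) _ _), leftUnitorInv_hcomp_assoc_leftUnitor, one_vcomp,
    A.hcomp_eq]

/-- Here the unit and counit of the companion meet in the middle, leaving the external conjoint
identity of `B`. -/
theorem companionConjoint_triangle_right :
    rightUnitorInv B.pro ≫ᶜ hcomp (one B.pro) (companionConjointUnit A B).cell (by simp) ≫ᶜ
      assocInv B.pro A.pro B.pro ≫ᶜ
      hcomp (companionConjointCounit A B).cell (one B.pro) (by simp) ≫ᶜ
      leftUnitor B.pro = one B.pro := by
  rw [companionConjointUnit, companionConjointCounit,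
    one_hcomp_vcomp _ _ _ (by simp) (by simp), vcomp_assoc,
    vcomp_reassoc (assocInv_naturality (one B.pro) A.unit B.unit (by simp) (by simp)),
    vcomp_hcomp_assoc (h := by simp) (h' := by simp)]
  rw [hcomp_congr (β' := one _ ≫ᶜ B.unit) (α' := rightUnitor B.pro ≫ᶜ B.counit) _ (by
      dsimp only
      rw [leftUnitor_pid, ← vcomp_assoc, vcomp_hcomp,
        ← hcomp_pidMap_rightUnitor (f := f) _ (by simp)]
      exact congrArg (· ≫ᶜ _) (hcomp_congr _ (one_vcomp _) A.vcomp_eq)) (by simp),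
    ← vcomp_hcomp_assoc (h := by simp) (h' := by simp), ← vcomp_assoc (assocInv _ _ _),
    ← vcomp_assoc (hcomp _ (leftUnitorInv _) _), one_hcomp_leftUnitorInv_assocInv_leftUnitor,
    one_vcomp, B.hcomp_eq]

end Adjunction

end DoubleCategory

/-! ## Companions and conjoints of natural transformations -/

namespace DoubleCategory

variable {D : Type u} [Category.{v} D] [DoubleCategory.{c, p} D] {x y z : D}

/-- Testing a reshaped cell on a counit produces a move of an external identity from right to left.
Moving it past `n` and then past `m` amounts to moving it past `m ⊙ n`; this closes the composition
axiom for companions, and `assocInv_unitors` does so for conjoints. -/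
theorem assoc_unitors (m : Pro x y) (n : Pro y z) :
    assoc m n (pid z) ≫ᶜ
      hcomp (one m) (rightUnitor n ≫ᶜ leftUnitorInv n) (by simp) ≫ᶜ assocInv m (pid y) n ≫ᶜ
      hcomp (rightUnitor m ≫ᶜ leftUnitorInv m) (one n) (by simp) ≫ᶜ assoc (pid x) m n =
    rightUnitor (m ⊙ n) ≫ᶜ leftUnitorInv (m ⊙ n) := by
  have key : ∀ {B : Type u} [Bicategory B] {a b c : B} (f : a ⟶ b) (g : b ⟶ c),
      (Bicategory.associator f g (𝟙 c)).hom ≫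
        Bicategory.whiskerLeft f ((Bicategory.rightUnitor g).hom ≫ (Bicategory.leftUnitor g).inv) ≫
        (Bicategory.associator f (𝟙 b) g).inv ≫
        Bicategory.whiskerRight ((Bicategory.rightUnitor f).hom ≫ (Bicategory.leftUnitor f).inv) g ≫
        (Bicategory.associator (𝟙 a) f g).hom =
      (Bicategory.rightUnitor (f ≫ g)).hom ≫ (Bicategory.leftUnitor (f ≫ g)).inv := by
    intros; bicategory
  exact congrArg Globular.cell (key (B := UBicat D) (a := x) (b := y) (c := z) m n)

theorem assocInv_unitors (m : Pro x y) (n : Pro y z) :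
    assocInv (pid x) m n ≫ᶜ
      hcomp (leftUnitor m ≫ᶜ rightUnitorInv m) (one n) (by simp) ≫ᶜ assoc m (pid y) n ≫ᶜ
      hcomp (one m) (leftUnitor n ≫ᶜ rightUnitorInv n) (by simp) ≫ᶜ assocInv m n (pid z) =
    leftUnitor (m ⊙ n) ≫ᶜ rightUnitorInv (m ⊙ n) := by
  have key : ∀ {B : Type u} [Bicategory B] {a b c : B} (f : a ⟶ b) (g : b ⟶ c),
      (Bicategory.associator (𝟙 a) f g).inv ≫
        Bicategory.whiskerRight ((Bicategory.leftUnitor f).hom ≫ (Bicategory.rightUnitor f).inv) g ≫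
        (Bicategory.associator f (𝟙 b) g).hom ≫
        Bicategory.whiskerLeft f ((Bicategory.leftUnitor g).hom ≫ (Bicategory.rightUnitor g).inv) ≫
        (Bicategory.associator f g (𝟙 c)).inv =
      (Bicategory.leftUnitor (f ≫ g)).hom ≫ (Bicategory.rightUnitor (f ≫ g)).inv := by
    intros; bicategory
  exact congrArg Globular.cell (key (B := UBicat D) (a := x) (b := y) (c := z) m n)

/-- Unitor naturality for a cell with trivial side, with the identity written as `one (pid x)`, the
form in which it arises from whiskering, instead of `pidMap (𝟙 x)`. -/
theorem leftUnitorInv_one_hcomp {y' : D} {m : Pro x y} {m' : Pro x y'}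
    (α : Cell m m') (h : tgt (one (pid x)) = src α) :
    leftUnitorInv m ≫ᶜ hcomp (one (pid x)) α h = α ≫ᶜ leftUnitorInv m' :=
  (congrArg (_ ≫ᶜ ·) (hcomp_congr _ (pidMap_id _).symm rfl)).trans
    (leftUnitorInv_pidMap_hcomp (f := 𝟙 x) α (by simpa using h))

theorem one_hcomp_leftUnitor {y' : D} {m : Pro x y} {m' : Pro x y'}
    (α : Cell m m') (h : tgt (one (pid x)) = src α) :
    hcomp (one (pid x)) α h ≫ᶜ leftUnitor m' = leftUnitor m ≫ᶜ α :=
  (congrArg (· ≫ᶜ _) (hcomp_congr _ (pidMap_id _).symm rfl)).trans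
    (pidMap_hcomp_leftUnitor (f := 𝟙 x) α (by simpa using h))

theorem rightUnitorInv_hcomp_one {x' : D} {m : Pro x y} {m' : Pro x' y}
    (α : Cell m m') (h : tgt α = src (one (pid y))) :
    rightUnitorInv m ≫ᶜ hcomp α (one (pid y)) h = α ≫ᶜ rightUnitorInv m' :=
  (congrArg (_ ≫ᶜ ·) (hcomp_congr _ rfl (pidMap_id _).symm)).trans
    (rightUnitorInv_hcomp_pidMap (f := 𝟙 y) α (by simpa using h))

theorem hcomp_one_rightUnitor {x' : D} {m : Pro x y} {m' : Pro x' y}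
    (α : Cell m m') (h : tgt α = src (one (pid y))) :
    hcomp α (one (pid y)) h ≫ᶜ rightUnitor m' = rightUnitor m ≫ᶜ α :=
  (congrArg (· ≫ᶜ _) (hcomp_congr _ rfl (pidMap_id _).symm)).trans
    (hcomp_pidMap_rightUnitor (f := 𝟙 y) α (by simpa using h))

end DoubleCategory

/-! ### The oplax protransformation of companions of a natural transformation. -/

namespace DoubleNatTrans

variable {D : Type u} [Category.{v} D] [DoubleCategory.{c, p} D]
  {E : Type u₁} [Category.{v₁} E] [DoubleCategory.{c₁, p₁} E]
  {F G : LaxDoubleFunctor D E} (α : DoubleNatTrans F G)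

section Companion

variable (A : ∀ x : D, Companion (α.app x))

/-- The component at an arrow of the companion of a natural transformation. -/
def companionArr {x y : D} (f : x ⟶ y) : Cell (A x).pro (A y).pro :=
  slideSquareCompanion (α.naturality f) (A x) (A y)

/-- The comparison at a proarrow of the companion of a natural transformation. -/
def companionNat {x y : D} (m : Pro x y) :
    Cell (F.mapPro m ⊙ (A y).pro) ((A x).pro ⊙ G.mapPro m) :=
  slideCompanion (α.cell m) (α.src_cell m) (α.tgt_cell m) (A x) (A y)

@[simp] theorem src_companionArr {x y : D} (f : x ⟶ y) : src (α.companionArr A f) = F.map f :=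
  (α.companionData A).src_arr f

@[simp] theorem tgt_companionArr {x y : D} (f : x ⟶ y) : tgt (α.companionArr A f) = G.map f :=
  (α.companionData A).tgt_arr f

@[simp] theorem src_companionNat {x y : D} (m : Pro x y) : src (α.companionNat A m) = 𝟙 _ :=
  (α.companionData A).src_nat m

@[simp] theorem tgt_companionNat {x y : D} (m : Pro x y) : tgt (α.companionNat A m) = 𝟙 _ :=
  (α.companionData A).tgt_nat m

/-- This and `companionNat_counit` are all that the oplax axioms use about the sliding cells. The
two corresponding unit equations enter only in the unit of the adjunction. -/
theorem companionArr_counit {x y : D} (f : x ⟶ y) :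
    α.companionArr A f ≫ᶜ (A y).counit = (A x).counit ≫ᶜ pidMap (G.map f) :=
  slideSquareCompanion_counit (α.naturality f) _ _

theorem unit_companionArr {x y : D} (f : x ⟶ y) :
    (A x).unit ≫ᶜ α.companionArr A f = pidMap (F.map f) ≫ᶜ (A y).unit :=
  unit_slideSquareCompanion (α.naturality f) _ _

theorem companionNat_counit {x y : D} (m : Pro x y) :
    α.companionNat A m ≫ᶜ hcomp (A x).counit (one (G.mapPro m)) (by simp) =
      hcomp (α.cell m) (A y).counit (by simp) ≫ᶜ rightUnitor (G.mapPro m) ≫ᶜ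
        leftUnitorInv (G.mapPro m) :=
  slideCompanion_counit _ (α.src_cell m) (α.tgt_cell m) _ _

theorem unit_companionNat {x y : D} (m : Pro x y) :
    hcomp (one (F.mapPro m)) (A y).unit (by simp) ≫ᶜ α.companionNat A m =
      rightUnitor (F.mapPro m) ≫ᶜ leftUnitorInv (F.mapPro m) ≫ᶜ
        hcomp (A x).unit (α.cell m) (by simp) :=
  one_hcomp_unit_slideCompanion _ (α.src_cell m) (α.tgt_cell m) _ _

/-- After the counit test both sides have the shape of a composite beside a counit, followed by
unitors. The left factors agree by naturality of `α` at `γ`, the right ones by the counit equation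
for the arrow component. -/
theorem companionNat_naturality {x y w z : D} {m : Pro x y} {n : Pro w z} (γ : Cell m n) :
    α.companionNat A m ≫ᶜ hcomp (α.companionArr A (src γ)) (G.mapCell γ) (by simp) =
      hcomp (F.mapCell γ) (α.companionArr A (tgt γ)) (by simp) ≫ᶜ α.companionNat A n := by
  apply (A w).hom_ext_hcomp
  · simp
  · rw [vcomp_assoc, vcomp_assoc, companionNat_counit, vcomp_hcomp (h' := by simp),
      hcomp_congr (α' := (A x).counit ≫ᶜ pidMap (G.map (src γ)))
        (β' := one _ ≫ᶜ G.mapCell γ) _ (α.companionArr_counit A _) (by simp),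
      ← vcomp_hcomp _ _ (by simp) _ _ (by simp), ← vcomp_assoc, companionNat_counit,
      vcomp_assoc, vcomp_assoc, leftUnitorInv_pidMap_hcomp,
      ← vcomp_reassoc (hcomp_pidMap_rightUnitor (f := G.map (tgt γ)) _ (by simp)),
      vcomp_hcomp_assoc (h := by simp) (h' := by simp),
      vcomp_hcomp_assoc (h := by simp) (h' := by simp)]
    exact congrArg (· ≫ᶜ _) (hcomp_congr _ (α.cell_naturality γ).symm
      (α.companionArr_counit A _).symm)

/-- The counit test strips both comparison cells down to the components of `α` at `m` and `n` beside
a single counit. The claim is then compatibility of `α` with the composition comparisons. -/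
theorem companionNat_comp {x y z : D} (m : Pro x y) (n : Pro y z) :
    assoc (F.mapPro m) (F.mapPro n) (A z).pro ≫ᶜ
        hcomp (one (F.mapPro m)) (α.companionNat A n) (by simp) ≫ᶜ
        assocInv (F.mapPro m) (A y).pro (G.mapPro n) ≫ᶜ
        hcomp (α.companionNat A m) (one (G.mapPro n)) (by simp) ≫ᶜ
        assoc (A x).pro (G.mapPro m) (G.mapPro n) ≫ᶜ
        hcomp (one (A x).pro) (G.lcomp m n) (by simp) =
      hcomp (F.lcomp m n) (one (A z).pro) (by simp) ≫ᶜ α.companionNat A (m ⊙ n) := by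
  apply (A x).hom_ext_hcomp
  · simp
  -- The equations `e₁` to `e₆` carry the counit from the end of the composite to its beginning, one
  -- factor at a time, replacing each comparison cell by a component of `α`. The unitors left behind
  -- are collapsed by `e₇`.
  · have e₁ : hcomp (one (A x).pro) (G.lcomp m n) (by simp) ≫ᶜ
          hcomp (A x).counit (one (G.mapPro (m ⊙ n))) (by simp) =
        hcomp (A x).counit (hcomp (one (G.mapPro m)) (one (G.mapPro n)) (by simp)) (by simp) ≫ᶜ
          hcomp (one (pid (G.obj x))) (G.lcomp m n) (by simp) := by
      rw [vcomp_hcomp, vcomp_hcomp]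
      exact hcomp_congr _ (by simp) (by simp)
    have e₂ := assoc_naturality (A x).counit (one (G.mapPro m)) (one (G.mapPro n))
      (by simp) (by simp)
    have e₃ : hcomp (α.companionNat A m) (one (G.mapPro n)) (by simp) ≫ᶜ
          hcomp (hcomp (A x).counit (one (G.mapPro m)) (by simp)) (one (G.mapPro n)) (by simp) =
        hcomp (hcomp (α.cell m) (A y).counit (by simp)) (one (G.mapPro n)) (by simp) ≫ᶜ
          hcomp (rightUnitor (G.mapPro m) ≫ᶜ leftUnitorInv (G.mapPro m)) (one (G.mapPro n))
            (by simp) := by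
      rw [vcomp_hcomp, vcomp_hcomp]
      exact hcomp_congr _ (α.companionNat_counit A m) rfl
    have e₄ := assocInv_naturality (α.cell m) (A y).counit (one (G.mapPro n)) (by simp) (by simp)
    have e₅ : hcomp (one (F.mapPro m)) (α.companionNat A n) (by simp) ≫ᶜ
          hcomp (α.cell m) (hcomp (A y).counit (one (G.mapPro n)) (by simp)) (by simp) =
        hcomp (α.cell m) (hcomp (α.cell n) (A z).counit (by simp)) (by simp) ≫ᶜ
          hcomp (one (G.mapPro m)) (rightUnitor (G.mapPro n) ≫ᶜ leftUnitorInv (G.mapPro n))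
            (by simp) := by
      rw [vcomp_hcomp, vcomp_hcomp]
      exact hcomp_congr _ (by simp) (α.companionNat_counit A n)
    have e₆ := assoc_naturality (α.cell m) (α.cell n) (A z).counit (by simp) (by simp)
    have e₇ := congrArg (· ≫ᶜ hcomp (one (pid (G.obj x))) (G.lcomp m n) (by simp))
      (assoc_unitors (G.mapPro m) (G.mapPro n))
    simp only [vcomp_assoc] at e₇ ⊢
    rw [e₁, ← vcomp_reassoc e₂, vcomp_reassoc e₃, ← vcomp_reassoc e₄, vcomp_reassoc e₅,
      ← vcomp_reassoc e₆, e₇, leftUnitorInv_one_hcomp, companionNat_counit,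
      vcomp_hcomp_assoc (h := by simp) (h' := by simp),
      hcomp_congr (α' := hcomp (α.cell m) (α.cell n) (by simp) ≫ᶜ G.lcomp m n)
        (β' := (A z).counit ≫ᶜ one (pid (G.obj z))) _ (α.cell_lcomp m n) (by simp),
      ← vcomp_hcomp _ _ (by simp) _ _ (by simp), vcomp_assoc,
      vcomp_reassoc (hcomp_one_rightUnitor _ (by simp))]

/-- After the counit test this is compatibility of `α` with the identity comparisons; the two
unitors of an external identity have to be exchanged along the way. -/
theorem companionNat_pid (x : D) :
    hcomp (F.lunit x) (one (A x).pro) (by simp) ≫ᶜ α.companionNat A (pid x) =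
      leftUnitor (A x).pro ≫ᶜ rightUnitorInv (A x).pro ≫ᶜ
        hcomp (one (A x).pro) (G.lunit x) (by simp) := by
  apply (A x).hom_ext_hcomp
  · simp
  · have e₁ : hcomp (one (A x).pro) (G.lunit x) (by simp) ≫ᶜ
          hcomp (A x).counit (one (G.mapPro (pid x))) (by simp) =
        hcomp (A x).counit (pidMap (𝟙 _)) (by simp) ≫ᶜ
          hcomp (one (pid (G.obj x))) (G.lunit x) (by simp) := by
      rw [vcomp_hcomp, vcomp_hcomp]
      exact hcomp_congr _ (by simp) (by simp)
    rw [vcomp_assoc, vcomp_assoc, vcomp_assoc, companionNat_counit, e₁,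
      ← vcomp_assoc (rightUnitorInv _), rightUnitorInv_hcomp_pidMap, vcomp_assoc,
      ← leftUnitorInv_pid, leftUnitorInv_one_hcomp,
      vcomp_hcomp_assoc (h := by simp) (h' := by simp),
      hcomp_congr (α' := pidMap (α.app x) ≫ᶜ G.lunit x)
        (β' := (A x).counit ≫ᶜ one (pid (G.obj x))) _ (α.cell_lunit x) (by simp),
      ← vcomp_hcomp _ _ (by simp) _ _ (by simp), vcomp_assoc,
      vcomp_reassoc (hcomp_one_rightUnitor _ (by simp)), ← leftUnitor_pid,
      vcomp_reassoc (pidMap_hcomp_leftUnitor _ (by simp))]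

/-- Functoriality in arrows is again a counit test, reducing to functoriality of `G` and of external
identities. -/
theorem companionData_isOplax : (α.companionData A).IsOplax where
  arr_id x := by
    have e : α.companionArr A (𝟙 x) = one (A x).pro := (A x).hom_ext (by simp)
      ((α.companionArr_counit A _).trans (by simp))
    exact e
  arr_comp {x y z} f g := by
    have e : α.companionArr A (f ≫ g) = α.companionArr A f ≫ᶜ α.companionArr A g :=
      (A z).hom_ext (by simp) (by
        rw [vcomp_assoc, companionArr_counit, companionArr_counit,
          vcomp_reassoc (α.companionArr_counit A f), G.map_comp, pidMap_comp])
    exact e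
  naturality γ := α.companionNat_naturality A γ
  nat_comp m n := α.companionNat_comp A m n
  nat_id x := α.companionNat_pid A x

theorem companionData_isPseudo [∀ x, IsIso (α.app x)]
    (h : ∀ {x y : D} (m : Pro x y), IsInvertible (α.cell m)) : (α.companionData A).IsPseudo :=
  fun _ _ m => isInvertible_slideCompanion (h m) (α.src_cell m) (α.tgt_cell m) _ _

end Companion
end DoubleNatTrans

/-! ### The lax protransformation of conjoints of a natural transformation. -/

namespace DoubleNatTrans

variable {D : Type u} [Category.{v} D] [DoubleCategory.{c, p} D]
  {E : Type u₁} [Category.{v₁} E] [DoubleCategory.{c₁, p₁} E]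
  {F G : LaxDoubleFunctor D E} (α : DoubleNatTrans F G)

section Conjoint

variable (B : ∀ x : D, Conjoint (α.app x))

/-- The component at an arrow of the conjoint of a natural transformation. -/
def conjointArr {x y : D} (f : x ⟶ y) : Cell (B x).pro (B y).pro :=
  slideSquareConjoint (α.naturality f) (B x) (B y)

/-- The comparison at a proarrow of the conjoint of a natural transformation. -/
def conjointNat {x y : D} (m : Pro x y) :
    Cell ((B x).pro ⊙ F.mapPro m) (G.mapPro m ⊙ (B y).pro) :=
  slideConjoint (α.cell m) (α.src_cell m) (α.tgt_cell m) (B x) (B y)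

@[simp] theorem src_conjointArr {x y : D} (f : x ⟶ y) : src (α.conjointArr B f) = G.map f :=
  (α.conjointData B).src_arr f

@[simp] theorem tgt_conjointArr {x y : D} (f : x ⟶ y) : tgt (α.conjointArr B f) = F.map f :=
  (α.conjointData B).tgt_arr f

@[simp] theorem src_conjointNat {x y : D} (m : Pro x y) : src (α.conjointNat B m) = 𝟙 _ :=
  (α.conjointData B).src_nat m

@[simp] theorem tgt_conjointNat {x y : D} (m : Pro x y) : tgt (α.conjointNat B m) = 𝟙 _ :=
  (α.conjointData B).tgt_nat m

theorem conjointArr_counit {x y : D} (f : x ⟶ y) :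
    α.conjointArr B f ≫ᶜ (B y).counit = (B x).counit ≫ᶜ pidMap (G.map f) :=
  slideSquareConjoint_counit (α.naturality f) _ _

theorem unit_conjointArr {x y : D} (f : x ⟶ y) :
    (B x).unit ≫ᶜ α.conjointArr B f = pidMap (F.map f) ≫ᶜ (B y).unit :=
  unit_slideSquareConjoint (α.naturality f) _ _

theorem conjointNat_counit {x y : D} (m : Pro x y) :
    α.conjointNat B m ≫ᶜ hcomp (one (G.mapPro m)) (B y).counit (by simp) =
      hcomp (B x).counit (α.cell m) (by simp) ≫ᶜ leftUnitor (G.mapPro m) ≫ᶜ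
        rightUnitorInv (G.mapPro m) :=
  slideConjoint_counit _ (α.src_cell m) (α.tgt_cell m) _ _

theorem unit_conjointNat {x y : D} (m : Pro x y) :
    hcomp (B x).unit (one (F.mapPro m)) (by simp) ≫ᶜ α.conjointNat B m =
      leftUnitor (F.mapPro m) ≫ᶜ rightUnitorInv (F.mapPro m) ≫ᶜ
        hcomp (α.cell m) (B y).unit (by simp) :=
  unit_hcomp_one_slideConjoint _ (α.src_cell m) (α.tgt_cell m) _ _

/-- The test now uses the counit at the right-hand end `z`, since the conjoint is the right factor
of the codomain. The factors then match by naturality of `α` and the counit equation for arrows. -/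
theorem conjointNat_naturality {x y w z : D} {m : Pro x y} {n : Pro w z} (γ : Cell m n) :
    α.conjointNat B m ≫ᶜ hcomp (G.mapCell γ) (α.conjointArr B (tgt γ)) (by simp) =
      hcomp (α.conjointArr B (src γ)) (F.mapCell γ) (by simp) ≫ᶜ α.conjointNat B n := by
  apply (B z).hom_ext_hcomp
  · simp
  · rw [vcomp_assoc, vcomp_assoc, conjointNat_counit, vcomp_hcomp (h' := by simp),
      hcomp_congr (α' := one _ ≫ᶜ G.mapCell γ) (β' := (B y).counit ≫ᶜ pidMap (G.map (tgt γ)))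
        _ (by simp) (α.conjointArr_counit B _),
      ← vcomp_hcomp _ _ (by simp) _ _ (by simp), ← vcomp_assoc, conjointNat_counit,
      vcomp_assoc, vcomp_assoc, rightUnitorInv_hcomp_pidMap,
      ← vcomp_reassoc (pidMap_hcomp_leftUnitor (f := G.map (src γ)) _ (by simp)),
      vcomp_hcomp_assoc (h := by simp) (h' := by simp),
      vcomp_hcomp_assoc (h := by simp) (h' := by simp)]
    exact congrArg (· ≫ᶜ _) (hcomp_congr _ (α.conjointArr_counit B _).symm
      (α.cell_naturality γ).symm)

/-- The counit at `z` is carried back through the composite as in `companionNat_comp`, and the claim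
again becomes compatibility of `α` with the composition comparisons. -/
theorem conjointNat_comp {x y z : D} (m : Pro x y) (n : Pro y z) :
    assocInv (B x).pro (F.mapPro m) (F.mapPro n) ≫ᶜ
        hcomp (α.conjointNat B m) (one (F.mapPro n)) (by simp) ≫ᶜ
        assoc (G.mapPro m) (B y).pro (F.mapPro n) ≫ᶜ
        hcomp (one (G.mapPro m)) (α.conjointNat B n) (by simp) ≫ᶜ
        assocInv (G.mapPro m) (G.mapPro n) (B z).pro ≫ᶜ
        hcomp (G.lcomp m n) (one (B z).pro) (by simp) =
      hcomp (one (B x).pro) (F.lcomp m n) (by simp) ≫ᶜ α.conjointNat B (m ⊙ n) := by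
  apply (B z).hom_ext_hcomp
  · simp
  · have e₁ : hcomp (G.lcomp m n) (one (B z).pro) (by simp) ≫ᶜ
          hcomp (one (G.mapPro (m ⊙ n))) (B z).counit (by simp) =
        hcomp (hcomp (one (G.mapPro m)) (one (G.mapPro n)) (by simp)) (B z).counit (by simp) ≫ᶜ
          hcomp (G.lcomp m n) (one (pid (G.obj z))) (by simp) := by
      rw [vcomp_hcomp, vcomp_hcomp]
      exact hcomp_congr _ (by simp) (by simp)
    have e₂ := assocInv_naturality (one (G.mapPro m)) (one (G.mapPro n)) (B z).counit
      (by simp) (by simp)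
    have e₃ : hcomp (one (G.mapPro m)) (α.conjointNat B n) (by simp) ≫ᶜ
          hcomp (one (G.mapPro m)) (hcomp (one (G.mapPro n)) (B z).counit (by simp)) (by simp) =
        hcomp (one (G.mapPro m)) (hcomp (B y).counit (α.cell n) (by simp)) (by simp) ≫ᶜ
          hcomp (one (G.mapPro m)) (leftUnitor (G.mapPro n) ≫ᶜ rightUnitorInv (G.mapPro n))
            (by simp) := by
      rw [vcomp_hcomp, vcomp_hcomp]
      exact hcomp_congr _ rfl (α.conjointNat_counit B n)
    have e₄ := assoc_naturality (one (G.mapPro m)) (B y).counit (α.cell n) (by simp) (by simp)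
    have e₅ : hcomp (α.conjointNat B m) (one (F.mapPro n)) (by simp) ≫ᶜ
          hcomp (hcomp (one (G.mapPro m)) (B y).counit (by simp)) (α.cell n) (by simp) =
        hcomp (hcomp (B x).counit (α.cell m) (by simp)) (α.cell n) (by simp) ≫ᶜ
          hcomp (leftUnitor (G.mapPro m) ≫ᶜ rightUnitorInv (G.mapPro m)) (one (G.mapPro n))
            (by simp) := by
      rw [vcomp_hcomp, vcomp_hcomp]
      exact hcomp_congr _ (α.conjointNat_counit B m) (by simp)
    have e₆ := assocInv_naturality (B x).counit (α.cell m) (α.cell n) (by simp) (by simp)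
    have e₇ := congrArg (· ≫ᶜ hcomp (G.lcomp m n) (one (pid (G.obj z))) (by simp))
      (assocInv_unitors (G.mapPro m) (G.mapPro n))
    simp only [vcomp_assoc] at e₇ ⊢
    rw [e₁, ← vcomp_reassoc e₂, vcomp_reassoc e₃, ← vcomp_reassoc e₄, vcomp_reassoc e₅,
      ← vcomp_reassoc e₆, e₇, rightUnitorInv_hcomp_one, conjointNat_counit,
      vcomp_hcomp_assoc (h := by simp) (h' := by simp),
      hcomp_congr (β' := hcomp (α.cell m) (α.cell n) (by simp) ≫ᶜ G.lcomp m n)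
        (α' := (B x).counit ≫ᶜ one (pid (G.obj x))) _ (by simp) (α.cell_lcomp m n),
      ← vcomp_hcomp _ _ (by simp) _ _ (by simp), vcomp_assoc,
      vcomp_reassoc (one_hcomp_leftUnitor _ (by simp))]

/-- Compatibility of `α` with the identity comparisons, as seen by the counit test. -/
theorem conjointNat_pid (x : D) :
    hcomp (one (B x).pro) (F.lunit x) (by simp) ≫ᶜ α.conjointNat B (pid x) =
      rightUnitor (B x).pro ≫ᶜ leftUnitorInv (B x).pro ≫ᶜ
        hcomp (G.lunit x) (one (B x).pro) (by simp) := by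
  apply (B x).hom_ext_hcomp
  · simp
  · have e₁ : hcomp (G.lunit x) (one (B x).pro) (by simp) ≫ᶜ
          hcomp (one (G.mapPro (pid x))) (B x).counit (by simp) =
        hcomp (pidMap (𝟙 _)) (B x).counit (by simp) ≫ᶜ
          hcomp (G.lunit x) (one (pid (G.obj x))) (by simp) := by
      rw [vcomp_hcomp, vcomp_hcomp]
      exact hcomp_congr _ (by simp) (by simp)
    rw [vcomp_assoc, vcomp_assoc, vcomp_assoc, conjointNat_counit, e₁,
      ← vcomp_assoc (leftUnitorInv _), leftUnitorInv_pidMap_hcomp, vcomp_assoc,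
      leftUnitorInv_pid, rightUnitorInv_hcomp_one,
      vcomp_hcomp_assoc (h := by simp) (h' := by simp),
      hcomp_congr (β' := pidMap (α.app x) ≫ᶜ G.lunit x)
        (α' := (B x).counit ≫ᶜ one (pid (G.obj x))) _ (by simp) (α.cell_lunit x),
      ← vcomp_hcomp _ _ (by simp) _ _ (by simp), vcomp_assoc,
      vcomp_reassoc (one_hcomp_leftUnitor _ (by simp)), leftUnitor_pid,
      vcomp_reassoc (hcomp_pidMap_rightUnitor _ (by simp))]

theorem conjointData_isLax : (α.conjointData B).IsLax where
  arr_id x := by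
    have e : α.conjointArr B (𝟙 x) = one (B x).pro := (B x).hom_ext (by simp)
      ((α.conjointArr_counit B _).trans (by simp))
    exact e
  arr_comp {x y z} f g := by
    have e : α.conjointArr B (f ≫ g) = α.conjointArr B f ≫ᶜ α.conjointArr B g :=
      (B z).hom_ext (by simp) (by
        rw [vcomp_assoc, conjointArr_counit, conjointArr_counit,
          vcomp_reassoc (α.conjointArr_counit B f), G.map_comp, pidMap_comp])
    exact e
  naturality γ := α.conjointNat_naturality B γ
  nat_comp m n := α.conjointNat_comp B m n
  nat_id x := α.conjointNat_pid B x

theorem conjointData_isPseudo [∀ x, IsIso (α.app x)]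
    (h : ∀ {x y : D} (m : Pro x y), IsInvertible (α.cell m)) : (α.conjointData B).IsPseudo :=
  fun _ _ m => isInvertible_slideConjoint (h m) (α.src_cell m) (α.tgt_cell m) _ _

end Conjoint

end DoubleNatTrans

/-! ### The adjoint equivalence of an invertible natural transformation -/

namespace DoubleCategory

variable {D : Type u} [Category.{v} D] [DoubleCategory.{c, p} D] {x y : D}

/-- The associators and unitors that remain in `unit_nat` once the component of `α` and the units
have been gathered on the right. -/
theorem adjunction_unit_coherence (m : Pro x y) :
    hcomp (leftUnitorInv (pid x)) (one m) (by simp) ≫ᶜ assoc (pid x) (pid x) m ≫ᶜ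
      hcomp (one (pid x)) (leftUnitor m ≫ᶜ rightUnitorInv m) (by simp) ≫ᶜ
      assocInv (pid x) m (pid y) =
    leftUnitor m ≫ᶜ rightUnitorInv m ≫ᶜ hcomp (one m) (leftUnitorInv (pid y)) (by simp) ≫ᶜ
      assocInv m (pid y) (pid y) ≫ᶜ
      hcomp (rightUnitor m ≫ᶜ leftUnitorInv m) (one (pid y)) (by simp) := by
  have key : ∀ {B : Type u} [Bicategory B] {a b : B} (f : a ⟶ b),
      Bicategory.whiskerRight (Bicategory.leftUnitor (𝟙 a)).inv f ≫
        (Bicategory.associator (𝟙 a) (𝟙 a) f).hom ≫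
        Bicategory.whiskerLeft (𝟙 a)
          ((Bicategory.leftUnitor f).hom ≫ (Bicategory.rightUnitor f).inv) ≫
        (Bicategory.associator (𝟙 a) f (𝟙 b)).inv =
      (Bicategory.leftUnitor f).hom ≫ (Bicategory.rightUnitor f).inv ≫
        Bicategory.whiskerLeft f (Bicategory.leftUnitor (𝟙 b)).inv ≫
        (Bicategory.associator f (𝟙 b) (𝟙 b)).inv ≫
        Bicategory.whiskerRight
          ((Bicategory.rightUnitor f).hom ≫ (Bicategory.leftUnitor f).inv) (𝟙 b) := by
    intros; bicategory
  exact congrArg Globular.cell (key (B := UBicat D) (a := x) (b := y) m)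

/-- The associators and unitors that remain in `counit_nat` once the component of `α` and the
counits have been gathered on the left. -/
theorem adjunction_counit_coherence (m : Pro x y) :
    hcomp (one (pid x)) (rightUnitor m ≫ᶜ leftUnitorInv m) (by simp) ≫ᶜ
      assocInv (pid x) (pid x) m ≫ᶜ hcomp (leftUnitor (pid x)) (one m) (by simp) ≫ᶜ
      leftUnitor m ≫ᶜ rightUnitorInv m =
    assocInv (pid x) m (pid y) ≫ᶜ
      hcomp (leftUnitor m ≫ᶜ rightUnitorInv m) (one (pid y)) (by simp) ≫ᶜ
      assoc m (pid y) (pid y) ≫ᶜ hcomp (one m) (leftUnitor (pid y)) (by simp) := by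
  have key : ∀ {B : Type u} [Bicategory B] {a b : B} (f : a ⟶ b),
      Bicategory.whiskerLeft (𝟙 a)
          ((Bicategory.rightUnitor f).hom ≫ (Bicategory.leftUnitor f).inv) ≫
        (Bicategory.associator (𝟙 a) (𝟙 a) f).inv ≫
        Bicategory.whiskerRight (Bicategory.leftUnitor (𝟙 a)).hom f ≫
        (Bicategory.leftUnitor f).hom ≫ (Bicategory.rightUnitor f).inv =
      (Bicategory.associator (𝟙 a) f (𝟙 b)).inv ≫
        Bicategory.whiskerRight
          ((Bicategory.leftUnitor f).hom ≫ (Bicategory.rightUnitor f).inv) (𝟙 b) ≫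
        (Bicategory.associator f (𝟙 b) (𝟙 b)).hom ≫
        Bicategory.whiskerLeft f (Bicategory.leftUnitor (𝟙 b)).hom := by
    intros; bicategory
  exact congrArg Globular.cell (key (B := UBicat D) (a := x) (b := y) m)

end DoubleCategory

/-! ### Naturality of the companion-conjoint units and counits. -/

namespace DoubleNatTrans

variable {D : Type u} [Category.{v} D] [DoubleCategory.{c, p} D]
  {E : Type u₁} [Category.{v₁} E] [DoubleCategory.{c₁, p₁} E]
  {F G : LaxDoubleFunctor D E} (α : DoubleNatTrans F G)
  (A : ∀ x : D, Companion (α.app x)) (B : ∀ x : D, Conjoint (α.app x))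

/-- By interchange this splits into the unit equations for the arrow components of the companion and
of the conjoint. -/
theorem unit_arr {x y : D} (f : x ⟶ y) :
    (companionConjointUnit (A x) (B x)).cell ≫ᶜ
        hcomp (α.companionArr A f) (α.conjointArr B f) (by simp) =
      pidMap (F.map f) ≫ᶜ (companionConjointUnit (A y) (B y)).cell := by
  have e : pidMap (F.map f) ≫ᶜ leftUnitorInv _ =
      leftUnitorInv _ ≫ᶜ hcomp (pidMap (F.map f)) (pidMap (F.map f)) (by simp) :=
    (leftUnitorInv_pidMap_hcomp _ _).symm
  simp only [companionConjointUnit, vcomp_assoc]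
  rw [vcomp_reassoc e, vcomp_hcomp, vcomp_hcomp]
  exact congrArg (_ ≫ᶜ ·) (hcomp_congr _ (α.unit_companionArr A f) (α.unit_conjointArr B f))

/-- By interchange this splits into the two counit equations for the arrow components. -/
theorem counit_arr {x y : D} (f : x ⟶ y) :
    (companionConjointCounit (A x) (B x)).cell ≫ᶜ pidMap (G.map f) =
      hcomp (α.conjointArr B f) (α.companionArr A f) (by simp) ≫ᶜ
        (companionConjointCounit (A y) (B y)).cell := by
  have e := pidMap_hcomp_leftUnitor (f := G.map f) (pidMap (G.map f)) (by simp)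
  simp only [companionConjointCounit, vcomp_assoc]
  rw [← e, vcomp_hcomp_assoc (h := by simp) (h' := by simp),
    vcomp_hcomp_assoc (h := by simp) (h' := by simp)]
  exact congrArg (· ≫ᶜ _) (hcomp_congr _ (α.conjointArr_counit B f).symm
    (α.companionArr_counit A f).symm)

/-- Both sides reduce to the component of `α` at `m` flanked by the unit of the companion on the
left and that of the conjoint on the right. The oplax comparison of the companion stands on the
right-hand side, so no invertibility is needed at this stage. -/
theorem unit_nat {x y : D} (m : Pro x y) :
    hcomp (companionConjointUnit (A x) (B x)).cell (one (F.mapPro m)) (by simp) ≫ᶜ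
        assoc (A x).pro (B x).pro (F.mapPro m) ≫ᶜ
        hcomp (one (A x).pro) (α.conjointNat B m) (by simp) ≫ᶜ
        assocInv (A x).pro (G.mapPro m) (B y).pro =
      leftUnitor (F.mapPro m) ≫ᶜ rightUnitorInv (F.mapPro m) ≫ᶜ
        hcomp (one (F.mapPro m)) (companionConjointUnit (A y) (B y)).cell (by simp) ≫ᶜ
        assocInv (F.mapPro m) (A y).pro (B y).pro ≫ᶜ
        hcomp (α.companionNat A m) (one (B y).pro) (by simp) := by
  -- The units are carried past each factor in turn: `e₁` to `e₃` treat the left-hand side, `e₄` and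
  -- `e₅` the right-hand side, and `e₆` compares the coherence cells left in front.
  have e₁ := assoc_naturality (A x).unit (B x).unit (one (F.mapPro m)) (by simp) (by simp)
  have e₂ : hcomp (A x).unit (hcomp (B x).unit (one (F.mapPro m)) (by simp)) (by simp) ≫ᶜ
        hcomp (one (A x).pro) (α.conjointNat B m) (by simp) =
      hcomp (one (pid (F.obj x))) (leftUnitor (F.mapPro m) ≫ᶜ rightUnitorInv (F.mapPro m))
          (by simp) ≫ᶜ
        hcomp (A x).unit (hcomp (α.cell m) (B y).unit (by simp)) (by simp) := by
    rw [vcomp_hcomp, vcomp_hcomp]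
    exact hcomp_congr _ (by simp) ((α.unit_conjointNat B m).trans (vcomp_assoc _ _ _).symm)
  have e₃ := assocInv_naturality (A x).unit (α.cell m) (B y).unit (by simp) (by simp)
  have e₄ := assocInv_naturality (one (F.mapPro m)) (A y).unit (B y).unit (by simp) (by simp)
  have e₅ : hcomp (hcomp (one (F.mapPro m)) (A y).unit (by simp)) (B y).unit (by simp) ≫ᶜ
        hcomp (α.companionNat A m) (one (B y).pro) (by simp) =
      hcomp (rightUnitor (F.mapPro m) ≫ᶜ leftUnitorInv (F.mapPro m)) (one (pid (F.obj y)))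
          (by simp) ≫ᶜ
        hcomp (hcomp (A x).unit (α.cell m) (by simp)) (B y).unit (by simp) := by
    rw [vcomp_hcomp, vcomp_hcomp]
    exact hcomp_congr _ ((α.unit_companionNat A m).trans (vcomp_assoc _ _ _).symm) (by simp)
  have e₆ := congrArg
    (· ≫ᶜ hcomp (hcomp (A x).unit (α.cell m) (by simp)) (B y).unit (by simp))
    (adjunction_unit_coherence (F.mapPro m))
  simp only [vcomp_assoc] at e₆
  rw [companionConjointUnit, companionConjointUnit,
    hcomp_vcomp_one _ _ _ (by simp) (by simp), one_hcomp_vcomp _ _ _ (by simp) (by simp),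
    vcomp_assoc, vcomp_assoc, vcomp_reassoc e₁, vcomp_reassoc e₂, e₃, vcomp_reassoc e₄, e₅, e₆]

/-- Both sides reduce to the component of `α` at `m` flanked by the two counits. As in `unit_nat`,
the oplax comparison itself occurs and not its inverse. -/
theorem counit_nat {x y : D} (m : Pro x y) :
    hcomp (one (B x).pro) (α.companionNat A m) (by simp) ≫ᶜ
        assocInv (B x).pro (A x).pro (G.mapPro m) ≫ᶜ
        hcomp (companionConjointCounit (A x) (B x)).cell (one (G.mapPro m)) (by simp) ≫ᶜ
        leftUnitor (G.mapPro m) ≫ᶜ rightUnitorInv (G.mapPro m) =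
      assocInv (B x).pro (F.mapPro m) (A y).pro ≫ᶜ
        hcomp (α.conjointNat B m) (one (A y).pro) (by simp) ≫ᶜ
        assoc (G.mapPro m) (B y).pro (A y).pro ≫ᶜ
        hcomp (one (G.mapPro m)) (companionConjointCounit (A y) (B y)).cell (by simp) := by
  have e₁ := assocInv_naturality (B x).counit (A x).counit (one (G.mapPro m)) (by simp) (by simp)
  have e₂ : hcomp (one (B x).pro) (α.companionNat A m) (by simp) ≫ᶜ
        hcomp (B x).counit (hcomp (A x).counit (one (G.mapPro m)) (by simp)) (by simp) =
      hcomp (B x).counit (hcomp (α.cell m) (A y).counit (by simp)) (by simp) ≫ᶜ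
        hcomp (one (pid (G.obj x))) (rightUnitor (G.mapPro m) ≫ᶜ leftUnitorInv (G.mapPro m))
          (by simp) := by
    rw [vcomp_hcomp, vcomp_hcomp]
    exact hcomp_congr _ (by simp) (α.companionNat_counit A m)
  have e₃ := assocInv_naturality (B x).counit (α.cell m) (A y).counit (by simp) (by simp)
  have e₄ := assoc_naturality (one (G.mapPro m)) (B y).counit (A y).counit (by simp) (by simp)
  have e₅ : hcomp (α.conjointNat B m) (one (A y).pro) (by simp) ≫ᶜ
        hcomp (hcomp (one (G.mapPro m)) (B y).counit (by simp)) (A y).counit (by simp) =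
      hcomp (hcomp (B x).counit (α.cell m) (by simp)) (A y).counit (by simp) ≫ᶜ
        hcomp (leftUnitor (G.mapPro m) ≫ᶜ rightUnitorInv (G.mapPro m)) (one (pid (G.obj y)))
          (by simp) := by
    rw [vcomp_hcomp, vcomp_hcomp]
    exact hcomp_congr _ (α.conjointNat_counit B m) (by simp)
  rw [companionConjointCounit, companionConjointCounit,
    hcomp_vcomp_one _ _ _ (by simp) (by simp), one_hcomp_vcomp _ _ _ (by simp) (by simp),
    vcomp_assoc, ← vcomp_reassoc e₁, vcomp_reassoc e₂, adjunction_counit_coherence,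
    ← vcomp_reassoc e₄, vcomp_reassoc e₅, ← vcomp_reassoc e₃]

end DoubleNatTrans

/-! ### Assembling the adjoint equivalence of pseudo protransformations. -/

namespace DoubleNatTrans

variable {D : Type u} [Category.{v} D] [DoubleCategory.{c, p} D]
  {E : Type u₁} [Category.{v₁} E] [DoubleCategory.{c₁, p₁} E]
  {F G : LaxDoubleFunctor D E} (α : DoubleNatTrans F G)
  (A : ∀ x : D, Companion (α.app x)) (B : ∀ x : D, Conjoint (α.app x))

/-- The companion of a natural transformation as a pseudo protransformation. -/
noncomputable abbrev companionPseudo (h : (α.companionData A).IsPseudo) : PseudoProtrans F G :=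
  (α.companionData A).toPseudo (α.companionData_isOplax A) h

/-- The conjoint of a natural transformation as a pseudo protransformation. -/
abbrev conjointPseudo (h : (α.conjointData B).IsPseudo) : PseudoProtrans G F :=
  ⟨α.conjointData B, α.conjointData_isLax B, h⟩

variable (hA : (α.companionData A).IsPseudo) (hB : (α.conjointData B).IsPseudo)

/-- The modification axiom concerns the companion as a pseudo protransformation, whose comparison is
the inverse `N`. It follows by composing `unit_nat` with `N` whiskered by the conjoint, which
cancels the oplax comparison. -/
theorem unit_pro_naturality {x y : D} (m : Pro x y)
    (N : Cell ((A x).pro ⊙ G.mapPro m) (F.mapPro m ⊙ (A y).pro))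
    (hN : α.companionNat A m ≫ᶜ N = one _) (ht : tgt N = 𝟙 _) :
    hcomp (companionConjointUnit (A x) (B x)).cell (one (F.mapPro m)) (by simp) ≫ᶜ
        assoc (A x).pro (B x).pro (F.mapPro m) ≫ᶜ
        hcomp (one (A x).pro) (α.conjointNat B m) (by simp) ≫ᶜ
        assocInv (A x).pro (G.mapPro m) (B y).pro ≫ᶜ
        hcomp N (one (B y).pro) (by simp [ht]) ≫ᶜ
        assoc (F.mapPro m) (A y).pro (B y).pro =
      (leftUnitor (F.mapPro m) ≫ᶜ rightUnitorInv (F.mapPro m)) ≫ᶜ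
        hcomp (one (F.mapPro m)) (companionConjointUnit (A y) (B y)).cell (by simp) := by
  have e₁ := congrArg (· ≫ᶜ hcomp N (one (B y).pro) (by simp [ht]) ≫ᶜ
    assoc (F.mapPro m) (A y).pro (B y).pro) (α.unit_nat A B m)
  simp only [vcomp_assoc] at e₁ ⊢
  rw [e₁, vcomp_hcomp_assoc (h := by simp) (h' := by simp [ht]),
    hcomp_congr (α' := one _) (β' := one _) _ hN (one_vcomp _), hcomp_one, one_vcomp,
    assocInv_assoc, vcomp_one]

/-- Here `N` is composed in front of `counit_nat` and cancels the oplax comparison from the other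
side. -/
theorem counit_pro_naturality {x y : D} (m : Pro x y)
    (N : Cell ((A x).pro ⊙ G.mapPro m) (F.mapPro m ⊙ (A y).pro))
    (hN : N ≫ᶜ α.companionNat A m = one _) (hs : src N = 𝟙 _) :
    hcomp (companionConjointCounit (A x) (B x)).cell (one (G.mapPro m)) (by simp) ≫ᶜ
        leftUnitor (G.mapPro m) ≫ᶜ rightUnitorInv (G.mapPro m) =
      (assoc (B x).pro (A x).pro (G.mapPro m) ≫ᶜ hcomp (one (B x).pro) N (by simp [hs]) ≫ᶜ
        assocInv (B x).pro (F.mapPro m) (A y).pro ≫ᶜ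
        hcomp (α.conjointNat B m) (one (A y).pro) (by simp) ≫ᶜ
        assoc (G.mapPro m) (B y).pro (A y).pro) ≫ᶜ
        hcomp (one (G.mapPro m)) (companionConjointCounit (A y) (B y)).cell (by simp) := by
  simp only [vcomp_assoc]
  rw [← α.counit_nat A B m, vcomp_hcomp_assoc (h := by simp [hs]) (h' := by simp),
    hcomp_congr (α' := one _) (β' := one _) _ (one_vcomp _) hN, hcomp_one, one_vcomp,
    assoc_assocInv_assoc]

/-- The unit of the adjunction between the companion and the conjoint of a natural
transformation. -/
noncomputable def unitModification : Modification (PseudoProtrans.id F)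
    ((α.companionPseudo A hA).comp (α.conjointPseudo B hB)) :=
  Modification.ofGlobular (fun x => companionConjointUnit (A x) (B x))
    (fun f => α.unit_arr A B f)
    (fun m => α.unit_pro_naturality A B m (((α.companionData A).inverse hA).nat m)
      ((α.companionData A).nat_inverse hA m) (((α.companionData A).inverse hA).tgt_nat m))

/-- The counit of the adjunction between the companion and the conjoint of a natural
transformation. -/
noncomputable def counitModification : Modification
    ((α.conjointPseudo B hB).comp (α.companionPseudo A hA)) (PseudoProtrans.id G) :=
  Modification.ofGlobular (fun x => companionConjointCounit (A x) (B x))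
    (fun f => α.counit_arr A B f)
    (fun m => α.counit_pro_naturality A B m (((α.companionData A).inverse hA).nat m)
      ((α.companionData A).inverse_nat hA m) (((α.companionData A).inverse hA).src_nat m))

/-- Componentwise inverses of a modification satisfy the modification axioms automatically, by
conjugating the original ones. Globularity supplies the identity sides that `Modification.inverse`
expects. -/
theorem _root_.Modification.isInvertible {σ τ : PseudoProtrans F G}
    (μ : Globular (D := LaxPs D E) (x := F) (y := G) σ τ)
    (h : ∀ x, IsInvertible (Modification.app μ.cell x)) : IsInvertible μ.cell := by
  choose ν h₁ h₂ using h
  -- The sides of `μ` are identity transformations, so its components have identity sides; this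
  -- forces the inverse cells `ν x` to be globular.
  have hl : ∀ x, src (Modification.app μ.cell x) = 𝟙 _ := fun x =>
    (Modification.src_app μ.cell x).trans (congrArg (DoubleNatTrans.app · x) μ.src_cell)
  have hr : ∀ x, tgt (Modification.app μ.cell x) = 𝟙 _ := fun x =>
    (Modification.tgt_app μ.cell x).trans (congrArg (DoubleNatTrans.app · x) μ.tgt_cell)
  refine ⟨Modification.inverse μ.cell μ.src_cell μ.tgt_cell
    (fun x => ⟨ν x, ?_, ?_⟩) h₁ h₂, Modification.ext ?_ ?_ (funext h₁),
    Modification.ext ?_ ?_ (funext h₂)⟩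
  · simpa [hl] using congrArg src (h₁ x)
  · simpa [hr] using congrArg tgt (h₁ x)
  · exact (Category.comp_id _).trans μ.src_cell
  · exact (Category.comp_id _).trans μ.tgt_cell
  · exact (Category.id_comp _).trans μ.src_cell
  · exact (Category.id_comp _).trans μ.tgt_cell

/-- The companion and the conjoint of an invertible natural transformation form an adjoint
equivalence. -/
noncomputable def adjointEquivalence [∀ x, IsIso (α.app x)] :
    ProAdjointEquivalence (D := LaxPs D E) (x := F) (y := G)
      (α.companionPseudo A hA) (α.conjointPseudo B hB) where
  unit := ⟨α.unitModification A B hA hB, rfl, rfl⟩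
  counit := ⟨α.counitModification A B hA hB, rfl, rfl⟩
  unit_invertible := Modification.isInvertible _
    fun x => isInvertible_companionConjointUnit (A x) (B x)
  counit_invertible := Modification.isInvertible _
    fun x => isInvertible_companionConjointCounit (A x) (B x)
  triangle_left := by
    -- The two sides of the composite modification are composites of five identities; only the
    -- components carry content, and there the claim is the triangle identity for a single arrow.
    refine Modification.ext ?_ ?_ ?_
    · have e : (𝟙 F ≫ 𝟙 F ≫ 𝟙 F ≫ 𝟙 F ≫ 𝟙 F : F ⟶ F) = 𝟙 F := by simp only [Category.id_comp]
      exact e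
    · have e : (𝟙 G ≫ 𝟙 G ≫ 𝟙 G ≫ 𝟙 G ≫ 𝟙 G : G ⟶ G) = 𝟙 G := by simp only [Category.id_comp]
      exact e
    · funext x
      exact companionConjoint_triangle_left (A x) (B x)
  triangle_right := by
    refine Modification.ext ?_ ?_ ?_
    · have e : (𝟙 G ≫ 𝟙 G ≫ 𝟙 G ≫ 𝟙 G ≫ 𝟙 G : G ⟶ G) = 𝟙 G := by simp only [Category.id_comp]
      exact e
    · have e : (𝟙 F ≫ 𝟙 F ≫ 𝟙 F ≫ 𝟙 F ≫ 𝟙 F : F ⟶ F) = 𝟙 F := by simp only [Category.id_comp]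
      exact e
    · funext x
      exact companionConjoint_triangle_right (A x) (B x)

end DoubleNatTrans

/-! ## Normal lax double functors preserve companions and conjoints -/

namespace LaxDoubleFunctor

variable {D : Type u} [Category.{v} D] [DoubleCategory.{c, p} D]
  {E : Type u₁} [Category.{v₁} E] [DoubleCategory.{c₁, p₁} E] (F : LaxDoubleFunctor D E)

/-- The unit is transported with the comparison `id → F id`, but the counit needs a map `F id → id`;
normality provides it as the inverse comparison. -/
theorem nonempty_companion (hF : F.IsNormal) {x y : D} {f : x ⟶ y} (A : Companion f) :
    Nonempty (Companion (F.map f)) := by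
  obtain ⟨ν, h₁, h₂⟩ := hF y
  have hs : src ν = 𝟙 _ := by simpa using congrArg src h₁
  have ht : tgt ν = 𝟙 _ := by simpa using congrArg tgt h₁
  refine ⟨⟨F.mapPro A.pro, F.lunit x ≫ᶜ F.mapCell A.unit, F.mapCell A.counit ≫ᶜ ν,
    by simp, by simp, by simp [hs], by simp [ht], ?_, ?_⟩⟩
  -- Expanding the right unitor by `lunit_right` produces the comparison at `y`, which cancels `ν`.
  -- The remaining cells form the image under `F` of the external companion identity, by naturality
  -- of the composition comparison and `glob_left`.
  · have e₁ : hcomp (F.lunit x ≫ᶜ F.mapCell A.unit) (F.mapCell A.counit ≫ᶜ ν) (by simp [hs]) ≫ᶜ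
          hcomp (one (F.mapPro A.pro)) (F.lunit y) (by simp) =
        hcomp (F.lunit x) (one (F.mapPro A.pro)) (by simp) ≫ᶜ
          hcomp (F.mapCell A.unit) (F.mapCell A.counit) (by simp) := by
      rw [vcomp_hcomp, vcomp_hcomp]
      exact hcomp_congr _ (by simp) (by simp [h₂])
    rw [← F.lunit_right, vcomp_reassoc e₁, vcomp_reassoc (F.lcomp_naturality A.unit A.counit
      (by simp)), ← F.mapCell_vcomp, ← vcomp_assoc (hcomp _ _ _), ← vcomp_assoc (leftUnitorInv _),
      ← F.glob_left, ← F.mapCell_vcomp, A.hcomp_eq, mapCell_one]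
  · rw [vcomp_assoc, ← vcomp_assoc (F.mapCell _), ← F.mapCell_vcomp, A.vcomp_eq,
      ← vcomp_assoc, ← F.lunit_naturality, vcomp_assoc, h₁, vcomp_one]

/-- Mirror image of the argument for companions: the left unitor is expanded instead, and
`glob_right` recognises the remaining comparison. -/
theorem nonempty_conjoint (hF : F.IsNormal) {x y : D} {f : x ⟶ y} (B : Conjoint f) :
    Nonempty (Conjoint (F.map f)) := by
  obtain ⟨ν, h₁, h₂⟩ := hF y
  have hs : src ν = 𝟙 _ := by simpa using congrArg src h₁
  have ht : tgt ν = 𝟙 _ := by simpa using congrArg tgt h₁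
  refine ⟨⟨F.mapPro B.pro, F.lunit x ≫ᶜ F.mapCell B.unit, F.mapCell B.counit ≫ᶜ ν,
    by simp, by simp, by simp [hs], by simp [ht], ?_, ?_⟩⟩
  · have e₁ : hcomp (F.mapCell B.counit ≫ᶜ ν) (F.lunit x ≫ᶜ F.mapCell B.unit) (by simp [ht]) ≫ᶜ
          hcomp (F.lunit y) (one (F.mapPro B.pro)) (by simp) =
        hcomp (one (F.mapPro B.pro)) (F.lunit x) (by simp) ≫ᶜ
          hcomp (F.mapCell B.counit) (F.mapCell B.unit) (by simp) := by
      rw [vcomp_hcomp, vcomp_hcomp]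
      exact hcomp_congr _ (by simp [h₂]) (by simp)
    rw [← F.lunit_left, vcomp_reassoc e₁, vcomp_reassoc (F.lcomp_naturality B.counit B.unit
      (by simp)), ← F.mapCell_vcomp, ← vcomp_assoc (hcomp _ _ _), ← vcomp_assoc (rightUnitorInv _),
      ← F.glob_right, ← F.mapCell_vcomp, B.hcomp_eq, mapCell_one]
  · rw [vcomp_assoc, ← vcomp_assoc (F.mapCell _), ← F.mapCell_vcomp, B.vcomp_eq,
      ← vcomp_assoc, ← F.lunit_naturality, vcomp_assoc, h₁, vcomp_one]

end LaxDoubleFunctor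

/-! ## Adjunctions of double categories -/

namespace DoubleAdjunction

variable {D : Type u} [Category.{v} D] [DoubleCategory.{c, p} D]
  {E : Type u₁} [Category.{v₁} E] [DoubleCategory.{c₁, p₁} E]
  {L : LaxDoubleFunctor D E} {R : LaxDoubleFunctor E D} (adj : DoubleAdjunction L R)

/-- The unit of an adjunction at an object. -/
def unitApp (a : D) : a ⟶ R.obj (L.obj a) := adj.unit.app a

/-- The counit of an adjunction at an object. -/
def counitApp (b : E) : L.obj (R.obj b) ⟶ b := adj.counit.app b

/-- The unit of an adjunction at a proarrow. -/
def unitCell {x y : D} (m : Pro x y) : Cell m (R.mapPro (L.mapPro m)) := adj.unit.cell m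

/-- The counit of an adjunction at a proarrow. -/
def counitCell {x y : E} (m : Pro x y) : Cell (L.mapPro (R.mapPro m)) m := adj.counit.cell m

/-- Restated through the accessors, whose types mention `L` and `R` directly instead of a composite
functor, so that the equation is usable for rewriting. -/
theorem counitApp_naturality {a b : E} (f : a ⟶ b) :
    L.map (R.map f) ≫ adj.counitApp b = adj.counitApp a ≫ f := adj.counit.naturality f

theorem counitCell_naturality {x y x' y' : E} {m : Pro x y} {m' : Pro x' y'} (γ : Cell m m') :
    L.mapCell (R.mapCell γ) ≫ᶜ adj.counitCell m' = adj.counitCell m ≫ᶜ γ :=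
  adj.counit.cell_naturality γ

/-- Naturality of the unit at `g` and the right triangle identity show that transposing twice
recovers `g`. Hence transposition is injective, which is the content of `hom_ext`. -/
theorem eq_unitApp_map {a : D} {b : E} (g : a ⟶ R.obj b) :
    g = adj.unitApp a ≫ R.map (L.map g ≫ adj.counitApp b) := by
  have e₁ : g ≫ adj.unitApp (R.obj b) = adj.unitApp a ≫ R.map (L.map g) := adj.unit.naturality g
  have e₂ : adj.unitApp (R.obj b) ≫ R.map (adj.counitApp b) = 𝟙 _ := adj.right_triangle b
  rw [R.map_comp, ← Category.assoc, ← e₁, Category.assoc, e₂, Category.comp_id]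

theorem eq_unitCell_map {x y : D} {x' y' : E} {m : Pro x y} {n : Pro x' y'}
    (γ : Cell m (R.mapPro n)) :
    γ = adj.unitCell m ≫ᶜ R.mapCell (L.mapCell γ ≫ᶜ adj.counitCell n) := by
  have e₁ : γ ≫ᶜ adj.unitCell (R.mapPro n) = adj.unitCell m ≫ᶜ R.mapCell (L.mapCell γ) :=
    adj.unit.cell_naturality γ
  have e₂ : adj.unitCell (R.mapPro n) ≫ᶜ R.mapCell (adj.counitCell n) = one _ :=
    adj.right_triangle_cell n
  rw [R.mapCell_vcomp, ← vcomp_assoc, ← e₁, vcomp_assoc, e₂, vcomp_one]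

theorem hom_ext {a : D} {b : E} {g g' : a ⟶ R.obj b}
    (h : L.map g ≫ adj.counitApp b = L.map g' ≫ adj.counitApp b) : g = g' := by
  rw [adj.eq_unitApp_map g, h, ← adj.eq_unitApp_map g']

theorem cell_ext {x y : D} {x' y' : E} {m : Pro x y} {n : Pro x' y'}
    {γ γ' : Cell m (R.mapPro n)}
    (h : L.mapCell γ ≫ᶜ adj.counitCell n = L.mapCell γ' ≫ᶜ adj.counitCell n) : γ = γ' := by
  rw [adj.eq_unitCell_map γ, h, ← adj.eq_unitCell_map γ']

/-- The transpose of an arrow. -/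
def transpose {a : D} {b : E} (h : L.obj a ⟶ b) : a ⟶ R.obj b := adj.unitApp a ≫ R.map h

/-- The transpose of a cell. -/
def transposeCell {x y : D} {x' y' : E} {m : Pro x y} {n : Pro x' y'} (γ : Cell (L.mapPro m) n) :
    Cell m (R.mapPro n) := adj.unitCell m ≫ᶜ R.mapCell γ

/-- Naturality of the counit and the left triangle identity give existence in the universal
property, complementing the uniqueness in `hom_ext`. -/
theorem map_transpose {a : D} {b : E} (h : L.obj a ⟶ b) :
    L.map (adj.transpose h) ≫ adj.counitApp b = h := by
  have e : L.map (adj.unitApp a) ≫ adj.counitApp (L.obj a) = 𝟙 _ := adj.left_triangle a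
  rw [transpose, L.map_comp, Category.assoc, counitApp_naturality, ← Category.assoc, e,
    Category.id_comp]

theorem mapCell_transposeCell {x y : D} {x' y' : E} {m : Pro x y} {n : Pro x' y'}
    (γ : Cell (L.mapPro m) n) :
    L.mapCell (adj.transposeCell γ) ≫ᶜ adj.counitCell n = γ := by
  have e : L.mapCell (adj.unitCell m) ≫ᶜ adj.counitCell (L.mapPro m) = one _ :=
    adj.left_triangle_cell m
  rw [transposeCell, L.mapCell_vcomp, vcomp_assoc, counitCell_naturality, ← vcomp_assoc, e,
    one_vcomp]

end DoubleAdjunction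

/-! ## Companions and conjoints of reindexing arrows of families -/

namespace Fam

variable {D : Type u} [Category.{v} D] [DoubleCategory.{c, p} D] {κ : IndexKind}
  {I J : Type w} (hI : κ.Mem I) (hJ : κ.Mem J) (f : J → I) (x : I → D)

/-- The companion of a reindexing arrow of families. -/
def reindexCompanion : Companion ((reindexTrans D κ hI hJ f).app x) where
  pro :=
    -- This is the graph span `I ← J → J` given by fibres: the fibre over `(i, j)` is a point when
    -- `i = f j` and empty otherwise. It carries external identities, and the unit and counit below
    -- consist of identity cells.
    { idx := fun (i : I) (j : J) => IdSpan i (f j)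
      mem := fun (i : I) (j : J) => κ.mem_of_finite (IdSpan i (f j))
      pro := fun b => IdSpan.pro (fun i => pid (x i)) b }
  unit :=
    { src := 𝟙 _
      tgt := ⟨f, fun j => 𝟙 (x (f j))⟩
      idx := fun b => b
      cell := fun _ => one _
      src_cell := fun _ => src_one _
      tgt_cell := fun _ => tgt_one _ }
  counit :=
    { src := ⟨f, fun j => 𝟙 (x (f j))⟩
      tgt := 𝟙 _
      idx := fun b => IdSpan.map f b
      cell := fun b => IdSpan.cell (m := fun i => pid (x i)) (m' := fun j => pid (x (f j))) f
        (fun j => one (pid (x (f j)))) b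
      src_cell := by rintro _ _ ⟨⟩; exact src_one _
      tgt_cell := by rintro _ _ ⟨⟩; exact tgt_one _ }
  src_unit := rfl
  tgt_unit := rfl
  src_counit := rfl
  tgt_counit := rfl
  hcomp_eq := by
    apply Fam.Square.ext_sigma
    · funext
      exact (Category.id_comp _).trans (Category.id_comp _)
    · funext
      exact (Category.id_comp _).trans (Category.id_comp _)
    · intro k l b
      -- Exposing the fibre as an `IdSpan` lets case analysis replace `k` by `f l`, leaving one
      -- unitor computation on an external identity of `D`.
      change IdSpan k (f l) at b
      cases b
      exact Sigma.ext rfl (heq_of_eq (by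
        have e : leftUnitorInv (pid (x (f l))) ≫ᶜ
          hcomp (one (pid (x (f l)))) (one (pid (x (f l)))) (by simp) ≫ᶜ
          rightUnitor (pid (x (f l))) = one _ := by simp [leftUnitorInv_pid]
        exact e))
  vcomp_eq := by
    apply Fam.Square.ext_sigma
    · funext
      exact Category.id_comp _
    · funext
      exact Category.id_comp _
    · rintro _ _ ⟨⟩
      exact Sigma.ext rfl (heq_of_eq ((one_vcomp _).trans (pidMap_id _).symm))

/-- The conjoint of a reindexing arrow of families. -/
def reindexConjoint : Conjoint ((reindexTrans D κ hI hJ f).app x) where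
  pro :=
    -- The reversed graph span `J ← J → I`, again carrying external identities.
    { idx := fun (j : J) (i : I) => IdSpan (f j) i
      mem := fun (j : J) (i : I) => κ.mem_of_finite (IdSpan (f j) i)
      pro := fun b => IdSpan.pro (fun i => pid (x i)) b }
  unit :=
    { src := ⟨f, fun j => 𝟙 (x (f j))⟩
      tgt := 𝟙 _
      idx := fun b => b
      cell := fun _ => one _
      src_cell := fun _ => src_one _
      tgt_cell := fun _ => tgt_one _ }
  counit :=
    { src := 𝟙 _
      tgt := ⟨f, fun j => 𝟙 (x (f j))⟩
      idx := fun b => IdSpan.map f b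
      cell := fun b => IdSpan.cell (m := fun i => pid (x i)) (m' := fun j => pid (x (f j))) f
        (fun j => one (pid (x (f j)))) b
      src_cell := by rintro _ _ ⟨⟩; exact src_one _
      tgt_cell := by rintro _ _ ⟨⟩; exact tgt_one _ }
  src_unit := rfl
  tgt_unit := rfl
  src_counit := rfl
  tgt_counit := rfl
  hcomp_eq := by
    apply Fam.Square.ext_sigma
    · funext
      exact (Category.id_comp _).trans (Category.id_comp _)
    · funext
      exact (Category.id_comp _).trans (Category.id_comp _)
    · intro k l b
      change IdSpan (f k) l at b
      cases b
      exact Sigma.ext rfl (heq_of_eq (by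
        have e : rightUnitorInv (pid (x (f k))) ≫ᶜ
          hcomp (one (pid (x (f k)))) (one (pid (x (f k)))) (by simp) ≫ᶜ
          leftUnitor (pid (x (f k))) = one _ := by simp [leftUnitor_pid]
        exact e))
  vcomp_eq := by
    apply Fam.Square.ext_sigma
    · funext
      exact Category.id_comp _
    · funext
      exact Category.id_comp _
    · rintro _ _ ⟨⟩
      exact Sigma.ext rfl (heq_of_eq ((one_vcomp _).trans (pidMap_id _).symm))

end Fam

/-! ## The universal property of products -/

namespace LaxProducts

variable {D : Type u} [Category.{v} D] [DoubleCategory.{c, p} D] {κ : IndexKind}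
  (P : LaxProducts.{w} D κ) {I J : Type w} (hI : κ.Mem I) (hJ : κ.Mem J)

/-- An arrow from a one-member family has a forced index function, so equality of all its components
is equality of transposes. -/
theorem hom_ext {a : D} {x : I → D} {g g' : a ⟶ (P.pi hI).obj x}
    (h : ∀ i, g ≫ P.proj hI x i = g' ≫ P.proj hI x i) : g = g' := by
  have e : (diagonal.{w} D κ).map g ≫ P.adj.counitApp ⟨I, hI, x⟩ =
      (diagonal.{w} D κ).map g' ≫ P.adj.counitApp ⟨I, hI, x⟩ :=
    Fam.Hom.ext rfl (heq_of_eq (funext h))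
  exact P.adj.hom_ext e

/-- Index data landing in a one-element set are unique, every element of an identity span is
diagonal, and the side arrows are the sides of the diagonal cells. The diagonal cells therefore
determine the whole square. -/
theorem _root_.Fam.Square.single_parallel_ext {a b : D} {q : Pro a b} {x y : I → D}
    {m : ∀ i, Pro (x i) (y i)} {S S' : Fam.Square (Fam.single.{w} κ q) (Fam.parallel hI m)}
    (h : ∀ i, (S.cell (IdSpan.refl i) : Cell q (m i)) = S'.cell (IdSpan.refl i)) : S = S' := by
  have hs : ∀ i, (S.src.arr i : a ⟶ x i) = S'.src.arr i := fun i =>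
    (S.src_cell (IdSpan.refl i)).symm.trans
      ((congrArg src (h i)).trans (S'.src_cell (IdSpan.refl i)))
  have ht : ∀ i, (S.tgt.arr i : b ⟶ y i) = S'.tgt.arr i := fun i =>
    (S.tgt_cell (IdSpan.refl i)).symm.trans
      ((congrArg tgt (h i)).trans (S'.tgt_cell (IdSpan.refl i)))
  obtain ⟨⟨s, sa⟩, ⟨t, ta⟩, e, γ, h₁, h₂⟩ := S
  obtain ⟨⟨s', sa'⟩, ⟨t', ta'⟩, e', γ', h₁', h₂'⟩ := S'
  obtain rfl : s' = s := funext fun _ => PUnit.ext _ _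
  obtain rfl : t' = t := funext fun _ => PUnit.ext _ _
  obtain rfl : @e' = @e := funext fun _ => funext fun _ => funext fun _ => PUnit.ext _ _
  refine Fam.Square.ext_cell (m := Fam.single.{w} κ q) (n := Fam.parallel hI m)
    (sa := sa) (sa' := sa') (ta := ta) (ta' := ta') (i := e') (f := γ) (f' := γ')
    (funext hs) (funext ht) ?_
  intro k l b
  change IdSpan k l at b
  cases b
  exact h _

/-- The cell version of `hom_ext`: the components of the transposed square are the composites with
the projection cells. -/
theorem cell_ext {a b : D} {q : Pro a b} {x y : I → D} {m : ∀ i, Pro (x i) (y i)}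
    {γ γ' : Cell q ((P.pi hI).mapPro m)}
    (h : ∀ i, γ ≫ᶜ P.projCell hI m i = γ' ≫ᶜ P.projCell hI m i) : γ = γ' := by
  have e : (diagonal.{w} D κ).mapCell γ ≫ᶜ P.adj.counitCell (Fam.parallel hI m) =
      (diagonal.{w} D κ).mapCell γ' ≫ᶜ P.adj.counitCell (Fam.parallel hI m) :=
    Fam.Square.single_parallel_ext hI h
  exact P.adj.cell_ext e

/-- The arrow into a product with given components. -/
def lift {a : D} {x : I → D} (g : ∀ i, a ⟶ x i) : a ⟶ (P.pi hI).obj x :=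
  P.adj.transpose (b := ⟨I, hI, x⟩) (⟨fun _ => PUnit.unit, g⟩ : Fam.Hom _ _)

theorem lift_proj {a : D} {x : I → D} (g : ∀ i, a ⟶ x i) (i : I) :
    P.lift hI g ≫ P.proj hI x i = g i := by
  have e := P.adj.map_transpose (a := a) (b := ⟨I, hI, x⟩)
    (⟨fun _ => PUnit.unit, g⟩ : Fam.Hom _ _)
  -- The type of a component depends on the index function, so the equation is substituted for
  -- arbitrary equal arrows instead of being rewritten in place.
  have key : ∀ h h' : Fam.Hom ((diagonal.{w} D κ).obj a) ⟨I, hI, x⟩, h = h' →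
      (h.arr i : a ⟶ x i) = h'.arr i := by
    rintro _ _ rfl
    rfl
  exact key _ _ e

theorem _root_.Fam.Square.congr_cell_refl {a b : D} {q : Pro a b} {x y : I → D}
    {m : ∀ i, Pro (x i) (y i)} {S S' : Fam.Square (Fam.single.{w} κ q) (Fam.parallel hI m)}
    (h : S = S') (i : I) : (S.cell (IdSpan.refl i) : Cell q (m i)) = S'.cell (IdSpan.refl i) := by
  subst h
  rfl

/-- The cell into a product with given components. -/
def liftCell {a b : D} {q : Pro a b} {x y : I → D} {m : ∀ i, Pro (x i) (y i)}
    (γ : ∀ i, Cell q (m i)) : Cell q ((P.pi hI).mapPro m) :=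
  P.adj.transposeCell (m := q) (n := Fam.parallel hI m)
    ({ src := ⟨fun _ => PUnit.unit, fun i => src (γ i)⟩
       tgt := ⟨fun _ => PUnit.unit, fun i => tgt (γ i)⟩
       idx := fun _ => PUnit.unit
       cell := fun {k l} b => match k, l, b with
        | _, _, .refl i => γ i
       src_cell := by rintro _ _ ⟨⟩; rfl
       tgt_cell := by rintro _ _ ⟨⟩; rfl } :
      Fam.Square (Fam.single.{w} κ q) (Fam.parallel hI m))

theorem liftCell_projCell {a b : D} {q : Pro a b} {x y : I → D} {m : ∀ i, Pro (x i) (y i)}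
    (γ : ∀ i, Cell q (m i)) (i : I) : P.liftCell hI γ ≫ᶜ P.projCell hI m i = γ i :=
  Fam.Square.congr_cell_refl hI (P.adj.mapCell_transposeCell (m := q) _) i

variable (f : J → I)

/-- This is the component at `j` of naturality of the counit at the reindexing arrow, whose own
component there is an identity. -/
theorem structureTrans_app_proj (x : I → D) (j : J) :
    (P.structureTrans hI hJ f).app x ≫ P.proj hJ (fun j => x (f j)) j = P.proj hI x (f j) := by
  have e := P.adj.counitApp_naturality ((reindexTrans D κ hI hJ f).app x)
  have key : ∀ h h' : Fam.Hom ((diagonal.{w} D κ).obj ((P.pi hI).obj x))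
      ⟨J, hJ, fun j => x (f j)⟩, h = h' →
      (h.arr j : (P.pi hI).obj x ⟶ x (f j)) = h'.arr j := by
    rintro _ _ rfl
    rfl
  exact (key _ _ e).trans (Category.comp_id _)

/-- Naturality of the counit at the reindexing cell, read at the diagonal element over `j`. -/
theorem structureTrans_cell_projCell {x y : I → D} (m : ∀ i, Pro (x i) (y i)) (j : J) :
    (P.structureTrans hI hJ f).cell m ≫ᶜ P.projCell hJ (fun j => m (f j)) j =
      P.projCell hI m (f j) :=
  (Fam.Square.congr_cell_refl hJ (P.adj.counitCell_naturality
    ((reindexTrans D κ hI hJ f).cell m)) j).trans (vcomp_one _)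

/-- The identity cell between members of a family of proarrows at equal indices. -/
def _root_.DoubleCategory.cellOfEq {x y : I → D} (m : ∀ i, Pro (x i) (y i)) {i i' : I}
    (h : i = i') : Cell (m i) (m i') :=
  match i, i', h with
  | _, _, rfl => one _

theorem proj_eqToHom (x : I → D) {i i' : I} (h : i = i') :
    P.proj hI x i ≫ eqToHom (congrArg x h) = P.proj hI x i' := by
  subst h
  exact Category.comp_id _

theorem projCell_cellOfEq {x y : I → D} (m : ∀ i, Pro (x i) (y i)) {i i' : I} (h : i = i') :
    P.projCell hI m i ≫ᶜ cellOfEq m h = P.projCell hI m i' := by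
  subst h
  exact vcomp_one _

variable {f}

/-- An inverse is built from projections along the inverse function and checked against projections
on both products. -/
theorem isIso_structureTrans_app (hf : Function.Bijective f) (x : I → D) :
    IsIso ((P.structureTrans hI hJ f).app x) := by
  obtain ⟨g, hl, hr⟩ := Function.bijective_iff_has_inverse.1 hf
  -- The projection at `g i` lands in `x (f (g i))`, which equals `x i` only propositionally;
  -- `eqToHom` bridges the gap.
  let k : (P.pi hJ).obj (fun j => x (f j)) ⟶ (P.pi hI).obj x :=
    P.lift hI fun i => P.proj hJ (fun j => x (f j)) (g i) ≫ eqToHom (congrArg x (hr i))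
  refine ⟨k, ?_, ?_⟩
  · refine P.hom_ext hI fun i => ?_
    have e : (P.structureTrans hI hJ f).app x ≫ P.proj hJ (fun j => x (f j)) (g i) ≫
        eqToHom (congrArg x (hr i)) = P.proj hI x i :=
      (Category.assoc _ _ _).symm.trans ((congrArg (· ≫ eqToHom _)
        (P.structureTrans_app_proj hI hJ f x (g i))).trans (P.proj_eqToHom hI x (hr i)))
    exact (Category.assoc _ _ _).trans ((congrArg (_ ≫ ·) (P.lift_proj hI _ i)).trans
      (e.trans (Category.id_comp _).symm))
  · refine P.hom_ext hJ fun j => ?_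
    exact (Category.assoc _ _ _).trans
      ((congrArg (k ≫ ·) (P.structureTrans_app_proj hI hJ f x j)).trans
      ((P.lift_proj hI _ (f j)).trans ((P.proj_eqToHom hJ (fun j => x (f j)) (hl j)).trans
      (Category.id_comp _).symm)))

/-- The same construction for cells, with `cellOfEq` playing the role of `eqToHom`. -/
theorem isInvertible_structureTrans_cell (hf : Function.Bijective f) {x y : I → D}
    (m : ∀ i, Pro (x i) (y i)) : IsInvertible ((P.structureTrans hI hJ f).cell m) := by
  obtain ⟨g, hl, hr⟩ := Function.bijective_iff_has_inverse.1 hf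
  let k : Cell ((P.pi hJ).mapPro (fun j => m (f j))) ((P.pi hI).mapPro m) :=
    P.liftCell hI fun i => P.projCell hJ (fun j => m (f j)) (g i) ≫ᶜ cellOfEq m (hr i)
  refine ⟨k, ?_, ?_⟩
  · refine P.cell_ext hI fun i => ?_
    have e : (P.structureTrans hI hJ f).cell m ≫ᶜ P.projCell hJ (fun j => m (f j)) (g i) ≫ᶜ
        cellOfEq m (hr i) = P.projCell hI m i :=
      (vcomp_assoc _ _ _).symm.trans ((congrArg (· ≫ᶜ cellOfEq m (hr i))
        (P.structureTrans_cell_projCell hI hJ f m (g i))).trans (P.projCell_cellOfEq hI m (hr i)))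
    exact (vcomp_assoc _ _ _).trans ((congrArg (_ ≫ᶜ ·) (P.liftCell_projCell hI _ i)).trans
      (e.trans (one_vcomp _).symm))
  · refine P.cell_ext hJ fun j => ?_
    have e : P.projCell hJ (fun j => m (f j)) (g (f j)) ≫ᶜ cellOfEq m (hr (f j)) =
        P.projCell hJ (fun j => m (f j)) j := by
      -- The transport is along an equality in `I`, while the projections are indexed by `J`.
      -- Generalising the endpoint in `J` makes both equalities reflexive at once.
      have : ∀ {j j' : J} (h : j = j') (h' : f j = f j'),
          P.projCell hJ (fun j => m (f j)) j ≫ᶜ cellOfEq m h' =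
            P.projCell hJ (fun j => m (f j)) j' := by
        rintro j _ rfl _
        exact vcomp_one _
      exact this (hl j) _
    exact (vcomp_assoc _ _ _).trans
      ((congrArg (k ≫ᶜ ·) (P.structureTrans_cell_projCell hI hJ f m j)).trans
      ((P.liftCell_projCell hI _ (f j)).trans (e.trans (one_vcomp _).symm)))

end LaxProducts

theorem mainTheorem10 {D : Type u} [Category.{v} D] [DoubleCategory.{c, p} D] (κ : IndexKind)
    (P : LaxProducts.{w} D κ) (hP : P.IsNormal) {I J : Type w} (hI : κ.Mem I) (hJ : κ.Mem J)
    (f₀ : J → I) :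
    -- the structure arrows and cells are the unique ones compatible with the projections
    (∀ (x : I → D) (g : (P.pi hI).obj x ⟶ (P.pi hJ).obj (fun j => x (f₀ j))),
      (∀ j, g ≫ P.proj hJ (fun j => x (f₀ j)) j = P.proj hI x (f₀ j)) ↔
        g = (P.structureTrans hI hJ f₀).app x) ∧
    (∀ (x y : I → D) (m : ∀ i, Pro (x i) (y i))
      (γ : Cell ((P.pi hI).mapPro m) ((P.pi hJ).mapPro (fun j => m (f₀ j)))),
      (∀ j, γ ≫ᶜ P.projCell hJ (fun j => m (f₀ j)) j = P.projCell hI m (f₀ j)) ↔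
        γ = (P.structureTrans hI hJ f₀).cell m) ∧
    -- the structure arrows have companions and conjoints
    (∀ x : I → D, Nonempty (Companion ((P.structureTrans hI hJ f₀).app x)) ∧
      Nonempty (Conjoint ((P.structureTrans hI hJ f₀).app x))) ∧
    -- for any choice of companions, the reshaped structure cells form an oplax protransformation
    (∀ A : ∀ x : I → D, Companion ((P.structureTrans hI hJ f₀).app x),
      ((P.structureTrans hI hJ f₀).companionData A).IsOplax) ∧
    -- for any choice of conjoints, the reshaped structure cells form a lax protransformation
    (∀ B : ∀ x : I → D, Conjoint ((P.structureTrans hI hJ f₀).app x),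
      ((P.structureTrans hI hJ f₀).conjointData B).IsLax) ∧
    -- for a bijection, both are pseudo, and they form an adjoint equivalence
    (Function.Bijective f₀ →
      ∀ (A : ∀ x : I → D, Companion ((P.structureTrans hI hJ f₀).app x))
        (B : ∀ x : I → D, Conjoint ((P.structureTrans hI hJ f₀).app x)),
        ∃ (h₁ : ((P.structureTrans hI hJ f₀).companionData A).IsOplax)
          (h₂ : ((P.structureTrans hI hJ f₀).companionData A).IsPseudo)
          (h₃ : ((P.structureTrans hI hJ f₀).conjointData B).IsLax)
          (h₄ : ((P.structureTrans hI hJ f₀).conjointData B).IsPseudo),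
          Nonempty (ProAdjointEquivalence (D := LaxPs (I → D) D)
            (x := P.pi hI) (y := (reindex D f₀).comp (P.pi hJ))
            (((P.structureTrans hI hJ f₀).companionData A).toPseudo h₁ h₂)
            (⟨(P.structureTrans hI hJ f₀).conjointData B, h₃, h₄⟩ :
              PseudoProtrans ((reindex D f₀).comp (P.pi hJ)) (P.pi hI)))) := by
  refine ⟨fun x g => ⟨fun h => P.hom_ext hJ fun j =>
      (h j).trans (P.structureTrans_app_proj hI hJ f₀ x j).symm, ?_⟩,
    fun x y m γ => ⟨fun h => P.cell_ext hJ fun j =>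
      (h j).trans (P.structureTrans_cell_projCell hI hJ f₀ m j).symm, ?_⟩,
    -- By definition the structure arrow is the product functor applied to the reindexing arrow of
    -- families, so preservation by a normal functor applies directly.
    fun x => ⟨P.prod.nonempty_companion hP (Fam.reindexCompanion hI hJ f₀ x),
      P.prod.nonempty_conjoint hP (Fam.reindexConjoint hI hJ f₀ x)⟩,
    fun A => DoubleNatTrans.companionData_isOplax _ A,
    fun B => DoubleNatTrans.conjointData_isLax _ B, fun hf A B => ?_⟩
  · rintro rfl j
    exact P.structureTrans_app_proj hI hJ f₀ x j
  · rintro rfl j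
    exact P.structureTrans_cell_projCell hI hJ f₀ m j
  -- Bijectivity enters through invertibility of the structure arrows and cells; the rest holds for
  -- any natural transformation with invertible components.
  · have : ∀ x, IsIso ((P.structureTrans hI hJ f₀).app x) :=
      P.isIso_structureTrans_app hI hJ hf
    have hc : ∀ {x y : I → D} (m : Pro x y),
        IsInvertible ((P.structureTrans hI hJ f₀).cell m) :=
      P.isInvertible_structureTrans_cell hI hJ hf
    exact ⟨_, DoubleNatTrans.companionData_isPseudo _ A hc, _,
      DoubleNatTrans.conjointData_isPseudo _ B hc,
      ⟨DoubleNatTrans.adjointEquivalence _ A B _ _⟩⟩
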